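/- All manifolds are smooth, finite-dimensional, Hausdorff and second countable. Let $\mathcal F$ be a singular foliation on a manifold $M$, i.e. a locally finitely generated $C^\infty(M)$-submodule of the module $\mathfrak X(M)$ of smooth vector fields which is stable under the Lie bracket; a vector field on an open set $W\subset M$ is said to belong to $\mathcal F|_W$ if near every point of $W$ it coincides with an element of $\mathcal F$. Let $L$ be a locally closed leaf of $\mathcal F$, with its structure of embedded submanifold of $M$. A complete Ehresmann $\mathcal F$-connection near $L$ is a triple $(M_L,p,H)$ where $M_L$ is an open neighbourhood of $L$ in $M$, $p\colon M_L\to L$ is a smooth submersion with $p|_L=\mathrm{id}_L$, and $H\subset TM_L$ is a smooth subbundle with $H\oplus\ker(dp)=TM_L$, all of whose (local) sections belong to $\mathcal F$, such that, for every vector field $b\in\mathfrak X(L)$ with horizontal lift $\tilde b$ (the unique section of $H$ that is $p$-related to $b$) and every $m\in M_L$, the integral curve of $\tilde b$ in $M_L$ starting at $m$ is defined on an open interval containing $0$ if and only if the integral curve of $b$ starting at $p(m)$ is. For $\ell\in L$ let $\mathcal T_\ell$ be the restriction of $\mathcal F$ to the embedded submanifold $p^{-1}(\ell)$, i.e. the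 vector fields on $p^{-1}(\ell)$ that are locally restrictions of elements of $\mathcal F$ that are tangent to $p^{-1}(\ell)$. **Proposition.** Let $(M_L,p,H)$ be a complete Ehresmann $\mathcal F$-connection near a locally closed leaf $L$. Then every $\ell\in L$ has an open neighbourhood $U\subset L$ for which there exists a diffeomorphism $\Phi\colon p^{-1}(U)\to U\times p^{-1}(\ell)$ whose first component is $p$ and which intertwines $\mathcal F|_{p^{-1}(U)}$ with the direct product foliation $\mathfrak X(U)\times\mathcal T_\ell$ (the vector fields on $U\times p^{-1}(\ell)$ that are locally $C^\infty$-linear combinations of vector fields $(b,0)$ with $b\in\mathfrak X(U)$ and $(0,Y)$ with $Y\in\mathcal T_\ell$): a vector field $X$ on $p^{-1}(U)$ belongs to $\mathcal F|_{p^{-1}(U)}$ if and only if $\Phi_*X$ belongs to $\mathfrak X(U)\times\mathcal T_\ell$. -/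

import Mathlib

open Set Filter Topology Manifold
open scoped ContDiff

namespace SingFol

section Basic

variable {E : Type*} [NormedAddCommGroup E] [NormedSpace ℝ E]
  {H : Type*} [TopologicalSpace H] (I : ModelWithCorners ℝ E H)
  (M : Type*) [TopologicalSpace M] [ChartedSpace H M]

/-- A (not necessarily smooth) vector field on `M`: a section of the tangent bundle. When only its
values along a subset of `M` matter, the other values are junk. -/
abbrev VField : Type _ := (x : M) → TangentSpace I x

variable {M}

/-- The vector field `X` is smooth on the (open) set `s`. -/
def SmoothVFieldOn [IsManifold I ∞ M] (X : VField I M) (s : Set M) : Prop :=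
  ContMDiffOn I I.tangent ∞ (fun x => (⟨x, X x⟩ : TangentBundle I M)) s

/-- All vector fields on the open set `U`, i.e. the full foliation `𝔛(U)` of `U`. -/
def fullFoliation [IsManifold I ∞ M] (U : Set M) : Set (VField I M) :=
  {X | SmoothVFieldOn I X U}

variable (M) in
/-- A singular foliation on `M`: a locally finitely generated `C^∞(M)`-submodule of the module of
smooth vector fields of `M` which is stable under Lie bracket. -/
structure SingularFoliation [IsManifold I ∞ M] where
  /-- the vector fields that belong to the foliation -/
  carrier : Set (VField I M)
  smooth : ∀ X ∈ carrier, SmoothVFieldOn I X univ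
  zero_mem : (fun x => (0 : TangentSpace I x)) ∈ carrier
  add_mem : ∀ X ∈ carrier, ∀ Y ∈ carrier, (fun x => X x + Y x) ∈ carrier
  smul_mem : ∀ f : M → ℝ, ContMDiff I 𝓘(ℝ, ℝ) ∞ f → ∀ X ∈ carrier,
    (fun x => f x • X x) ∈ carrier
  lie_mem : ∀ X ∈ carrier, ∀ Y ∈ carrier, VectorField.mlieBracket I X Y ∈ carrier
  locally_fg : ∀ x : M, ∃ V : Set M, IsOpen V ∧ x ∈ V ∧
    ∃ (k : ℕ) (Y : Fin k → VField I M), (∀ i, Y i ∈ carrier) ∧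
      ∀ X ∈ carrier, ∃ f : Fin k → M → ℝ, (∀ i, ContMDiffOn I 𝓘(ℝ, ℝ) ∞ (f i) V) ∧
        ∀ y ∈ V, X y = ∑ i, f i y • Y i y

variable {I}

/-- The vector fields on the open set `W` that belong to the foliation: those which coincide, near
each point of `W`, with an element of the foliation. -/
def SingularFoliation.onOpen [IsManifold I ∞ M] (F : SingularFoliation I M) (W : Set M) :
    Set (VField I M) :=
  {X | ∀ x ∈ W, ∃ Y ∈ F.carrier, ∀ᶠ y in 𝓝 x, X y = Y y}

/-- The leaf through `x`: all points that can be reached from `x` by following successively finitely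
many integral curves of vector fields of the foliation. -/
def SingularFoliation.leaf [IsManifold I ∞ M] (F : SingularFoliation I M) (x : M) : Set M :=
  {y | Relation.ReflTransGen
    (fun a b => ∃ X ∈ F.carrier, ∃ γ : ℝ → M,
      IsMIntegralCurveOn γ X (Icc 0 1) ∧ γ 0 = a ∧ γ 1 = b) x y}

end Basic

section Products

variable {E₁ : Type*} [NormedAddCommGroup E₁] [NormedSpace ℝ E₁]
  {H₁ : Type*} [TopologicalSpace H₁] {I₁ : ModelWithCorners ℝ E₁ H₁}
  {M₁ : Type*} [TopologicalSpace M₁] [ChartedSpace H₁ M₁]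
  {E₂ : Type*} [NormedAddCommGroup E₂] [NormedSpace ℝ E₂]
  {H₂ : Type*} [TopologicalSpace H₂] {I₂ : ModelWithCorners ℝ E₂ H₂}
  {M₂ : Type*} [TopologicalSpace M₂] [ChartedSpace H₂ M₂]

/-- The vector field `(a, b) ↦ (X a, 0)` on `M₁ × M₂`. -/
noncomputable def liftFst (X : VField I₁ M₁) : VField (I₁.prod I₂) (M₁ × M₂) :=
  fun z => ((X z.1, 0) : TangentSpace I₁ z.1 × TangentSpace I₂ z.2)

/-- The vector field `(a, b) ↦ (0, Y b)` on `M₁ × M₂`. -/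
noncomputable def liftSnd (Y : VField I₂ M₂) : VField (I₁.prod I₂) (M₁ × M₂) :=
  fun z => ((0, Y z.2) : TangentSpace I₁ z.1 × TangentSpace I₂ z.2)

/-- The direct product of a foliation `𝒜` of a submanifold `A` of `M₁` and a foliation `ℬ` of a
submanifold `B` of `M₂`: the vector fields along `A ×ˢ B` that are locally linear combinations,
with smooth functions as coefficients, of vector fields `(a, b) ↦ (X a, 0)` with `X ∈ 𝒜` and
`(a, b) ↦ (0, Y b)` with `Y ∈ ℬ`. -/
def prodFoliation (A : Set M₁) (𝒜 : Set (VField I₁ M₁)) (B : Set M₂) (ℬ : Set (VField I₂ M₂)) :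
    Set (VField (I₁.prod I₂) (M₁ × M₂)) :=
  {Z | ∀ z ∈ A ×ˢ B, ∃ W : Set (M₁ × M₂), IsOpen W ∧ z ∈ W ∧
    ∃ (k l : ℕ) (X : Fin k → VField I₁ M₁) (Y : Fin l → VField I₂ M₂)
      (f : Fin k → M₁ × M₂ → ℝ) (g : Fin l → M₁ × M₂ → ℝ),
      (∀ i, X i ∈ 𝒜) ∧ (∀ j, Y j ∈ ℬ) ∧
      (∀ i, ContMDiffOn (I₁.prod I₂) 𝓘(ℝ, ℝ) ∞ (f i) W) ∧
      (∀ j, ContMDiffOn (I₁.prod I₂) 𝓘(ℝ, ℝ) ∞ (g j) W) ∧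
      ∀ w ∈ W ∩ A ×ˢ B,
        Z w = ∑ i, f i w • liftFst (I₂ := I₂) (X i) w + ∑ j, g j w • liftSnd (I₁ := I₁) (Y j) w}

/-- `f` is smooth on the subset `A`: near each point of `A` it is the restriction to `A` of a smooth
map defined on an open set. -/
def SmoothOnSubset (I₁ : ModelWithCorners ℝ E₁ H₁) (I₂ : ModelWithCorners ℝ E₂ H₂)
    (f : M₁ → M₂) (A : Set M₁) : Prop :=
  ∀ x ∈ A, ∃ V : Set M₁, IsOpen V ∧ x ∈ V ∧ ∃ g : M₁ → M₂,
    ContMDiffOn I₁ I₂ ∞ g V ∧ ∀ y ∈ V ∩ A, g y = f y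

/-- `Φ` restricts to a diffeomorphism from the submanifold `A` of `M₁` onto the submanifold `B` of
`M₂`, with inverse `Ψ`. -/
structure IsDiffeoBetween (I₁ : ModelWithCorners ℝ E₁ H₁) (I₂ : ModelWithCorners ℝ E₂ H₂)
    (Φ : M₁ → M₂) (Ψ : M₂ → M₁) (A : Set M₁) (B : Set M₂) : Prop where
  mapsTo : MapsTo Φ A B
  mapsTo_inv : MapsTo Ψ B A
  left_inv : ∀ x ∈ A, Ψ (Φ x) = x
  right_inv : ∀ y ∈ B, Φ (Ψ y) = y
  smooth : SmoothOnSubset I₁ I₂ Φ A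
  smooth_inv : SmoothOnSubset I₂ I₁ Ψ B

/-- The diffeomorphism `Φ` from the open subset `A` of `M₁` onto a submanifold of `M₂` intertwines
the foliations `𝒜` and `ℬ`: for vector fields `X` and `Z` with `Z = Φ_* X`, one has
`X ∈ 𝒜` if and only if `Z ∈ ℬ`. -/
def Intertwines (I₁ : ModelWithCorners ℝ E₁ H₁) (I₂ : ModelWithCorners ℝ E₂ H₂)
    (Φ : M₁ → M₂) (A : Set M₁) (𝒜 : Set (VField I₁ M₁)) (ℬ : Set (VField I₂ M₂)) : Prop :=
  ∀ (X : VField I₁ M₁) (Z : VField I₂ M₂),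
    (∀ x ∈ A, mfderiv I₁ I₂ Φ x (X x) = Z (Φ x)) → (X ∈ 𝒜 ↔ Z ∈ ℬ)

end Products

section Connections

variable {E : Type*} [NormedAddCommGroup E] [NormedSpace ℝ E]
  {H : Type*} [TopologicalSpace H] {I : ModelWithCorners ℝ E H}
  {M : Type*} [TopologicalSpace M] [ChartedSpace H M] [IsManifold I ∞ M]
  {E' : Type*} [NormedAddCommGroup E'] [NormedSpace ℝ E']
  {H' : Type*} [TopologicalSpace H'] {I' : ModelWithCorners ℝ E' H'}
  {L : Type*} [TopologicalSpace L] [ChartedSpace H' L] [IsManifold I' ∞ L]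

/-- `j : L → M` exhibits the manifold `L` as a locally closed leaf of the foliation. -/
structure IsLocallyClosedLeaf (F : SingularFoliation I M) (j : L → M) (I' : ModelWithCorners ℝ E' H')
    : Prop where
  embedding : IsSmoothEmbedding I' I ∞ j
  isLeaf : ∃ x : M, range j = F.leaf x
  locallyClosed : IsLocallyClosed (range j)

/-- `(M_L, p, hor)` is an Ehresmann `F`-connection near the leaf `j : L → M`: `M_L` is an open
neighbourhood of the leaf, `p : M_L → L` a smooth submersion restricting to the identity of `L`, and
`hor` a smooth subbundle of the tangent bundle of `M_L`, complementary to the kernel of `dp`, all of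
whose sections belong to `F`. (Values of `p` and of `hor` outside of `M_L` are junk.) -/
structure IsEhresmannFConnection (F : SingularFoliation I M) (j : L → M)
    (I' : ModelWithCorners ℝ E' H') (M_L : Set M) (p : M → L)
    (hor : (x : M) → Submodule ℝ (TangentSpace I x)) : Prop where
  isOpen : IsOpen M_L
  leaf_subset : range j ⊆ M_L
  smooth_proj : ContMDiffOn I I' ∞ p M_L
  proj_leaf : ∀ ℓ : L, p (j ℓ) = ℓ
  submersion : ∀ m ∈ M_L, Function.Surjective (mfderiv I I' p m)
  isCompl : ∀ m ∈ M_L, IsCompl (hor m) (LinearMap.ker (mfderiv I I' p m).toLinearMap)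
  smooth_hor : ∀ m ∈ M_L, ∀ v ∈ hor m, ∃ V : Set M, IsOpen V ∧ m ∈ V ∧ V ⊆ M_L ∧
    ∃ X : VField I M, SmoothVFieldOn I X V ∧ X m = v ∧ ∀ y ∈ V, X y ∈ hor y
  sections_mem : ∀ V : Set M, IsOpen V → V ⊆ M_L → ∀ X : VField I M, SmoothVFieldOn I X V →
    (∀ y ∈ V, X y ∈ hor y) → X ∈ F.onOpen V

/-- `X` is the horizontal lift to `M_L` of the vector field `b` on `L`. -/
def IsHorizontalLift (I' : ModelWithCorners ℝ E' H') (M_L : Set M) (p : M → L)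
    (hor : (x : M) → Submodule ℝ (TangentSpace I x)) (b : VField I' L) (X : VField I M) : Prop :=
  ∀ m ∈ M_L, X m ∈ hor m ∧ mfderiv I I' p m (X m) = b (p m)

/-- Completeness: for every vector field `b` on `L`, the integral curve in `M_L` starting at `m` of
the horizontal lift of `b` is defined on a given interval if and only if the integral curve of `b`
starting at `p m` is. -/
def IsCompleteConnection (I' : ModelWithCorners ℝ E' H') [IsManifold I' ∞ L]
    (M_L : Set M) (p : M → L)
    (hor : (x : M) → Submodule ℝ (TangentSpace I x)) : Prop :=
  ∀ (b : VField I' L) (X : VField I M), SmoothVFieldOn I' b univ →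
    IsHorizontalLift I' M_L p hor b X →
    ∀ m ∈ M_L, ∀ s t : ℝ, s < 0 → 0 < t →
      ((∃ γ : ℝ → M, γ 0 = m ∧ (∀ r ∈ Ioo s t, γ r ∈ M_L) ∧ IsMIntegralCurveOn γ X (Ioo s t)) ↔
        ∃ η : ℝ → L, η 0 = p m ∧ IsMIntegralCurveOn η b (Ioo s t))

/-- The fibre over `ℓ` of `p : M_L → L`. When `p` is a submersion, it is an embedded submanifold,
whose tangent space at `m` is the kernel of the differential of `p` at `m`. -/
def fibre (M_L : Set M) (p : M → L) (ℓ : L) : Set M := {m | m ∈ M_L ∧ p m = ℓ}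

/-- The restriction of `F` to the fibre of `p` over `ℓ`: the vector fields tangent to the fibre
that are locally restrictions to the fibre of elements of `F`. -/
def fibreFoliation (F : SingularFoliation I M) (I' : ModelWithCorners ℝ E' H')
    (M_L : Set M) (p : M → L) (ℓ : L) : Set (VField I M) :=
  {Y | ∀ m ∈ fibre M_L p ℓ, mfderiv I I' p m (Y m) = 0 ∧
    ∃ X ∈ F.carrier, ∀ᶠ y in 𝓝[fibre M_L p ℓ] m, Y y = X y}

end Connections

end SingFol

namespace SingFol

section Nemytskii

universe u

/-- The pointwise application of a continuous family of continuous linear maps to a continuous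
function, as a continuous bilinear map. -/
noncomputable def pointwiseApply (K : Type*) [TopologicalSpace K] [CompactSpace K]
    (E F : Type*) [NormedAddCommGroup E] [NormedSpace ℝ E]
    [NormedAddCommGroup F] [NormedSpace ℝ F] :
    C(K, E →L[ℝ] F) →L[ℝ] C(K, E) →L[ℝ] C(K, F) :=
  LinearMap.mkContinuous₂
    (LinearMap.mk₂ ℝ (fun (A : C(K, E →L[ℝ] F)) (h : C(K, E)) =>
        (⟨fun s => A s (h s), A.continuous.clm_apply h.continuous⟩ : C(K, F)))
      (fun _ _ _ => by ext; simp) (fun _ _ _ => by ext; simp)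
      (fun _ _ _ => by ext; simp) (fun _ _ _ => by ext; simp)) 1
    (fun A h => by
      rw [one_mul, ContinuousMap.norm_le _ (by positivity)]
      intro s
      exact ((A s).le_opNorm _).trans
        (mul_le_mul (A.norm_coe_le_norm s) (h.norm_coe_le_norm s) (norm_nonneg _) (by positivity)))

variable {K : Type*} [TopologicalSpace K] [CompactSpace K]
    {E F : Type u} [NormedAddCommGroup E] [NormedSpace ℝ E]
    [NormedAddCommGroup F] [NormedSpace ℝ F]

lemma hasFDerivAt_comp_left (g : C(E, F)) (g' : C(E, E →L[ℝ] F))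
    (hg : ∀ x, HasFDerivAt g (g' x) x) (α : C(K, E)) :
    HasFDerivAt (fun β : C(K, E) => g.comp β) (pointwiseApply K E F (g'.comp α)) α := by
  refine HasFDerivAt.of_isLittleO (Asymptotics.isLittleO_iff.2 fun c hc => ?_)
  have hcomp : IsCompact (range α) := isCompact_range α.continuous
  have hu := hcomp.uniformContinuousAt_of_continuousAt g'
    (fun a _ => g'.continuous.continuousAt) (Metric.dist_mem_uniformity hc)
  obtain ⟨δ, hδ, hδ'⟩ := Metric.mem_uniformity_dist.1 hu
  filter_upwards [Metric.ball_mem_nhds α hδ] with β hβ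
  rw [ContinuousMap.norm_le _ (by positivity)]
  intro s
  have hs : dist (β s) (α s) < δ := (ContinuousMap.dist_apply_le_dist s).trans_lt hβ
  have key := (convex_ball (α s) δ).norm_image_sub_le_of_norm_hasFDerivWithin_le'
    (f := g) (f' := g') (φ := g' (α s)) (C := c) (x := α s) (y := β s)
    (fun x _ => (hg x).hasFDerivWithinAt)
    (fun x hx => by
      have := hδ' (a := α s) (b := x) (by rw [dist_comm]; exact hx) (mem_range_self s)
      have h2 : dist (g' (α s)) (g' x) < c := this
      rw [dist_comm, dist_eq_norm] at h2
      exact h2.le)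
    (Metric.mem_ball_self hδ) hs
  exact key.trans (mul_le_mul_of_nonneg_left ((β - α).norm_coe_le_norm s) hc.le)

lemma contDiff_comp_left_nat (n : ℕ) : ∀ {F : Type u} [NormedAddCommGroup F] [NormedSpace ℝ F]
    (g : C(E, F)), ContDiff ℝ n g → ContDiff ℝ n (fun β : C(K, E) => g.comp β) := by
  induction n with
  | zero =>
    intro F _ _ g _
    exact contDiff_zero.2 (ContinuousMap.continuous_postcomp g)
  | succ n ih =>
    intro F _ _ g hg
    have h1 : ContDiff ℝ n (fderiv ℝ g) := by
      have := (contDiff_succ_iff_fderiv (n := n)).1 (by exact_mod_cast hg)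
      exact this.2.2
    have hd : Differentiable ℝ g := hg.differentiable (by simp)
    have hder := fun α : C(K, E) => hasFDerivAt_comp_left g ⟨fderiv ℝ g, h1.continuous⟩
      (fun x => (hd x).hasFDerivAt) α
    have : ContDiff ℝ ((n : WithTop ℕ∞) + 1) (fun β : C(K, E) => g.comp β) := by
      refine contDiff_succ_iff_fderiv.2 ⟨fun α => (hder α).differentiableAt, by simp, ?_⟩
      have : fderiv ℝ (fun β : C(K, E) => g.comp β) = fun α =>
          pointwiseApply K E F ((⟨fderiv ℝ g, h1.continuous⟩ : C(E, E →L[ℝ] F)).comp α) :=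
        funext fun α => (hder α).fderiv
      rw [this]
      exact (pointwiseApply K E F).contDiff.comp (ih ⟨fderiv ℝ g, h1.continuous⟩ h1)
    exact_mod_cast this

/-- Composition on the left with a smooth map is a smooth map between spaces of continuous
functions on a compact space. -/
lemma contDiff_comp_left (g : C(E, F)) (hg : ContDiff ℝ ∞ g) :
    ContDiff ℝ ∞ (fun β : C(K, E) => g.comp β) :=
  contDiff_infty.2 fun n => contDiff_comp_left_nat n g (contDiff_infty.1 hg n)

end Nemytskii

section Primitive

variable (E : Type*) [NormedAddCommGroup E] [NormedSpace ℝ E]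

/-- The primitive vanishing at `0` of a continuous function on `[-1, 1]`. -/
noncomputable def primitive : C(Icc (-1 : ℝ) 1, E) →L[ℝ] C(Icc (-1 : ℝ) 1, E) :=
  LinearMap.mkContinuous
    { toFun := fun α => ⟨fun s => ∫ r in (0 : ℝ)..s, IccExtend (by norm_num) α r, by
        refine (intervalIntegral.continuous_primitive (fun a b => ?_) 0).comp
          continuous_subtype_val
        exact (α.continuous.Icc_extend' (h := by norm_num)).intervalIntegrable _ _⟩
      map_add' := fun α β => by
        ext s
        exact intervalIntegral.integral_add
          ((α.continuous.Icc_extend' (h := by norm_num)).intervalIntegrable _ _)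
          ((β.continuous.Icc_extend' (h := by norm_num)).intervalIntegrable _ _)
      map_smul' := fun c α => by
        ext s
        exact intervalIntegral.integral_smul c _ }
    1 (fun α => by
      rw [one_mul, ContinuousMap.norm_le _ (by positivity)]
      intro s
      refine (intervalIntegral.norm_integral_le_of_norm_le_const (C := ‖α‖)
        (fun r _ => α.norm_coe_le_norm _)).trans ?_
      have : |(s : ℝ) - 0| ≤ 1 := by
        rw [sub_zero, abs_le]; exact s.2
      exact mul_le_of_le_one_right (norm_nonneg _) this)

variable {E}

lemma hasDerivAt_of_eq_add_smul_primitive [CompleteSpace E] {α β : C(Icc (-1 : ℝ) 1, E)} {x : E}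
    {τ : ℝ} (h : ∀ s, α s = x + τ • primitive E β s) {s : ℝ} (hs : s ∈ Ioo (-1 : ℝ) 1) :
    HasDerivAt (fun r => IccExtend (by norm_num : (-1 : ℝ) ≤ 1) α r)
      (τ • IccExtend (by norm_num : (-1 : ℝ) ≤ 1) β s) s := by
  have hc : Continuous (IccExtend (by norm_num : (-1 : ℝ) ≤ 1) β) :=
    β.continuous.Icc_extend'
  have h1 : HasDerivAt (fun r => ∫ t in (0 : ℝ)..r, IccExtend (by norm_num : (-1 : ℝ) ≤ 1) β t)
      (IccExtend (by norm_num : (-1 : ℝ) ≤ 1) β s) s :=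
    intervalIntegral.integral_hasDerivAt_right (hc.intervalIntegrable _ _)
      (hc.stronglyMeasurableAtFilter _ _) hc.continuousAt
  refine ((h1.const_smul τ).const_add x).congr_of_eventuallyEq ?_
  filter_upwards [Ioo_mem_nhds hs.1 hs.2] with r hr
  rw [IccExtend_of_mem _ _ (Ioo_subset_Icc_self hr), h]
  rfl

end Primitive

section LocalFlow

universe u

variable {E : Type u} [NormedAddCommGroup E] [NormedSpace ℝ E]

/-- The map `(τ, α) ↦ (τ, α - τ ∫ X ∘ α)`: its inverse solves the differential equation
`α' = τ X(α)`. -/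
noncomputable def picardMap (X : C(E, E)) (z : ℝ × C(Icc (-1 : ℝ) 1, E)) :
    ℝ × C(Icc (-1 : ℝ) 1, E) :=
  (z.1, z.2 - z.1 • primitive E (X.comp z.2))

lemma contDiff_picardMap (X : C(E, E)) (hX : ContDiff ℝ ∞ X) : ContDiff ℝ ∞ (picardMap X) :=
  contDiff_fst.prodMk (contDiff_snd.sub (contDiff_fst.smul
    ((primitive E).contDiff.comp ((contDiff_comp_left X hX).comp contDiff_snd))))

lemma hasFDerivAt_picardMap_zero (X : C(E, E)) (hX : ContDiff ℝ ∞ X) (α : C(Icc (-1 : ℝ) 1, E)) :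
    ∃ e : (ℝ × C(Icc (-1 : ℝ) 1, E)) ≃L[ℝ] (ℝ × C(Icc (-1 : ℝ) 1, E)),
      HasFDerivAt (picardMap X) (e : _ →L[ℝ] _) (0, α) := by
  refine ⟨(ContinuousLinearEquiv.refl ℝ ℝ).skewProd (ContinuousLinearEquiv.refl ℝ _)
    (-(ContinuousLinearMap.toSpanSingleton ℝ (primitive E (X.comp α)))), ?_⟩
  have hG : ContDiff ℝ ∞ fun z : ℝ × C(Icc (-1 : ℝ) 1, E) => primitive E (X.comp z.2) :=
    (primitive E).contDiff.comp ((contDiff_comp_left X hX).comp contDiff_snd)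
  have h1 := (hG.differentiable (by simp) (0, α)).hasFDerivAt
  have h2 := (hasFDerivAt_fst (𝕜 := ℝ) (p := ((0 : ℝ), α))).prodMk
    ((hasFDerivAt_snd (𝕜 := ℝ) (p := ((0 : ℝ), α))).sub
      ((hasFDerivAt_fst (𝕜 := ℝ) (p := ((0 : ℝ), α))).smul h1))
  refine h2.congr_fderiv ?_
  ext : 1
  · ext <;> simp
  · refine ContinuousLinearMap.ext fun β => ?_
    simp

lemma exists_smooth_solution_family [CompleteSpace E] (X : C(E, E)) (hX : ContDiff ℝ ∞ X)
    (x₀ : E) {δ : ℝ} (hδ : 0 < δ) :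
    ∃ ε > 0, ∃ W : Set E, IsOpen W ∧ x₀ ∈ W ∧ ∃ sol : E → C(Icc (-1 : ℝ) 1, E),
      ContDiffOn ℝ ∞ sol W ∧ ∀ x ∈ W, (∀ s, dist (sol x s) x₀ < δ) ∧
        sol x = ContinuousMap.const _ x + (ε : ℝ) • primitive E (X.comp (sol x)) := by
  set α₀ : C(Icc (-1 : ℝ) 1, E) := ContinuousMap.const _ x₀ with hα₀
  obtain ⟨e, he⟩ := hasFDerivAt_picardMap_zero X hX α₀
  have hP := contDiff_picardMap X hX
  have hP0 : picardMap X (0, α₀) = (0, α₀) := by simp [picardMap]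
  set f := (hP.contDiffAt (x := (0, α₀))).toOpenPartialHomeomorph _ he (by simp) with hf
  have hfc : (f : _ → _) = picardMap X := rfl
  have hsrc : ((0 : ℝ), α₀) ∈ f.source :=
    (hP.contDiffAt (x := (0, α₀))).mem_toOpenPartialHomeomorph_source he (by simp)
  have htgt : ((0 : ℝ), α₀) ∈ f.target := by
    have := f.map_source hsrc
    rwa [hfc, hP0] at this
  have hsymm : f.symm (0, α₀) = (0, α₀) := by
    have := f.left_inv hsrc
    rwa [hfc, hP0] at this
  have hcont : Tendsto f.symm (𝓝 (0, α₀)) (𝓝 (0, α₀)) := by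
    have := f.continuousAt_symm htgt
    rwa [ContinuousAt, hsymm] at this
  have hinv : ∀ᶠ z in 𝓝 ((0 : ℝ), α₀), ∃ e' : (ℝ × C(Icc (-1 : ℝ) 1, E)) ≃L[ℝ]
      (ℝ × C(Icc (-1 : ℝ) 1, E)), (e' : _ →L[ℝ] _) = fderiv ℝ (picardMap X) z := by
    have hc := (hP.continuous_fderiv (by simp)).tendsto (0, α₀)
    rw [he.fderiv] at hc
    exact hc (ContinuousLinearEquiv.nhds e)
  have hball : ∀ᶠ z in 𝓝 ((0 : ℝ), α₀), dist z.2 α₀ < δ :=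
    (continuous_snd.tendsto ((0 : ℝ), α₀)).eventually
      (Metric.ball_mem_nhds α₀ hδ : ∀ᶠ y in 𝓝 α₀, dist y α₀ < δ)
  have htgt' : ∀ᶠ w in 𝓝 ((0 : ℝ), α₀), w ∈ f.target := f.open_target.mem_nhds htgt
  have hev := htgt'.and
    ((hcont.eventually hinv).and (hcont.eventually hball))
  have hconst : Continuous fun z : ℝ × E => (z.1, (ContinuousMap.const _ z.2 : C(Icc (-1 : ℝ) 1, E))) :=
    continuous_fst.prodMk (ContinuousMap.continuous_const'.comp continuous_snd)
  have hev2 := hconst.tendsto (0, x₀) |>.eventually hev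
  obtain ⟨r, hr, hr'⟩ := Metric.eventually_nhds_iff_ball.1 hev2
  have hmem : ∀ x ∈ Metric.ball x₀ r, (r / 2, x) ∈ Metric.ball ((0 : ℝ), x₀) r := by
    intro x hx
    rw [Metric.mem_ball, Prod.dist_eq, max_lt_iff]
    refine ⟨?_, hx⟩
    simp only [dist_zero_right, Real.norm_eq_abs]
    rw [abs_of_pos (by positivity)]
    linarith
  refine ⟨r / 2, by positivity, Metric.ball x₀ r, Metric.isOpen_ball, Metric.mem_ball_self hr,
    fun x => (f.symm (r / 2, ContinuousLinearMap.const ℝ (Icc (-1 : ℝ) 1) x)).2, ?_, ?_⟩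
  · intro x hx
    obtain ⟨h1, ⟨e', he'⟩, -⟩ := hr' _ (hmem x hx)
    have hs : ContDiffAt ℝ ∞ f.symm (r / 2, ContinuousLinearMap.const ℝ (Icc (-1 : ℝ) 1) x) := by
      refine f.contDiffAt_symm (f₀' := e') h1 ?_ (hfc ▸ hP.contDiffAt)
      have := (hP.differentiable (by simp) (f.symm (r / 2, ContinuousLinearMap.const ℝ (Icc (-1 : ℝ) 1) x))).hasFDerivAt
      rw [hfc]
      convert this
      exact he'
    refine ContDiffAt.contDiffWithinAt ?_
    exact contDiffAt_snd.comp x (hs.comp x (contDiffAt_const.prodMk (ContinuousLinearMap.const ℝ (Icc (-1 : ℝ) 1) :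
      E →L[ℝ] C(Icc (-1 : ℝ) 1, E)).contDiff.contDiffAt))
  · intro x hx
    obtain ⟨h1, -, h3⟩ := hr' _ (hmem x hx)
    refine ⟨fun s => (ContinuousMap.dist_apply_le_dist (f := (f.symm (r / 2, ContinuousLinearMap.const ℝ (Icc (-1 : ℝ) 1) x)).2)
      (g := α₀) s).trans_lt h3, ?_⟩
    have h4 : picardMap X (f.symm (r / 2, ContinuousLinearMap.const ℝ (Icc (-1 : ℝ) 1) x)) = (r / 2, ContinuousLinearMap.const ℝ (Icc (-1 : ℝ) 1) x) := f.right_inv h1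
    have h5 : (f.symm (r / 2, ContinuousLinearMap.const ℝ (Icc (-1 : ℝ) 1) x)).1 = r / 2 := congrArg Prod.fst h4
    have h6 := congrArg Prod.snd h4
    simp only [picardMap, h5] at h6
    exact sub_eq_iff_eq_add.1 h6

/-- Existence of a smooth local flow of a smooth vector field on a Banach space, together with the
equation of variations along the trajectories. -/
theorem exists_smooth_local_flow [CompleteSpace E] {X : E → E} (hX : ContDiff ℝ ∞ X) (x₀ : E)
    {O : Set E} (hO : O ∈ 𝓝 x₀) :
    ∃ ε > 0, ∃ W : Set E, IsOpen W ∧ x₀ ∈ W ∧ ∃ φ : ℝ → E → E,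
      (∀ x ∈ W, φ 0 x = x) ∧ (∀ t ∈ Ioo (-ε) ε, ContDiffOn ℝ ∞ (φ t) W) ∧
      ∀ x ∈ W, ∀ t ∈ Ioo (-ε) ε, φ t x ∈ O ∧ HasDerivAt (fun r => φ r x) (X (φ t x)) t ∧
        ∀ w, HasDerivAt (fun r => fderiv ℝ (φ r) x w)
          (fderiv ℝ X (φ t x) (fderiv ℝ (φ t) x w)) t := by
  obtain ⟨δ, hδ, hδO⟩ := Metric.mem_nhds_iff.1 hO
  obtain ⟨ε, hε, W, hW, hxW, sol, hsol, hsol'⟩ :=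
    exists_smooth_solution_family ⟨X, hX.continuous⟩ hX x₀ hδ
  have hdX : Continuous (fderiv ℝ X) := hX.continuous_fderiv (by simp)
  have hscale : ∀ t ∈ Ioo (-ε) ε, t / ε ∈ Ioo (-1 : ℝ) 1 := by
    intro t ht
    rw [mem_Ioo, lt_div_iff₀ hε, div_lt_iff₀ hε]
    simpa using ht
  have hderiv : ∀ {α β : C(Icc (-1 : ℝ) 1, E)} {x : E},
      (α = ContinuousMap.const _ x + ε • primitive E β) → ∀ t ∈ Ioo (-ε) ε,
      HasDerivAt (fun r => IccExtend (by norm_num : (-1 : ℝ) ≤ 1) α (r / ε))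
        (IccExtend (by norm_num : (-1 : ℝ) ≤ 1) β (t / ε)) t := by
    intro α β x h t ht
    have h1 := hasDerivAt_of_eq_add_smul_primitive (fun s => DFunLike.congr_fun h s) (hscale t ht)
    have h2 := h1.scomp t ((hasDerivAt_id t).div_const ε)
    rw [smul_smul, one_div, inv_mul_cancel₀ hε.ne', one_smul] at h2
    exact h2
  have hφd : ∀ x ∈ W, HasFDerivAt sol (fderiv ℝ sol x) x := fun x hx =>
    ((hsol.contDiffAt (hW.mem_nhds hx)).differentiableAt (by simp)).hasFDerivAt
  have hfd : ∀ x ∈ W, ∀ (t : ℝ) (w : E),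
      fderiv ℝ (fun x => IccExtend (by norm_num : (-1 : ℝ) ≤ 1) (sol x) (t / ε)) x w =
        IccExtend (by norm_num : (-1 : ℝ) ≤ 1) (fderiv ℝ sol x w) (t / ε) := by
    intro x hx t w
    have := ((ContinuousMap.evalCLM ℝ (projIcc (-1 : ℝ) 1 (by norm_num) (t / ε)) :
      C(Icc (-1 : ℝ) 1, E) →L[ℝ] E).hasFDerivAt.comp x (hφd x hx)).fderiv
    exact DFunLike.congr_fun this w
  refine ⟨ε, hε, W, hW, hxW,
    fun t x => IccExtend (by norm_num : (-1 : ℝ) ≤ 1) (sol x) (t / ε), ?_, ?_, ?_⟩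
  · intro x hx
    have h0 : (0 : ℝ) ∈ Icc (-1 : ℝ) 1 := by norm_num
    change IccExtend _ _ _ = _
    rw [zero_div, IccExtend_of_mem _ _ h0]
    refine (DFunLike.congr_fun (hsol' x hx).2 ⟨0, h0⟩).trans ?_
    have : primitive E ((⟨X, hX.continuous⟩ : C(E, E)).comp (sol x)) ⟨0, h0⟩ = 0 :=
      intervalIntegral.integral_same
    simp [this]
  · intro t _
    exact (ContinuousMap.evalCLM ℝ (projIcc (-1 : ℝ) 1 (by norm_num) (t / ε)) :
      C(Icc (-1 : ℝ) 1, E) →L[ℝ] E).contDiff.comp_contDiffOn hsol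
  · intro x hx t ht
    refine ⟨hδO ((hsol' x hx).1 _), hderiv (hsol' x hx).2 t ht, fun w => ?_⟩
    have key : fderiv ℝ sol x w = ContinuousMap.const _ w + ε • primitive E
        (pointwiseApply _ E E ((⟨fderiv ℝ X, hdX⟩ : C(E, E →L[ℝ] E)).comp (sol x))
          (fderiv ℝ sol x w)) := by
      have hN := hasFDerivAt_comp_left ⟨X, hX.continuous⟩ ⟨fderiv ℝ X, hdX⟩
        (fun y => (hX.differentiable (by simp) y).hasFDerivAt) (sol x)
      have h1 := ((primitive E).hasFDerivAt.comp x (hN.comp x (hφd x hx))).const_smul ε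
      have h2 := (hφd x hx).sub h1
      have h3 : HasFDerivAt (fun y => sol y - ε • primitive E
          ((⟨X, hX.continuous⟩ : C(E, E)).comp (sol y))) (ContinuousLinearMap.const ℝ (Icc (-1 : ℝ) 1)) x := by
        refine (ContinuousLinearMap.const ℝ (Icc (-1 : ℝ) 1) :
          E →L[ℝ] C(Icc (-1 : ℝ) 1, E)).hasFDerivAt.congr_of_eventuallyEq ?_
        filter_upwards [hW.mem_nhds hx] with y hy
        exact sub_eq_iff_eq_add.2 (hsol' y hy).2
      exact sub_eq_iff_eq_add.1 (DFunLike.congr_fun (h2.unique h3) w)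
    have := hderiv key t ht
    rw [hfd x hx t w]
    exact this.congr_of_eventuallyEq (Eventually.of_forall fun r => hfd x hx r w)

end LocalFlow

section Invariance

universe u

/-- A smooth map defined on an open set coincides near each point of it with a globally defined
smooth map. -/
lemma exists_contDiff_eventuallyEq {E F : Type*} [NormedAddCommGroup E] [NormedSpace ℝ E]
    [FiniteDimensional ℝ E] [NormedAddCommGroup F] [NormedSpace ℝ F] {f : E → F} {O : Set E}
    (hO : IsOpen O) (hf : ContDiffOn ℝ ∞ f O) {x₀ : E} (hx : x₀ ∈ O) :
    ∃ g : E → F, ContDiff ℝ ∞ g ∧ g =ᶠ[𝓝 x₀] f := by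
  obtain ⟨r, hr, hrO⟩ := Metric.isOpen_iff.1 hO x₀ hx
  let b : ContDiffBump x₀ := ⟨r / 4, r / 2, by positivity, by linarith⟩
  refine ⟨fun x => b x • f x, ?_, ?_⟩
  · refine contDiff_iff_contDiffAt.2 fun x => ?_
    by_cases hx : x ∈ Metric.ball x₀ r
    · exact b.contDiff.contDiffAt.smul (hf.contDiffAt (hO.mem_nhds (hrO hx)))
    · have : (fun x => b x • f x) =ᶠ[𝓝 x] fun _ => 0 := by
        have hU : (Metric.closedBall x₀ (r / 2))ᶜ ∈ 𝓝 x := by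
          refine Metric.isClosed_closedBall.isOpen_compl.mem_nhds fun h => hx ?_
          exact Metric.closedBall_subset_ball (by linarith) h
        filter_upwards [hU] with y hy
        rw [b.zero_of_le_dist (le_of_lt (not_le.1 fun h => hy h)), zero_smul]
      exact contDiffAt_const.congr_of_eventuallyEq this
  · filter_upwards [b.eventuallyEq_one] with x hx
    simp [hx]

variable {Q : Type u} [NormedAddCommGroup Q] [NormedSpace ℝ Q] [FiniteDimensional ℝ Q]
  {ι : Type} [Fintype ι] [DecidableEq ι]

/-- If the brackets of `X` with the vector fields `G i` are linear combinations of the `G i`, then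
the local flow of `X` maps the `G i` to linear combinations of the `G i`. -/
theorem exists_local_flow_preserving {X : Q → Q} {G : ι → Q → Q} {c : ι → ι → Q → ℝ} {z₀ : Q}
    {O : Set Q} (hO : IsOpen O) (hz₀ : z₀ ∈ O) (hX : ContDiffOn ℝ ∞ X O)
    (hG : ∀ i, ContDiffOn ℝ ∞ (G i) O) (hc : ∀ i j, ContDiffOn ℝ ∞ (c i j) O)
    (hbr : ∀ z ∈ O, ∀ i, fderiv ℝ (G i) z (X z) - fderiv ℝ X z (G i z) = ∑ j, c i j z • G j z) :
    ∃ ε > 0, ∃ W : Set Q, IsOpen W ∧ z₀ ∈ W ∧ ∃ (φ : ℝ → Q → Q) (A : ℝ → Q → ι → ι → ℝ),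
      (∀ z ∈ W, φ 0 z = z) ∧
      (∀ t ∈ Ioo (-ε) ε, ContDiffOn ℝ ∞ (φ t) W ∧
        ∀ i j, ContDiffOn ℝ ∞ (fun z => A t z i j) W) ∧
      ∀ z ∈ W, ∀ t ∈ Ioo (-ε) ε, φ t z ∈ O ∧ HasDerivAt (fun r => φ r z) (X (φ t z)) t ∧
        ∀ i, fderiv ℝ (φ t) z (G i z) = ∑ j, A t z i j • G j (φ t z) := by
  obtain ⟨X', hX', hXX'⟩ := exists_contDiff_eventuallyEq hO hX hz₀
  have hc' := fun i j => exists_contDiff_eventuallyEq hO (hc i j) hz₀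
  choose c' hc' hcc' using hc'
  obtain ⟨K, hK⟩ : ∃ K : NNReal, ‖fderiv ℝ X' z₀‖ < K := by
    refine ⟨⟨‖fderiv ℝ X' z₀‖ + 1, by positivity⟩, ?_⟩
    change ‖fderiv ℝ X' z₀‖ < ‖fderiv ℝ X' z₀‖ + 1
    linarith
  have hKev : ∀ᶠ z in 𝓝 z₀, ‖fderiv ℝ X' z‖ < K :=
    (hX'.continuous_fderiv (by simp)).norm.continuousAt.eventually_lt continuousAt_const hK
  have hcev : ∀ᶠ z in 𝓝 z₀, ∀ i j, c' i j z = c i j z :=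
    eventually_all.2 fun i => eventually_all.2 fun j => hcc' i j
  have hOev : ∀ᶠ z in 𝓝 z₀, z ∈ O := hO.mem_nhds hz₀
  obtain ⟨N, hN, hNo, hz₀N⟩ := eventually_nhds_iff.1
    (hOev.and ((hXX'.eventually_nhds).and (hKev.and hcev)))
  let Ξ : Q × (ι → ι → ℝ) → Q × (ι → ι → ℝ) :=
    fun Z => (X' Z.1, fun i j => -∑ l, Z.2 i l * c' l j Z.1)
  have hΞ2 : ContDiff ℝ ∞ fun Z : Q × (ι → ι → ℝ) =>
      (fun i j => -∑ l, Z.2 i l * c' l j Z.1 : ι → ι → ℝ) := by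
    refine contDiff_pi.2 fun i => contDiff_pi.2 fun j => ContDiff.neg ?_
    refine ContDiff.sum fun l _ => ContDiff.mul ?_ ((hc' l j).comp contDiff_fst)
    exact contDiff_pi.1 (contDiff_pi.1 contDiff_snd i) l
  have hΞ : ContDiff ℝ ∞ Ξ := (hX'.comp contDiff_fst).prodMk hΞ2
  let one : ι → ι → ℝ := fun i j => if i = j then 1 else 0
  obtain ⟨ε, hε, W', hW', hzW', Φ, hΦ0, hΦs, hΦ⟩ := exists_smooth_local_flow hΞ (z₀, one)
    (O := Prod.fst ⁻¹' N) (continuous_fst.continuousAt.preimage_mem_nhds (hNo.mem_nhds hz₀N))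
  have hcW : ContDiff ℝ ∞ fun z : Q => (z, one) := contDiff_id.prodMk contDiff_const
  have hW : IsOpen ((fun z : Q => (z, one)) ⁻¹' W') := hW'.preimage hcW.continuous
  refine ⟨ε, hε, _, hW, hzW', fun t z => (Φ t (z, one)).1,
    fun t z => (Φ t (z, one)).2, fun z hz => by simp [hΦ0 _ hz], fun t ht => ?_,
    fun z hz t ht => ?_⟩
  · have h1 : ContDiffOn ℝ ∞ (fun z : Q => Φ t (z, one)) ((fun z : Q => (z, one)) ⁻¹' W') :=
      (hΦs t ht).comp hcW.contDiffOn (mapsTo_preimage _ _)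
    exact ⟨contDiff_fst.comp_contDiffOn h1, fun i j =>
      contDiffOn_pi.1 (contDiffOn_pi.1 (contDiff_snd.comp_contDiffOn h1) i) j⟩
  · have hder : ∀ t ∈ Ioo (-ε) ε, HasDerivAt (fun r => (Φ r (z, one)).1)
        (X' (Φ t (z, one)).1) t := fun t ht => (hΦ _ hz t ht).2.1.fst
    have hmem : ∀ t ∈ Ioo (-ε) ε, (Φ t (z, one)).1 ∈ N := fun t ht => (hΦ _ hz t ht).1
    have hXeq : ∀ t ∈ Ioo (-ε) ε, X' (Φ t (z, one)).1 = X (Φ t (z, one)).1 := fun t ht =>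
      (hN _ (hmem t ht)).2.1.self_of_nhds
    have hA : ∀ t ∈ Ioo (-ε) ε, ∀ i j, HasDerivAt (fun r => (Φ r (z, one)).2 i j)
        (-∑ l, (Φ t (z, one)).2 i l * c' l j (Φ t (z, one)).1) t := fun t ht i j =>
      hasDerivAt_pi.1 (hasDerivAt_pi.1 (hΦ _ hz t ht).2.1.snd i) j
    have hfd : ∀ t ∈ Ioo (-ε) ε, ∀ w, fderiv ℝ (fun z => (Φ t (z, one)).1) z w =
        (fderiv ℝ (Φ t) (z, one) (w, 0)).1 := by
      intro t ht w
      have h1 : HasFDerivAt (Φ t) (fderiv ℝ (Φ t) (z, one)) (z, one) :=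
        (((hΦs t ht).contDiffAt (hW'.mem_nhds hz)).differentiableAt (by simp)).hasFDerivAt
      have h2 : HasFDerivAt (fun z : Q => (z, one)) (ContinuousLinearMap.inl ℝ Q (ι → ι → ℝ)) z :=
        (hasFDerivAt_id z).prodMk (hasFDerivAt_const _ _)
      have h3 := (h1.comp z h2).fst
      exact DFunLike.congr_fun h3.fderiv w
    have hvar : ∀ w, ∀ t ∈ Ioo (-ε) ε,
        HasDerivAt (fun r => (fderiv ℝ (Φ r) (z, one) (w, 0)).1)
          (fderiv ℝ X' (Φ t (z, one)).1 (fderiv ℝ (Φ t) (z, one) (w, 0)).1) t := by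
      intro w t ht
      have h1 := ((hΦ _ hz t ht).2.2 (w, 0)).fst
      have h2 : HasFDerivAt Ξ _ (Φ t (z, one)) :=
        (((hX'.differentiable (by simp) (Φ t (z, one)).1).hasFDerivAt.comp _ hasFDerivAt_fst)).prodMk
          (hΞ2.differentiable (by simp) (Φ t (z, one))).hasFDerivAt
      rw [h2.fderiv] at h1
      exact h1
    refine ⟨(hN _ (hmem t ht)).1, hXeq t ht ▸ hder t ht, fun i => ?_⟩
    have h0 : (0 : ℝ) ∈ Ioo (-ε) ε := ⟨by linarith, hε⟩
    have huniq := ODE_solution_unique_of_mem_Ioo (a := -ε) (b := ε) (t₀ := 0) (K := K)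
      (v := fun t x => fderiv ℝ X' (Φ t (z, one)).1 x) (s := fun _ => univ)
      (f := fun r => (fderiv ℝ (Φ r) (z, one) (G i z, 0)).1)
      (g := fun r => ∑ j, (Φ r (z, one)).2 i j • G j (Φ r (z, one)).1)
      (fun r hr => ?_) h0 (fun r hr => ⟨hvar _ r hr, mem_univ _⟩)
      (fun r hr => ⟨?_, mem_univ _⟩) ?_
    · rw [hfd t ht]
      exact huniq ht
    · refine LipschitzWith.lipschitzOnWith ?_
      exact (fderiv ℝ X' (Φ r (z, one)).1).lipschitz.weaken (hN _ (hmem r hr)).2.2.1.le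
    · have hd : HasDerivAt (fun r => ∑ j, (Φ r (z, one)).2 i j • G j (Φ r (z, one)).1)
          (∑ j, ((Φ r (z, one)).2 i j • fderiv ℝ (G j) (Φ r (z, one)).1 (X (Φ r (z, one)).1) +
            (-∑ l, (Φ r (z, one)).2 i l * c' l j (Φ r (z, one)).1) • G j (Φ r (z, one)).1)) r := by
        refine HasDerivAt.fun_sum fun j _ => ?_
        refine (hA r hr i j).smul ?_
        have h1 := (((hG j).contDiffAt (hO.mem_nhds (hN _ (hmem r hr)).1)).differentiableAt
          (by simp)).hasFDerivAt
        have h2 := h1.comp_hasDerivAt r (hder r hr)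
        rw [hXeq r hr] at h2
        exact h2
      convert hd using 1
      have hfX : fderiv ℝ X' (Φ r (z, one)).1 = fderiv ℝ X (Φ r (z, one)).1 :=
        Filter.EventuallyEq.fderiv_eq (hN _ (hmem r hr)).2.1
      have hcc := (hN _ (hmem r hr)).2.2.2
      have hb := fun j => sub_eq_iff_eq_add.1 (hbr _ (hN _ (hmem r hr)).1 j)
      simp only [hfX, map_sum, map_smul, hcc, hb, smul_add, Finset.sum_add_distrib, neg_smul,
        Finset.sum_neg_distrib, Finset.sum_smul, Finset.smul_sum, mul_smul]
      rw [Finset.sum_comm]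
      abel
    · have h1 : fderiv ℝ (fun z => (Φ 0 (z, one)).1) z (G i z) = G i z := by
        have : (fun z => (Φ 0 (z, one)).1) =ᶠ[𝓝 z] id := by
          filter_upwards [hW.mem_nhds hz] with y hy
          simp [hΦ0 _ hy]
        rw [this.fderiv_eq, fderiv_id]; rfl
      rw [← hfd 0 h0, h1, hΦ0 _ hz]
      simp [one]

end Invariance

section SmoothNear

variable {E₁ : Type*} [NormedAddCommGroup E₁] [NormedSpace ℝ E₁]
  {H₁ : Type*} [TopologicalSpace H₁] {I₁ : ModelWithCorners ℝ E₁ H₁}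
  {M₁ : Type*} [TopologicalSpace M₁] [ChartedSpace H₁ M₁]
  {E₂ : Type*} [NormedAddCommGroup E₂] [NormedSpace ℝ E₂]
  {H₂ : Type*} [TopologicalSpace H₂] {I₂ : ModelWithCorners ℝ E₂ H₂}
  {M₂ : Type*} [TopologicalSpace M₂] [ChartedSpace H₂ M₂]
  {E₃ : Type*} [NormedAddCommGroup E₃] [NormedSpace ℝ E₃]
  {H₃ : Type*} [TopologicalSpace H₃] {I₃ : ModelWithCorners ℝ E₃ H₃}
  {M₃ : Type*} [TopologicalSpace M₃] [ChartedSpace H₃ M₃]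
  {V : Type*} [NormedAddCommGroup V] [NormedSpace ℝ V]

/-- The map `f` is smooth at all points near `x`. -/
def SmoothNear (I₁ : ModelWithCorners ℝ E₁ H₁) (I₂ : ModelWithCorners ℝ E₂ H₂) (f : M₁ → M₂)
    (x : M₁) : Prop :=
  ∀ᶠ y in 𝓝 x, ContMDiffAt I₁ I₂ ∞ f y

lemma SmoothNear.contMDiffAt {f : M₁ → M₂} {x : M₁} (h : SmoothNear I₁ I₂ f x) :
    ContMDiffAt I₁ I₂ ∞ f x := Eventually.self_of_nhds h

lemma SmoothNear.continuousAt {f : M₁ → M₂} {x : M₁} (h : SmoothNear I₁ I₂ f x) :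
    ContinuousAt f x := h.contMDiffAt.continuousAt

lemma SmoothNear.of_contMDiffOn {f : M₁ → M₂} {s : Set M₁} (h : ContMDiffOn I₁ I₂ ∞ f s)
    (hs : IsOpen s) {x : M₁} (hx : x ∈ s) : SmoothNear I₁ I₂ f x := by
  filter_upwards [hs.mem_nhds hx] with y hy
  exact h.contMDiffAt (hs.mem_nhds hy)

lemma SmoothNear.of_contMDiff {f : M₁ → M₂} (h : ContMDiff I₁ I₂ ∞ f) (x : M₁) :
    SmoothNear I₁ I₂ f x := Eventually.of_forall fun y => h y

lemma SmoothNear.exists_contMDiffOn {f : M₁ → M₂} {x : M₁} (h : SmoothNear I₁ I₂ f x) :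
    ∃ s : Set M₁, IsOpen s ∧ x ∈ s ∧ ContMDiffOn I₁ I₂ ∞ f s := by
  obtain ⟨s, hs, hso, hx⟩ := eventually_nhds_iff.1 h
  exact ⟨s, hso, hx, fun y hy => (hs y hy).contMDiffWithinAt⟩

lemma SmoothNear.congr {f g : M₁ → M₂} {x : M₁} (h : SmoothNear I₁ I₂ f x) (hfg : g =ᶠ[𝓝 x] f) :
    SmoothNear I₁ I₂ g x := by
  filter_upwards [h, hfg.eventually_nhds] with y hy hy'
  exact hy.congr_of_eventuallyEq hy'

lemma SmoothNear.comp {g : M₂ → M₃} {f : M₁ → M₂} {x : M₁} (hg : SmoothNear I₂ I₃ g (f x))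
    (hf : SmoothNear I₁ I₂ f x) : SmoothNear I₁ I₃ (fun y => g (f y)) x := by
  filter_upwards [hf, hf.continuousAt.eventually hg] with y hy hy'
  exact hy'.comp y hy

lemma SmoothNear.prodMk {g : M₁ → M₃} {f : M₁ → M₂} {x : M₁} (hf : SmoothNear I₁ I₂ f x)
    (hg : SmoothNear I₁ I₃ g x) : SmoothNear I₁ (I₂.prod I₃) (fun y => (f y, g y)) x := by
  filter_upwards [hf, hg] with y hy hy'
  exact hy.prodMk hy'

lemma smoothNear_const {c : M₂} {x : M₁} : SmoothNear I₁ I₂ (fun _ => c) x :=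
  Eventually.of_forall fun _ => contMDiffAt_const

lemma smoothNear_id {x : M₁} : SmoothNear I₁ I₁ (fun y => y) x :=
  Eventually.of_forall fun _ => contMDiffAt_id

lemma smoothNear_fst {x : M₁ × M₂} : SmoothNear (I₁.prod I₂) I₁ Prod.fst x :=
  Eventually.of_forall fun _ => contMDiffAt_fst

lemma smoothNear_snd {x : M₁ × M₂} : SmoothNear (I₁.prod I₂) I₂ Prod.snd x :=
  Eventually.of_forall fun _ => contMDiffAt_snd

lemma SmoothNear.clm_comp {W : Type*} [NormedAddCommGroup W] [NormedSpace ℝ W] {f : M₁ → V}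
    {x : M₁} (A : V →L[ℝ] W) (hf : SmoothNear I₁ 𝓘(ℝ, V) f x) :
    SmoothNear I₁ 𝓘(ℝ, W) (fun y => A (f y)) x :=
  (SmoothNear.of_contMDiff A.contMDiff (f x)).comp hf

lemma SmoothNear.add {f g : M₁ → V} {x : M₁} (hf : SmoothNear I₁ 𝓘(ℝ, V) f x)
    (hg : SmoothNear I₁ 𝓘(ℝ, V) g x) : SmoothNear I₁ 𝓘(ℝ, V) (fun y => f y + g y) x := by
  filter_upwards [hf, hg] with y hy hy'
  exact hy.add hy'

lemma SmoothNear.neg {f : M₁ → V} {x : M₁} (hf : SmoothNear I₁ 𝓘(ℝ, V) f x) :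
    SmoothNear I₁ 𝓘(ℝ, V) (fun y => -f y) x := by
  filter_upwards [hf] with y hy
  exact hy.neg

lemma SmoothNear.smul {f : M₁ → ℝ} {g : M₁ → V} {x : M₁} (hf : SmoothNear I₁ 𝓘(ℝ, ℝ) f x)
    (hg : SmoothNear I₁ 𝓘(ℝ, V) g x) : SmoothNear I₁ 𝓘(ℝ, V) (fun y => f y • g y) x := by
  filter_upwards [hf, hg] with y hy hy'
  exact hy.smul hy'

lemma SmoothNear.mul {f g : M₁ → ℝ} {x : M₁} (hf : SmoothNear I₁ 𝓘(ℝ, ℝ) f x)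
    (hg : SmoothNear I₁ 𝓘(ℝ, ℝ) g x) : SmoothNear I₁ 𝓘(ℝ, ℝ) (fun y => f y * g y) x :=
  hf.smul hg

lemma SmoothNear.sum {ι : Type*} {s : Finset ι} {f : ι → M₁ → V} {x : M₁}
    (hf : ∀ i ∈ s, SmoothNear I₁ 𝓘(ℝ, V) (f i) x) :
    SmoothNear I₁ 𝓘(ℝ, V) (fun y => ∑ i ∈ s, f i y) x := by
  have : ∀ᶠ y in 𝓝 x, ∀ i ∈ s, ContMDiffAt I₁ 𝓘(ℝ, V) ∞ (f i) y :=
    (Filter.eventually_all_finset s).2 hf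
  filter_upwards [this] with y hy
  exact ContMDiffAt.sum hy

variable [IsManifold I₁ ∞ M₁]

/-- The derivative of a smooth map with values in a vector space along a smooth vector field is
smooth. -/
lemma SmoothNear.mfderiv_vfield {h : M₁ → V} {X : VField I₁ M₁} {x : M₁}
    (hh : SmoothNear I₁ 𝓘(ℝ, V) h x)
    (hX : SmoothNear I₁ I₁.tangent (fun y => (⟨y, X y⟩ : TangentBundle I₁ M₁)) x) :
    SmoothNear I₁ 𝓘(ℝ, V) (fun y => (mfderiv I₁ 𝓘(ℝ, V) h y (X y) : V)) x := by
  obtain ⟨s, hs, hso, hxs⟩ := eventually_nhds_iff.1 (Eventually.and hh hX)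
  have h1 : ContMDiffOn I₁ 𝓘(ℝ, V) ∞ h s := fun y hy => (hs y hy).1.contMDiffWithinAt
  have h2 : ContMDiffOn I₁ I₁.tangent ∞ (fun y => (⟨y, X y⟩ : TangentBundle I₁ M₁)) s :=
    fun y hy => (hs y hy).2.contMDiffWithinAt
  have h3 := h1.contMDiffOn_tangentMapWithin (m := ∞) (by simp) hso.uniqueMDiffOn
  have h4 := h3.comp h2 (fun y hy => hy)
  have h5 := (contMDiff_snd_tangentBundle_modelSpace (n := ∞) V 𝓘(ℝ, V)).comp_contMDiffOn h4
  refine SmoothNear.of_contMDiffOn (h5.congr fun y hy => ?_) hso hxs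
  simp only [Function.comp, tangentMapWithin]
  rw [mfderivWithin_of_isOpen hso hy]

end SmoothNear

section SpanAlong

variable {E : Type*} [NormedAddCommGroup E] [NormedSpace ℝ E]
  {M : Type*} [TopologicalSpace M] [ChartedSpace E M] [IsManifold 𝓘(ℝ, E) ∞ M]
  {E₁ : Type*} [NormedAddCommGroup E₁] [NormedSpace ℝ E₁]
  {H₁ : Type*} [TopologicalSpace H₁] {I₁ : ModelWithCorners ℝ E₁ H₁}
  {Q : Type*} [TopologicalSpace Q] [ChartedSpace H₁ Q]
  {E₂ : Type*} [NormedAddCommGroup E₂] [NormedSpace ℝ E₂]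
  {H₂ : Type*} [TopologicalSpace H₂] {I₂ : ModelWithCorners ℝ E₂ H₂}
  {Q' : Type*} [TopologicalSpace Q'] [ChartedSpace H₂ Q']

/-- The value at `m` of a vector field, as an element of the model space. -/
def VField.vec (Y : VField 𝓘(ℝ, E) M) (m : M) : E := Y m

/-- Near `z₀`, the vector field `ξ` along the map `f : Q → M` is a linear combination, with smooth
functions on `Q` as coefficients, of vector fields of the foliation `F`. -/
def SpanAlong (F : SingularFoliation 𝓘(ℝ, E) M) (I₁ : ModelWithCorners ℝ E₁ H₁)
    (f : Q → M) (ξ : Q → E) (z₀ : Q) : Prop :=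
  ∃ (ι : Type) (_ : Fintype ι) (Y : ι → VField 𝓘(ℝ, E) M) (a : ι → Q → ℝ),
    (∀ i, Y i ∈ F.carrier) ∧ (∀ i, SmoothNear I₁ 𝓘(ℝ, ℝ) (a i) z₀) ∧
    ∀ᶠ z in 𝓝 z₀, ξ z = ∑ i, a i z • VField.vec (Y i) (f z)

variable {F : SingularFoliation 𝓘(ℝ, E) M} {f g : Q → M} {ξ η : Q → E} {z₀ : Q}

lemma SpanAlong.zero : SpanAlong F I₁ f (fun _ => 0) z₀ :=
  ⟨Empty, inferInstance, nofun, nofun, nofun, nofun, Eventually.of_forall fun _ => by simp⟩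

lemma SpanAlong.add (hξ : SpanAlong F I₁ f ξ z₀) (hη : SpanAlong F I₁ f η z₀) :
    SpanAlong F I₁ f (fun z => ξ z + η z) z₀ := by
  obtain ⟨ι, _, Y, a, hY, ha, h⟩ := hξ
  obtain ⟨κ, _, Z, b, hZ, hb, h'⟩ := hη
  refine ⟨ι ⊕ κ, inferInstance, Sum.elim Y Z, Sum.elim a b, by rintro (i | i); exacts [hY i, hZ i],
    by rintro (i | i); exacts [ha i, hb i], ?_⟩
  filter_upwards [h, h'] with z hz hz'
  simp [hz, hz']

lemma SpanAlong.smul {c : Q → ℝ} (hc : SmoothNear I₁ 𝓘(ℝ, ℝ) c z₀) (hξ : SpanAlong F I₁ f ξ z₀) :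
    SpanAlong F I₁ f (fun z => c z • ξ z) z₀ := by
  obtain ⟨ι, _, Y, a, hY, ha, h⟩ := hξ
  refine ⟨ι, inferInstance, Y, fun i z => c z * a i z, hY, fun i => hc.mul (ha i), ?_⟩
  filter_upwards [h] with z hz
  simp [hz, Finset.smul_sum, mul_smul]

lemma SpanAlong.sum {κ : Type*} {s : Finset κ} {ζ : κ → Q → E}
    (h : ∀ i ∈ s, SpanAlong F I₁ f (ζ i) z₀) : SpanAlong F I₁ f (fun z => ∑ i ∈ s, ζ i z) z₀ := by
  classical
  induction s using Finset.induction_on with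
  | empty => simpa using SpanAlong.zero
  | insert i s hi ih =>
    simp only [Finset.sum_insert hi]
    exact (h i (by simp)).add (ih fun j hj => h j (by simp [hj]))

lemma SpanAlong.congr (hξ : SpanAlong F I₁ f ξ z₀) (h : η =ᶠ[𝓝 z₀] ξ) :
    SpanAlong F I₁ f η z₀ := by
  obtain ⟨ι, _, Y, a, hY, ha, h'⟩ := hξ
  exact ⟨ι, inferInstance, Y, a, hY, ha, by filter_upwards [h, h'] with z hz hz'; rw [hz, hz']⟩

lemma SpanAlong.congr_map (hξ : SpanAlong F I₁ f ξ z₀) (h : g =ᶠ[𝓝 z₀] f) :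
    SpanAlong F I₁ g ξ z₀ := by
  obtain ⟨ι, _, Y, a, hY, ha, h'⟩ := hξ
  exact ⟨ι, inferInstance, Y, a, hY, ha, by filter_upwards [h, h'] with z hz hz'; rw [hz, hz']⟩

lemma SpanAlong.comp {σ : Q' → Q} {w₀ : Q'} (hξ : SpanAlong F I₁ f ξ (σ w₀))
    (hσ : SmoothNear I₂ I₁ σ w₀) :
    SpanAlong F I₂ (fun w => f (σ w)) (fun w => ξ (σ w)) w₀ := by
  obtain ⟨ι, _, Y, a, hY, ha, h⟩ := hξ
  exact ⟨ι, inferInstance, Y, fun i w => a i (σ w), hY, fun i => (ha i).comp hσ,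
    hσ.continuousAt.eventually h⟩

lemma SpanAlong.of_mem {Y : VField 𝓘(ℝ, E) M} (hY : Y ∈ F.carrier) :
    SpanAlong F I₁ f (fun z => VField.vec Y (f z)) z₀ :=
  ⟨Unit, inferInstance, fun _ => Y, fun _ _ => 1, fun _ => hY, fun _ => smoothNear_const,
    Eventually.of_forall fun _ => by simp⟩

/-- A smooth linear combination of vector fields of the foliation coincides locally with a vector
field of the foliation. -/
lemma SpanAlong.exists_mem [FiniteDimensional ℝ E] [T2Space M] {X : M → E} {m₀ : M}
    (h : SpanAlong F 𝓘(ℝ, E) (fun m => m) X m₀) :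
    ∃ Y ∈ F.carrier, ∀ᶠ m in 𝓝 m₀, X m = VField.vec Y m := by
  classical
  obtain ⟨ι, _, Y, a, hY, ha, h⟩ := h
  have key : ∀ i, ∃ b : M → ℝ, ContMDiff 𝓘(ℝ, E) 𝓘(ℝ, ℝ) ∞ b ∧ b =ᶠ[𝓝 m₀] a i := by
    intro i
    obtain ⟨s, hs, hm, hsm⟩ := (ha i).exists_contMDiffOn
    obtain ⟨χ, hχ⟩ := (SmoothBumpFunction.nhds_basis_tsupport (I := 𝓘(ℝ, E)) m₀).mem_iff.1
      (hs.mem_nhds hm)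
    refine ⟨fun m => χ m • a i m, ?_, ?_⟩
    · refine contMDiff_of_tsupport fun x hx => ?_
      have hx' : x ∈ s := hχ.2 (closure_mono (Function.support_smul_subset_left _ _) hx)
      exact χ.contMDiff.contMDiffAt.smul (hsm.contMDiffAt (hs.mem_nhds hx'))
    · filter_upwards [χ.eventuallyEq_one] with m hm
      simp [hm]
  choose b hb hba using key
  have hsum : ∀ s : Finset ι, ∃ Z ∈ F.carrier, ∀ m, VField.vec Z m = ∑ i ∈ s, b i m • VField.vec (Y i) m := by
    intro s
    induction s using Finset.induction_on with
    | empty => exact ⟨_, F.zero_mem, fun m => rfl⟩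
    | insert i s hi ih =>
      obtain ⟨Z, hZ, hZ'⟩ := ih
      refine ⟨_, F.add_mem _ (F.smul_mem (b i) (hb i) _ (hY i)) _ hZ, fun m => ?_⟩
      rw [Finset.sum_insert hi, ← hZ']
      rfl
  obtain ⟨Z, hZ, hZ'⟩ := hsum Finset.univ
  refine ⟨Z, hZ, ?_⟩
  filter_upwards [h, eventually_all.2 hba] with m hm hm'
  rw [hm, hZ']
  exact Finset.sum_congr rfl fun i _ => by rw [hm' i]

lemma SpanAlong.of_mem_onOpen {Y : VField 𝓘(ℝ, E) M} {W : Set M} (hY : Y ∈ F.onOpen W)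
    (hf : ContinuousAt f z₀) (hW : f z₀ ∈ W) :
    SpanAlong F I₁ f (fun z => VField.vec Y (f z)) z₀ := by
  obtain ⟨Z, hZ, h⟩ := hY _ hW
  exact (SpanAlong.of_mem hZ).congr (hf.eventually h)

end SpanAlong

section Chart

variable {E : Type*} [NormedAddCommGroup E] [NormedSpace ℝ E]
  {M : Type*} [TopologicalSpace M] [ChartedSpace E M]

/-- The expression of a vector field in the chart at `m₀`. -/
noncomputable def chartField (m₀ : M) (Y : VField 𝓘(ℝ, E) M) : E → E :=
  VectorField.mpullback 𝓘(ℝ, E) 𝓘(ℝ, E) (extChartAt 𝓘(ℝ, E) m₀).symm Y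

lemma chartField_sum {ι : Type*} [Fintype ι] {m₀ : M} {x : E} {Y : VField 𝓘(ℝ, E) M}
    {Z : ι → VField 𝓘(ℝ, E) M} {a : ι → ℝ}
    (h : Y ((extChartAt 𝓘(ℝ, E) m₀).symm x) = ∑ i, a i • Z i ((extChartAt 𝓘(ℝ, E) m₀).symm x)) :
    chartField m₀ Y x = ∑ i, a i • chartField m₀ (Z i) x := by
  simp only [chartField, VectorField.mpullback_apply, h, map_sum, map_smul]
  rfl

variable [IsManifold 𝓘(ℝ, E) ∞ M]

lemma isInvertible_mfderiv_chart_symm {m₀ : M} {x : E} (hx : x ∈ (extChartAt 𝓘(ℝ, E) m₀).target) :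
    (mfderiv 𝓘(ℝ, E) 𝓘(ℝ, E) (extChartAt 𝓘(ℝ, E) m₀).symm x).IsInvertible := by
  have := isInvertible_mfderivWithin_extChartAt_symm (I := 𝓘(ℝ, E)) hx
  rwa [modelWithCornersSelf_coe, range_id, mfderivWithin_univ] at this

lemma mfderiv_chart_symm_chartField {m₀ : M} {x : E}
    (hx : x ∈ (extChartAt 𝓘(ℝ, E) m₀).target) (Y : VField 𝓘(ℝ, E) M) :
    mfderiv 𝓘(ℝ, E) 𝓘(ℝ, E) (extChartAt 𝓘(ℝ, E) m₀).symm x (chartField (E := E) m₀ Y x) =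
      Y ((extChartAt 𝓘(ℝ, E) m₀).symm x) :=
  (isInvertible_mfderiv_chart_symm hx).self_apply_inverse _

lemma chart_symm_contMDiffAt {m₀ : M} {x : E} (hx : x ∈ (extChartAt 𝓘(ℝ, E) m₀).target) :
    ContMDiffAt 𝓘(ℝ, E) 𝓘(ℝ, E) ∞ (extChartAt 𝓘(ℝ, E) m₀).symm x :=
  (contMDiffOn_extChartAt_symm m₀).contMDiffAt ((isOpen_extChartAt_target m₀).mem_nhds hx)

lemma mfderiv_chart_eq_chartField {m₀ m : M} (hm : m ∈ (extChartAt 𝓘(ℝ, E) m₀).source)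
    (Y : VField 𝓘(ℝ, E) M) :
    mfderiv 𝓘(ℝ, E) 𝓘(ℝ, E) (extChartAt 𝓘(ℝ, E) m₀) m (Y m) =
      chartField m₀ Y (extChartAt 𝓘(ℝ, E) m₀ m) := by
  have hx := (extChartAt 𝓘(ℝ, E) m₀).map_source hm
  have h1 := mfderiv_chart_symm_chartField hx Y
  have h2 : mfderiv 𝓘(ℝ, E) 𝓘(ℝ, E) (extChartAt 𝓘(ℝ, E) m₀)
      ((extChartAt 𝓘(ℝ, E) m₀).symm (extChartAt 𝓘(ℝ, E) m₀ m))
      (mfderiv 𝓘(ℝ, E) 𝓘(ℝ, E) (extChartAt 𝓘(ℝ, E) m₀).symm (extChartAt 𝓘(ℝ, E) m₀ m)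
        (chartField (E := E) m₀ Y (extChartAt 𝓘(ℝ, E) m₀ m))) =
      chartField m₀ Y (extChartAt 𝓘(ℝ, E) m₀ m) := by
    have hid : (extChartAt 𝓘(ℝ, E) m₀) ∘ (extChartAt 𝓘(ℝ, E) m₀).symm =ᶠ[𝓝
        (extChartAt 𝓘(ℝ, E) m₀ m)] id := by
      filter_upwards [(isOpen_extChartAt_target m₀).mem_nhds hx] with y hy
      exact (extChartAt 𝓘(ℝ, E) m₀).right_inv hy
    have hc := mfderiv_comp (I := 𝓘(ℝ, E)) (I' := 𝓘(ℝ, E)) (I'' := 𝓘(ℝ, E))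
      (extChartAt 𝓘(ℝ, E) m₀ m)
      (g := extChartAt 𝓘(ℝ, E) m₀) (f := (extChartAt 𝓘(ℝ, E) m₀).symm)
      ((contMDiffAt_extChartAt' (n := ∞) (by
        rw [← extChartAt_source 𝓘(ℝ, E), (extChartAt 𝓘(ℝ, E) m₀).left_inv hm]; exact hm)).mdifferentiableAt
          (by simp))
      ((chart_symm_contMDiffAt hx).mdifferentiableAt (by simp))
    rw [hid.mfderiv_eq, mfderiv_id] at hc
    exact (DFunLike.congr_fun hc _).symm
  rw [h1] at h2
  rwa [(extChartAt 𝓘(ℝ, E) m₀).left_inv hm] at h2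

lemma chartField_contDiffOn [CompleteSpace E] {m₀ : M} {Y : VField 𝓘(ℝ, E) M} (hY : SmoothVFieldOn 𝓘(ℝ, E) Y univ) :
    ContDiffOn ℝ ∞ (chartField m₀ Y) (extChartAt 𝓘(ℝ, E) m₀).target := by
  intro x hx
  have h1 := ContMDiffAt.mpullback_vectorField_preimage (m := ∞)
    (hY.contMDiffAt univ_mem) (chart_symm_contMDiffAt hx) (isInvertible_mfderiv_chart_symm hx)
    (by simp)
  exact contMDiffWithinAt_vectorSpace_iff_contDiffWithinAt.1 h1.contMDiffWithinAt

lemma lieBracket_chartField [CompleteSpace E] {m₀ : M} {Y Z : VField 𝓘(ℝ, E) M}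
    (hY : SmoothVFieldOn 𝓘(ℝ, E) Y univ) (hZ : SmoothVFieldOn 𝓘(ℝ, E) Z univ) {x : E}
    (hx : x ∈ (extChartAt 𝓘(ℝ, E) m₀).target) :
    fderiv ℝ (chartField m₀ Z) x (chartField m₀ Y x) -
      fderiv ℝ (chartField m₀ Y) x (chartField m₀ Z x) =
      chartField m₀ (VectorField.mlieBracket 𝓘(ℝ, E) Y Z) x := by
  have hY' := (hY.contMDiffAt (x := (extChartAt 𝓘(ℝ, E) m₀).symm x) univ_mem)
  have hZ' := (hZ.contMDiffAt (x := (extChartAt 𝓘(ℝ, E) m₀).symm x) univ_mem)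
  have : IsManifold 𝓘(ℝ, E) (minSmoothness ℝ 2) M := by
    rw [minSmoothness_of_isRCLikeNormedField]
    exact IsManifold.of_le (n := ∞) (by exact WithTop.coe_le_coe.2 le_top)
  have h := VectorField.mpullback_mlieBracket (I := 𝓘(ℝ, E)) (I' := 𝓘(ℝ, E)) (n := ∞)
    (f := (extChartAt 𝓘(ℝ, E) m₀).symm)
    (hY'.mdifferentiableAt (by simp)) (hZ'.mdifferentiableAt (by simp))
    (chart_symm_contMDiffAt hx) (by
      rw [minSmoothness_of_isRCLikeNormedField]; exact WithTop.coe_le_coe.2 le_top)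
  refine Eq.trans ?_ h.symm
  rw [← VectorField.mlieBracketWithin_univ, VectorField.mlieBracketWithin_eq_lieBracketWithin]
  exact (congrFun (VectorField.lieBracketWithin_univ (𝕜 := ℝ) (V := chartField m₀ Y)
    (W := chartField m₀ Z)) x).symm

end Chart

section Transports

variable {E : Type*} [NormedAddCommGroup E] [NormedSpace ℝ E]
  {M : Type*} [TopologicalSpace M] [ChartedSpace E M] [IsManifold 𝓘(ℝ, E) ∞ M]
  {E' : Type*} [NormedAddCommGroup E'] [NormedSpace ℝ E']

/-- The tangent vector `(v, w)` of `E' × M`. -/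
def pairVec {z : E' × M} (v : E') (w : TangentSpace 𝓘(ℝ, E) z.2) :
    TangentSpace (𝓘(ℝ, E').prod 𝓘(ℝ, E)) z :=
  ((v, w) : TangentSpace 𝓘(ℝ, E') z.1 × TangentSpace 𝓘(ℝ, E) z.2)

/-- The map `f : E' × M → M`, seen as a family of maps from `M` to itself with parameter in `E'`, is
smooth near `z₀` and its differential maps the vector fields of the foliation and the constant
vector fields of the parameter space to vector fields of the foliation. -/
def Transports (F : SingularFoliation 𝓘(ℝ, E) M) (f : E' × M → M) (z₀ : E' × M) : Prop :=
  SmoothNear (𝓘(ℝ, E').prod 𝓘(ℝ, E)) 𝓘(ℝ, E) f z₀ ∧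
    ∀ (v : E'), ∀ Y ∈ F.carrier, SpanAlong F (𝓘(ℝ, E').prod 𝓘(ℝ, E)) f
      (fun z => (mfderiv (𝓘(ℝ, E').prod 𝓘(ℝ, E)) 𝓘(ℝ, E) f z (pairVec v (Y z.2)) : E)) z₀

variable {F : SingularFoliation 𝓘(ℝ, E) M} {f g : E' × M → M} {z₀ : E' × M}

lemma Transports.congr (hf : Transports F f z₀) (h : g =ᶠ[𝓝 z₀] f) : Transports F g z₀ := by
  refine ⟨hf.1.congr h, fun v Y hY => ((hf.2 v Y hY).congr_map h).congr ?_⟩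
  filter_upwards [h.eventually_nhds] with z hz
  rw [Filter.EventuallyEq.mfderiv_eq hz]
  rfl

lemma transports_snd : Transports F (Prod.snd : E' × M → M) z₀ := by
  refine ⟨smoothNear_snd, fun v Y hY => (SpanAlong.of_mem hY).congr
    (Eventually.of_forall fun z => ?_)⟩
  simp only [mfderiv_snd]
  rfl

lemma Transports.comp (hf : Transports F f (z₀.1, g z₀)) (hg : Transports F g z₀) :
    Transports F (fun z => f (z.1, g z)) z₀ := by
  have hσ : SmoothNear (𝓘(ℝ, E').prod 𝓘(ℝ, E)) (𝓘(ℝ, E').prod 𝓘(ℝ, E))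
      (fun z => (z.1, g z)) z₀ := smoothNear_fst.prodMk hg.1
  refine ⟨SmoothNear.comp (g := f) (f := fun z : E' × M => (z.1, g z)) hf.1 hσ, fun v Y hY => ?_⟩
  have h1 := SpanAlong.comp (σ := fun z : E' × M => (z.1, g z)) (hf.2 v _ F.zero_mem) hσ
  obtain ⟨ι, _, Z, a, hZ, ha, h2⟩ := hg.2 v Y hY
  have h3 : ∀ i, SpanAlong F (𝓘(ℝ, E').prod 𝓘(ℝ, E)) (fun z => f (z.1, g z)) _ z₀ := fun i =>
    (SpanAlong.comp (σ := fun z : E' × M => (z.1, g z)) (hf.2 0 (Z i) (hZ i)) hσ).smul (ha i)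
  refine (h1.add (SpanAlong.sum (s := Finset.univ) fun i _ => h3 i)).congr ?_
  filter_upwards [h2, hg.1, hσ.continuousAt.eventually hf.1] with z hz hgz hfz
  have hd : mfderiv (𝓘(ℝ, E').prod 𝓘(ℝ, E)) 𝓘(ℝ, E) (fun z => f (z.1, g z)) z =
      (mfderiv (𝓘(ℝ, E').prod 𝓘(ℝ, E)) 𝓘(ℝ, E) f (z.1, g z)).comp
        ((mfderiv (𝓘(ℝ, E').prod 𝓘(ℝ, E)) 𝓘(ℝ, E') Prod.fst z).prod
          (mfderiv (𝓘(ℝ, E').prod 𝓘(ℝ, E)) 𝓘(ℝ, E) g z)) := by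
    have := mfderiv_comp z (g := f) (f := fun z : E' × M => (z.1, g z))
      (hfz.mdifferentiableAt (by simp))
      (mdifferentiableAt_fst.prodMk (hgz.mdifferentiableAt (by simp)))
    rw [mfderiv_prodMk mdifferentiableAt_fst (hgz.mdifferentiableAt (by simp))] at this
    exact this
  have hv : ((mfderiv (𝓘(ℝ, E').prod 𝓘(ℝ, E)) 𝓘(ℝ, E') Prod.fst z).prod
      (mfderiv (𝓘(ℝ, E').prod 𝓘(ℝ, E)) 𝓘(ℝ, E) g z)) (pairVec v (Y z.2)) =
      pairVec (z := (z.1, g z)) v (0 : TangentSpace 𝓘(ℝ, E) (g z)) +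
        ∑ i, a i z • pairVec (z := (z.1, g z)) 0 (Z i (g z)) := by
    have e1 : (mfderiv (𝓘(ℝ, E').prod 𝓘(ℝ, E)) 𝓘(ℝ, E') Prod.fst z) (pairVec v (Y z.2)) = v := by
      rw [mfderiv_fst]; rfl
    have key : ((v, ∑ i, a i z • VField.vec (Z i) (g z)) : E' × E) =
        (v, 0) + ∑ i, a i z • ((0, VField.vec (Z i) (g z)) : E' × E) := by
      ext <;> simp [Prod.fst_sum, Prod.snd_sum]
    exact Eq.trans (α := E' × E) (congrArg₂ (Prod.mk (α := E') (β := E)) e1 hz) key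
  rw [hd]
  refine (congrArg (mfderiv (𝓘(ℝ, E').prod 𝓘(ℝ, E)) 𝓘(ℝ, E) f (z.1, g z)) hv).trans ?_
  rw [map_add, map_sum]
  simp only [map_smul]
  rfl

end Transports

section ParametrizedField

variable {E : Type*} [NormedAddCommGroup E] [NormedSpace ℝ E] [FiniteDimensional ℝ E]
  {E' : Type*} [NormedAddCommGroup E'] [NormedSpace ℝ E'] [FiniteDimensional ℝ E']

/-- Local flows of the vector field `(0, ∑ k, u k • B k x)` on `E' × E`, when the `Y i` generate a
family of vector fields on `E` that contains the `B k` and their brackets with the `Y i`. -/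
lemma exists_parametrized_flow {n K : ℕ} (b : Module.Basis (Fin n) ℝ E') {T : Set E} (hT : IsOpen T)
    {B : Fin n → E → E} {Y : Fin K → E → E} (hB : ∀ k, ContDiffOn ℝ ∞ (B k) T)
    (hY : ∀ i, ContDiffOn ℝ ∞ (Y i) T) {d : Fin n → Fin K → E → ℝ}
    {e : Fin n → Fin K → Fin K → E → ℝ} (hd : ∀ k i, ContDiffOn ℝ ∞ (d k i) T)
    (he : ∀ k i j, ContDiffOn ℝ ∞ (e k i j) T)
    (hBY : ∀ x ∈ T, ∀ k, B k x = ∑ i, d k i x • Y i x)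
    (hbr : ∀ x ∈ T, ∀ k i, fderiv ℝ (Y i) x (B k x) - fderiv ℝ (B k) x (Y i x) =
      ∑ j, e k i j x • Y j x) (u₀ : E') {x₀ : E} (hx₀ : x₀ ∈ T) :
    ∃ ε > 0, ∃ W : Set (E' × E), IsOpen W ∧ (u₀, x₀) ∈ W ∧ ∃ (φ : ℝ → E' × E → E' × E)
      (A : ℝ → E' × E → (Fin n ⊕ Fin K) → Fin K → ℝ),
      (∀ z ∈ W, φ 0 z = z) ∧
      (∀ t ∈ Ioo (-ε) ε, ContDiffOn ℝ ∞ (φ t) W ∧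
        ∀ i j, ContDiffOn ℝ ∞ (fun z => A t z i j) W) ∧
      ∀ z ∈ W, ∀ t ∈ Ioo (-ε) ε, (φ t z).2 ∈ T ∧
        HasDerivAt (fun r => (φ r z).2) (∑ k, b.coord k z.1 • B k (φ t z).2) t ∧
        (∀ k, (fderiv ℝ (φ t) z (b k, 0)).2 = ∑ j, A t z (Sum.inl k) j • Y j (φ t z).2) ∧
        ∀ i, (fderiv ℝ (φ t) z (0, Y i z.2)).2 = ∑ j, A t z (Sum.inr i) j • Y j (φ t z).2 := by
  let cf : Fin n → E' →L[ℝ] ℝ := fun k => LinearMap.toContinuousLinearMap (b.coord k)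
  let X : E' × E → E' × E := fun z => (0, ∑ k, cf k z.1 • B k z.2)
  let G : Fin n ⊕ Fin K → E' × E → E' × E :=
    Sum.elim (fun k _ => (b k, 0)) (fun i z => (0, Y i z.2))
  let c : Fin n ⊕ Fin K → Fin n ⊕ Fin K → E' × E → ℝ :=
    Sum.elim (fun k => Sum.elim (fun _ _ => 0) (fun j z => - d k j z.2))
      (fun i => Sum.elim (fun _ _ => 0) (fun j z => ∑ k, cf k z.1 * e k i j z.2))
  have hO : IsOpen (Prod.snd ⁻¹' T : Set (E' × E)) := hT.preimage continuous_snd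
  have hsnd : ∀ {F : Type _} [NormedAddCommGroup F] [NormedSpace ℝ F] {h : E → F},
      ContDiffOn ℝ ∞ h T → ContDiffOn ℝ ∞ (fun z : E' × E => h z.2) (Prod.snd ⁻¹' T) :=
    fun h => h.comp contDiff_snd.contDiffOn (mapsTo_preimage _ _)
  have hsndR : ∀ {h : E → ℝ},
      ContDiffOn ℝ ∞ h T → ContDiffOn ℝ ∞ (fun z : E' × E => h z.2) (Prod.snd ⁻¹' T) :=
    fun h => h.comp contDiff_snd.contDiffOn (mapsTo_preimage _ _)
  have hcf : ∀ k, ContDiff ℝ ∞ fun z : E' × E => cf k z.1 := fun k =>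
    (cf k).contDiff.comp contDiff_fst
  have hX2 : ContDiffOn ℝ ∞ (fun z : E' × E => ∑ k, cf k z.1 • B k z.2) (Prod.snd ⁻¹' T) :=
    ContDiffOn.sum fun k _ => (hcf k).contDiffOn.smul (hsnd (hB k))
  have hX : ContDiffOn ℝ ∞ X (Prod.snd ⁻¹' T) := contDiffOn_const.prodMk hX2
  have hG : ∀ i, ContDiffOn ℝ ∞ (G i) (Prod.snd ⁻¹' T) := by
    rintro (k | i)
    · exact contDiffOn_const
    · exact contDiffOn_const.prodMk (hsnd (hY i))
  have hc : ∀ i j, ContDiffOn ℝ ∞ (c i j) (Prod.snd ⁻¹' T) := by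
    rintro (k | i) (l | j)
    · exact contDiffOn_const
    · exact (hsndR (hd k j)).neg
    · exact contDiffOn_const
    · change ContDiffOn ℝ ∞ (fun z : E' × E => ∑ k, cf k z.1 * e k i j z.2) _
      exact ContDiffOn.sum fun k _ => (hcf k).contDiffOn.mul (hsndR (he k i j))
  have hXd : ∀ z : E' × E, z.2 ∈ T → ∀ w : E' × E, fderiv ℝ X z w =
      (0, ∑ k, (cf k z.1 • fderiv ℝ (B k) z.2 w.2 + cf k w.1 • B k z.2)) := by
    intro z hz w
    have h1 : ∀ k, HasFDerivAt (fun z : E' × E => cf k z.1 • B k z.2) _ z := fun k =>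
      (((cf k).hasFDerivAt.comp z hasFDerivAt_fst).smul
        ((((hB k).contDiffAt (hT.mem_nhds hz)).differentiableAt
          (by simp)).hasFDerivAt.comp z hasFDerivAt_snd))
    have h2 : HasFDerivAt X _ z :=
      (hasFDerivAt_const (0 : E') z).prodMk (HasFDerivAt.fun_sum fun k _ => h1 k)
    rw [h2.fderiv]
    simp
  have hbrX : ∀ z ∈ (Prod.snd ⁻¹' T : Set (E' × E)), ∀ i,
      fderiv ℝ (G i) z (X z) - fderiv ℝ X z (G i z) = ∑ j, c i j z • G j z := by
    intro z hz i
    rw [hXd z hz, Fintype.sum_sum_type]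
    rcases i with k | i
    · have h0 : fderiv ℝ (G (Sum.inl k)) z = 0 := fderiv_const_apply _
      rw [h0]
      have h1 : ∀ l, cf l (b k) = if k = l then 1 else 0 := fun l => by
        simp [cf, Finsupp.single_apply]
      ext
      · simp [G, c, Prod.fst_sum]
      · simp [G, c, Prod.snd_sum, h1, hBY z.2 hz]
    · have h0 : fderiv ℝ (G (Sum.inr i)) z (X z) = (0, fderiv ℝ (Y i) z.2 (X z).2) := by
        have : HasFDerivAt (G (Sum.inr i)) _ z := (hasFDerivAt_const (0 : E') z).prodMk
          ((((hY i).contDiffAt (hT.mem_nhds hz)).differentiableAt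
            (by simp)).hasFDerivAt.comp z hasFDerivAt_snd)
        rw [this.fderiv]
        simp
      rw [h0]
      ext
      · simp [G, c, Prod.fst_sum]
      · have h2 := fun k => hbr z.2 hz k i
        simp only [G, c, X, Prod.snd_sum, Sum.elim_inr, Sum.elim_inl, Prod.snd_sub, map_sum,
          map_smul, map_zero, zero_smul, add_zero, Prod.smul_snd,
          Finset.sum_const_zero, zero_add, Finset.sum_smul, mul_smul, ← Finset.sum_sub_distrib,
          ← smul_sub, h2, Finset.smul_sum]
        rw [Finset.sum_comm]
  obtain ⟨ε, hε, W, hW, hmW, φ, A, hφ0, hφs, hφ⟩ :=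
    exists_local_flow_preserving (z₀ := (u₀, x₀)) hO hx₀ hX hG hc hbrX
  refine ⟨ε, hε, W, hW, hmW, φ, fun t z i j => A t z i (Sum.inr j), hφ0,
    fun t ht => ⟨(hφs t ht).1, fun i j => (hφs t ht).2 _ _⟩, fun z hz t ht => ?_⟩
  obtain ⟨h1, h2, h3⟩ := hφ z hz t ht
  have hfst : (φ t z).1 = z.1 := by
    have hc : ∀ r ∈ Ioo (-ε) ε, HasDerivAt (fun r => (φ r z).1) 0 r := fun r hr =>
      (hφ z hz r hr).2.1.fst
    have h0 : (0 : ℝ) ∈ Ioo (-ε) ε := ⟨by linarith, hε⟩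
    have := isOpen_Ioo.is_const_of_fderiv_eq_zero (𝕜 := ℝ) isPreconnected_Ioo
      (fun r hr => (hc r hr).differentiableAt.differentiableWithinAt)
      (fun r hr => by rw [(hc r hr).hasFDerivAt.fderiv]; ext; simp) ht h0
    exact this.trans (by rw [hφ0 z hz])
  refine ⟨h1, ?_, fun k => ?_, fun i => ?_⟩
  · have := h2.snd
    simp only [X, hfst] at this
    exact this
  · have := congrArg Prod.snd (h3 (Sum.inl k))
    rw [Fintype.sum_sum_type] at this
    simpa [G, Prod.snd_sum] using this
  · have := congrArg Prod.snd (h3 (Sum.inr i))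
    rw [Fintype.sum_sum_type] at this
    simpa [G, Prod.snd_sum] using this

end ParametrizedField

section LocalTransport

variable {E : Type*} [NormedAddCommGroup E] [NormedSpace ℝ E] [FiniteDimensional ℝ E]
  {M : Type*} [TopologicalSpace M] [ChartedSpace E M] [IsManifold 𝓘(ℝ, E) ∞ M]
  {E' : Type*} [NormedAddCommGroup E'] [NormedSpace ℝ E'] [FiniteDimensional ℝ E']

omit [FiniteDimensional ℝ E] in
lemma mfderiv_chart_symm_sum {ι : Type*} [Fintype ι] {m₀ : M} {x : E}
    (hx : x ∈ (extChartAt 𝓘(ℝ, E) m₀).target) (a : ι → ℝ) (Z : ι → VField 𝓘(ℝ, E) M) :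
    (mfderiv 𝓘(ℝ, E) 𝓘(ℝ, E) (extChartAt 𝓘(ℝ, E) m₀).symm x
      (∑ i, a i • chartField (E := E) m₀ (Z i) x : E) : E) =
      ∑ i, a i • VField.vec (Z i) ((extChartAt 𝓘(ℝ, E) m₀).symm x) := by
  have h1 : ∀ A : E →L[ℝ] E, A (∑ i, a i • chartField (E := E) m₀ (Z i) x : E) =
      ∑ i, a i • A (chartField (E := E) m₀ (Z i) x) := fun A => by
    simp only [map_sum, map_smul]
  refine (h1 _).trans (Finset.sum_congr rfl fun i _ => ?_)
  exact congrArg (fun w : E => a i • w) (mfderiv_chart_symm_chartField hx (Z i))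

/-- Vector fields `∑ k, u k • B k` of the foliation, depending on a parameter `u ∈ E'`, have local
flows which transport the foliation. -/
theorem exists_local_transport {F : SingularFoliation 𝓘(ℝ, E) M} {β : E' → VField 𝓘(ℝ, E) M}
    {n : ℕ} (b : Module.Basis (Fin n) ℝ E') {B : Fin n → VField 𝓘(ℝ, E) M}
    (hB : ∀ k, B k ∈ F.carrier) {m₀ : M} {N₀ : Set M} (hN₀ : N₀ ∈ 𝓝 m₀)
    (hβ : ∀ m ∈ N₀, ∀ u, VField.vec (β u) m = ∑ k, b.coord k u • VField.vec (B k) m) (u₀ : E') :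
    ∃ ε > 0, ∃ W : Set (E' × M), IsOpen W ∧ (u₀, m₀) ∈ W ∧ ∃ f : ℝ → E' × M → M,
      (∀ z ∈ W, f 0 z = z.2) ∧ ∀ t ∈ Ioo (-ε) ε, ∀ z ∈ W, Transports F (f t) z ∧ f t z ∈ N₀ ∧
        HasMFDerivAt 𝓘(ℝ, ℝ) 𝓘(ℝ, E) (fun r => f r z) t
          ((1 : ℝ →L[ℝ] ℝ).smulRight (β z.1 (f t z))) := by
  obtain ⟨V, hV, hmV, K, Y, hY, hgen⟩ := F.locally_fg m₀
  set ψ := extChartAt 𝓘(ℝ, E) m₀ with hψ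
  obtain ⟨N, hNsub, hN, hmN⟩ := mem_nhds_iff.1 (inter_mem hN₀
    (inter_mem (hV.mem_nhds hmV) (extChartAt_source_mem_nhds (I := 𝓘(ℝ, E)) m₀)))
  choose d hd hd' using fun k => hgen (B k) (hB k)
  choose e he he' using fun k i => hgen _ (F.lie_mem _ (hB k) _ (hY i))
  set T : Set E := ψ.target ∩ ψ.symm ⁻¹' N with hT
  have hTo : IsOpen T := (continuousOn_extChartAt_symm m₀).isOpen_inter_preimage
    (isOpen_extChartAt_target m₀) hN
  have hcoef : ∀ {a : M → ℝ}, ContMDiffOn 𝓘(ℝ, E) 𝓘(ℝ, ℝ) ∞ a V →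
      ContDiffOn ℝ ∞ (fun x => a (ψ.symm x)) T := fun ha =>
    contMDiffOn_iff_contDiffOn.1 (ha.comp ((contMDiffOn_extChartAt_symm m₀).mono inter_subset_left)
      fun x hx => (hNsub hx.2).2.1)
  have hfield : ∀ {Z : VField 𝓘(ℝ, E) M}, Z ∈ F.carrier → ContDiffOn ℝ ∞ (chartField m₀ Z) T :=
    fun hZ => (chartField_contDiffOn (F.smooth _ hZ)).mono inter_subset_left
  have hsum : ∀ {Z : VField 𝓘(ℝ, E) M} {a : Fin K → M → ℝ},
      (∀ y ∈ V, Z y = ∑ i, a i y • Y i y) → ∀ x ∈ T,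
      chartField m₀ Z x = ∑ i, a i (ψ.symm x) • chartField m₀ (Y i) x := fun h x hx =>
    chartField_sum (h _ (hNsub hx.2).2.1)
  have hψm : ∀ m ∈ N, ψ m ∈ T := fun m hm => by
    refine ⟨ψ.map_source (hNsub hm).2.2, ?_⟩
    rw [mem_preimage, ψ.left_inv (hNsub hm).2.2]; exact hm
  obtain ⟨ε, hε, W, hW, hmW, φ, A, hφ0, hφs, hφ⟩ := exists_parametrized_flow b hTo
    (fun k => hfield (hB k)) (fun i => hfield (hY i)) (fun k i => hcoef (hd k i))
    (fun k i j => hcoef (he k i j)) (fun x hx k => hsum (hd' k) x hx)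
    (fun x hx k i => (lieBracket_chartField (F.smooth _ (hB k)) (F.smooth _ (hY i)) hx.1).trans
      (hsum (he' k i) x hx)) u₀ (hψm m₀ hmN)
  have hsrc : ∀ m ∈ N, m ∈ (chartAt E m₀).source := fun m hm => by
    have : m ∈ (extChartAt 𝓘(ℝ, E) m₀).source := (hNsub hm).2.2
    rwa [extChartAt_source] at this
  have hψc : ContMDiffOn (𝓘(ℝ, E').prod 𝓘(ℝ, E)) 𝓘(ℝ, E' × E) ∞ (fun z : E' × M => (z.1, ψ z.2))
      (Prod.snd ⁻¹' N) := by
    rw [modelWithCornersSelf_prod, ← chartedSpaceSelf_prod]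
    refine contMDiffOn_fst.prodMk ?_
    refine (contMDiffOn_extChartAt (x := m₀)).comp contMDiffOn_snd fun z hz => hsrc _ hz
  have hWo : IsOpen ((Prod.snd ⁻¹' N : Set (E' × M)) ∩ (fun z => (z.1, ψ z.2)) ⁻¹' W) :=
    hψc.continuousOn.isOpen_inter_preimage (hN.preimage continuous_snd) hW
  refine ⟨ε, hε, _, hWo, ⟨hmN, hmW⟩, fun t z => ψ.symm (φ t (z.1, ψ z.2)).2, ?_, ?_⟩
  · rintro z ⟨hz, hzW⟩
    change ψ.symm (φ 0 _).2 = _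
    rw [hφ0 _ hzW]
    exact ψ.left_inv (hNsub hz).2.2
  have htgt : ∀ z : E' × M, z.2 ∈ N → (z.1, ψ z.2) ∈ W → ∀ t ∈ Ioo (-ε) ε,
      (φ t (z.1, ψ z.2)).2 ∈ T := fun z _ hz t ht => (hφ _ hz t ht).1
  rintro t ht z ⟨hz, hzW⟩
  refine ⟨⟨?_, fun v Z hZ => ?_⟩, (hNsub (htgt z hz hzW t ht).2).1, ?_⟩
  · refine SmoothNear.of_contMDiffOn ?_ hWo ⟨hz, hzW⟩
    refine (contMDiffOn_extChartAt_symm m₀).comp (t := ψ.target) ?_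
      (fun y hy => (htgt y hy.1 hy.2 t ht).1)
    exact contDiff_snd.contMDiff.comp_contMDiffOn
      ((hφs t ht).1.contMDiffOn.comp (hψc.mono inter_subset_left) fun y hy => hy.2)
  · obtain ⟨a, ha, ha'⟩ := hgen Z hZ
    have hAs : ∀ i j, SmoothNear (𝓘(ℝ, E').prod 𝓘(ℝ, E)) 𝓘(ℝ, ℝ)
        (fun z : E' × M => A t (z.1, ψ z.2) i j) z := fun i j =>
      SmoothNear.of_contMDiffOn (((hφs t ht).2 i j).contMDiffOn.comp
        (hψc.mono inter_subset_left) fun y hy => hy.2) hWo ⟨hz, hzW⟩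
    refine ⟨Fin K, inferInstance, Y, fun j z => ∑ k, b.coord k v * A t (z.1, ψ z.2) (Sum.inl k) j +
      ∑ i, a i z.2 * A t (z.1, ψ z.2) (Sum.inr i) j, hY, fun j => ?_, ?_⟩
    · refine (SmoothNear.sum fun k _ => smoothNear_const.mul (hAs _ _)).add
        (SmoothNear.sum fun i _ => SmoothNear.mul ?_ (hAs _ _))
      exact (SmoothNear.of_contMDiffOn (ha i) hV (hNsub hz).2.1).comp smoothNear_snd
    · filter_upwards [hWo.mem_nhds ⟨hz, hzW⟩] with y hy
      have hσ : HasMFDerivAt (𝓘(ℝ, E').prod 𝓘(ℝ, E)) 𝓘(ℝ, E' × E)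
          (fun z : E' × M => (z.1, ψ z.2)) y
          ((mfderiv (𝓘(ℝ, E').prod 𝓘(ℝ, E)) 𝓘(ℝ, E') Prod.fst y).prod
            ((mfderiv 𝓘(ℝ, E) 𝓘(ℝ, E) ψ y.2).comp
              (mfderiv (𝓘(ℝ, E').prod 𝓘(ℝ, E)) 𝓘(ℝ, E) Prod.snd y))) := by
        rw [modelWithCornersSelf_prod, ← chartedSpaceSelf_prod]
        refine HasMFDerivAt.prodMk mdifferentiableAt_fst.hasMFDerivAt ?_
        refine HasMFDerivAt.comp y (MDifferentiableAt.hasMFDerivAt ?_)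
          mdifferentiableAt_snd.hasMFDerivAt
        exact mdifferentiableAt_extChartAt (hsrc y.2 hy.1)
      have hφd : HasFDerivAt (fun q => (φ t q).2) ((ContinuousLinearMap.snd ℝ E' E).comp
          (fderiv ℝ (φ t) (y.1, ψ y.2))) (y.1, ψ y.2) :=
        (((hφs t ht).1.contDiffAt (hW.mem_nhds hy.2)).differentiableAt (by simp)).hasFDerivAt.snd
      have hx := htgt y hy.1 hy.2 t ht
      have hmf := (((chart_symm_contMDiffAt hx.1).mdifferentiableAt (by simp)).hasMFDerivAt).comp y
        (hφd.hasMFDerivAt.comp y hσ)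
      have hvec : (ContinuousLinearMap.snd ℝ E' E).comp (fderiv ℝ (φ t) (y.1, ψ y.2))
          (v, chartField (E := E) m₀ Z (ψ y.2)) =
          ∑ j, (∑ k, b.coord k v * A t (y.1, ψ y.2) (Sum.inl k) j +
            ∑ i, a i y.2 * A t (y.1, ψ y.2) (Sum.inr i) j) •
              chartField (E := E) m₀ (Y j) (φ t (y.1, ψ y.2)).2 := by
        have hdec : (v, chartField (E := E) m₀ Z (ψ y.2)) =
            ∑ k, b.coord k v • ((b k, 0) : E' × E) +
              ∑ i, a i y.2 • ((0, chartField (E := E) m₀ (Y i) (ψ y.2)) : E' × E) := by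
          have h1 := hsum ha' (ψ y.2) (hψm _ hy.1)
          rw [ψ.left_inv (hNsub hy.1).2.2] at h1
          ext
          · simp [Prod.fst_sum, b.sum_repr]
          · simp [Prod.snd_sum, h1]
        obtain ⟨-, -, h2, h3⟩ := hφ _ hy.2 t ht
        rw [hdec]
        simp only [map_add, map_sum, map_smul, ContinuousLinearMap.comp_apply,
          ContinuousLinearMap.coe_snd', h2, h3, Finset.smul_sum, smul_smul, add_smul,
          Finset.sum_smul, Finset.sum_add_distrib]
        congr 1 <;> exact Finset.sum_comm
      have hZψ := mfderiv_chart_eq_chartField (hNsub hy.1).2.2 Z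
      have hvσ : ((mfderiv (𝓘(ℝ, E').prod 𝓘(ℝ, E)) 𝓘(ℝ, E') Prod.fst y).prod
            ((mfderiv 𝓘(ℝ, E) 𝓘(ℝ, E) ψ y.2).comp
              (mfderiv (𝓘(ℝ, E').prod 𝓘(ℝ, E)) 𝓘(ℝ, E) Prod.snd y))) (pairVec v (Z y.2)) =
          ((v, chartField (E := E) m₀ Z (ψ y.2)) : E' × E) := by
        rw [mfderiv_fst, mfderiv_snd]
        exact congrArg (Prod.mk (α := E') (β := E) v) hZψ
      refine (DFunLike.congr_fun hmf.mfderiv _).trans ?_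
      refine Eq.trans ?_ (mfderiv_chart_symm_sum hx.1 _ Y)
      refine congrArg (mfderiv 𝓘(ℝ, E) 𝓘(ℝ, E) ψ.symm (φ t (y.1, ψ y.2)).2) ?_
      refine Eq.trans ?_ hvec
      exact congrArg ((ContinuousLinearMap.snd ℝ E' E).comp (fderiv ℝ (φ t) (y.1, ψ y.2))) hvσ
  · have hx := htgt z hz hzW t ht
    have h1 := (((chart_symm_contMDiffAt hx.1).mdifferentiableAt (by simp)).hasMFDerivAt).comp t
      (hφ _ hzW t ht).2.1.hasFDerivAt.hasMFDerivAt
    refine h1.congr_mfderiv ?_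
    refine ContinuousLinearMap.ext_ring ?_
    have h2 := (mfderiv_chart_symm_sum hx.1 (fun k => b.coord k z.1) B).trans
      (hβ _ (hNsub hx.2).1 z.1).symm
    refine Eq.trans (congrArg (mfderiv 𝓘(ℝ, E) 𝓘(ℝ, E) ψ.symm (φ t (z.1, ψ z.2)).2)
      (one_smul ℝ (∑ k, b.coord k z.1 • chartField (E := E) m₀ (B k) (φ t (z.1, ψ z.2)).2))) ?_
    exact h2.trans (one_smul ℝ (VField.vec (β z.1) _)).symm

end LocalTransport

section Propagation

variable {E : Type*} [NormedAddCommGroup E] [NormedSpace ℝ E]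
  {M : Type*} [TopologicalSpace M] [T2Space M] [ChartedSpace E M] [IsManifold 𝓘(ℝ, E) ∞ M]

/-- Uniqueness of integral curves, for a vector field which is only smooth on the set in which the
integral curves lie. -/
lemma integralCurve_eqOn_Ioo [CompleteSpace E] {X : VField 𝓘(ℝ, E) M} {γ γ' : ℝ → M} {a b t₀ : ℝ}
    (ht₀ : t₀ ∈ Ioo a b)
    (hX : ∀ t ∈ Ioo a b, ContMDiffAt 𝓘(ℝ, E) 𝓘(ℝ, E).tangent ∞
      (fun x => (⟨x, X x⟩ : TangentBundle 𝓘(ℝ, E) M)) (γ t))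
    (hγ : IsMIntegralCurveOn γ X (Ioo a b)) (hγ' : IsMIntegralCurveOn γ' X (Ioo a b))
    (h : γ t₀ = γ' t₀) : EqOn γ γ' (Ioo a b) := by
  have hI : IsManifold 𝓘(ℝ, E) 1 M := IsManifold.of_le (n := ∞) (by simp)
  intro t ht
  refine isPreconnected_Ioo.induction₂' (fun s r => γ s = γ' s → γ r = γ' r) (fun s hs => ?_)
    (fun _ _ _ _ _ _ h1 h2 h3 => h2 (h1 h3)) ht₀ ht h
  have hnh : Ioo a b ∈ 𝓝 s := Ioo_mem_nhds hs.1 hs.2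
  refine Filter.Eventually.filter_mono nhdsWithin_le_nhds ?_
  have h1 := hγ.isMIntegralCurveAt hnh
  have h2 := hγ'.isMIntegralCurveAt hnh
  by_cases heq : γ s = γ' s
  · have := isMIntegralCurveAt_eventuallyEq_of_contMDiffAt_boundaryless
      ((hX s hs).of_le (by simp)) h1 h2 heq
    filter_upwards [this] with r hr
    exact ⟨fun _ => hr, fun _ => heq⟩
  · have hne : ∀ᶠ r in 𝓝 s, γ r ≠ γ' r := by
      have hc := h1.continuousAt.prodMk h2.continuousAt
      exact hc.eventually (isOpen_ne_fun continuous_fst continuous_snd |>.mem_nhds heq)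
    filter_upwards [hne] with r hr
    exact ⟨fun h => absurd h heq, fun h => absurd h hr⟩

variable [FiniteDimensional ℝ E]
  {E' : Type*} [NormedAddCommGroup E'] [NormedSpace ℝ E'] [FiniteDimensional ℝ E']
  {F : SingularFoliation 𝓘(ℝ, E) M} {β : E' → VField 𝓘(ℝ, E) M}
  {n : ℕ} {b : Module.Basis (Fin n) ℝ E'} {O : Set M}

/-- The family of vector fields `β u`, with `u ∈ E'`, depends linearly on `u` and consists near each
point of `O` of vector fields of the foliation. -/
def IsLinearFamilyOn (F : SingularFoliation 𝓘(ℝ, E) M) (b : Module.Basis (Fin n) ℝ E')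
    (β : E' → VField 𝓘(ℝ, E) M) (O : Set M) : Prop :=
  ∀ m₀ ∈ O, ∃ B : Fin n → VField 𝓘(ℝ, E) M, (∀ k, B k ∈ F.carrier) ∧
    ∀ᶠ m in 𝓝 m₀, ∀ u, VField.vec (β u) m = ∑ k, b.coord k u • VField.vec (B k) m

omit [FiniteDimensional ℝ E'] in
lemma IsLinearFamilyOn.contMDiffAt (hβ : IsLinearFamilyOn F b β O) (u : E') {m₀ : M}
    (hm : m₀ ∈ O) : ContMDiffAt 𝓘(ℝ, E) 𝓘(ℝ, E).tangent ∞
      (fun x => (⟨x, β u x⟩ : TangentBundle 𝓘(ℝ, E) M)) m₀ := by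
  obtain ⟨B, hB, hev⟩ := hβ m₀ hm
  have hspan : SpanAlong F 𝓘(ℝ, E) (fun m => m) (VField.vec (β u)) m₀ :=
    ⟨Fin n, inferInstance, B, fun k _ => b.coord k u, hB, fun _ => smoothNear_const,
      hev.mono fun m hm => hm u⟩
  obtain ⟨Y, hY, hev'⟩ := hspan.exists_mem
  refine ((F.smooth Y hY).contMDiffAt univ_mem).congr_of_eventuallyEq ?_
  filter_upwards [hev'] with m hm
  exact congrArg (Bundle.TotalSpace.mk (F := E) (E := (TangentSpace 𝓘(ℝ, E) : M → Type _)) m) hm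

/-- The flows of a linear family of vector fields of a foliation transport the foliation as long as
they exist. -/
theorem transports_flow (hO : IsOpen O) (hβ : IsLinearFamilyOn F b β O) {D : Set (E' × M)}
    (hD : IsOpen D) {s₀ s₁ : ℝ} (h0 : (0 : ℝ) ∈ Ioo s₀ s₁) {γ : E' × M → ℝ → M}
    (hγ0 : ∀ z ∈ D, γ z 0 = z.2) (hγO : ∀ z ∈ D, ∀ r ∈ Ioo s₀ s₁, γ z r ∈ O)
    (hγ : ∀ z ∈ D, IsMIntegralCurveOn (γ z) (β z.1) (Ioo s₀ s₁)) {z₀ : E' × M} (hz₀ : z₀ ∈ D)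
    {t : ℝ} (ht : t ∈ Ioo s₀ s₁) : Transports F (fun z => γ z t) z₀ := by
  refine isPreconnected_Ioo.induction₂' (fun s r => Transports F (fun z => γ z s) z₀ →
    Transports F (fun z => γ z r) z₀) (fun τ hτ => ?_)
    (fun _ _ _ _ _ _ h1 h2 h3 => h2 (h1 h3)) h0 ht
    (transports_snd.congr (by filter_upwards [hD.mem_nhds hz₀] with z hz using hγ0 z hz))
  obtain ⟨B, hB, hev⟩ := hβ _ (hγO z₀ hz₀ τ hτ)
  obtain ⟨ε, hε, W, hW, hmW, f, hf0, hf⟩ := exists_local_transport b hB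
    (inter_mem (hO.mem_nhds (hγO z₀ hz₀ τ hτ)) hev) (fun m hm u => hm.2 u) z₀.1
  have key : ∀ s ∈ Ioo s₀ s₁, ∀ r ∈ Ioo s₀ s₁, (z₀.1, γ z₀ s) ∈ W → r - s ∈ Ioo (-ε) ε →
      Transports F (fun z => γ z s) z₀ → Transports F (fun z => γ z r) z₀ := by
    intro s hs r hr hsW hrs hT
    have hT' := Transports.comp (f := f (r - s)) (g := fun z => γ z s) (hf (r - s) hrs _ hsW).1 hT
    refine hT'.congr ?_
    have hc : ContinuousAt (fun z : E' × M => (z.1, γ z s)) z₀ :=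
      continuousAt_fst.prodMk hT.1.continuousAt
    filter_upwards [hD.mem_nhds hz₀, hc.eventually (hW.mem_nhds hsW)] with z hz hzW
    have h0' : (0 : ℝ) ∈ Ioo (max (-ε) (s₀ - s)) (min ε (s₁ - s)) := by
      simp only [mem_Ioo, max_lt_iff, lt_min_iff]
      exact ⟨⟨by linarith, by linarith [hs.1]⟩, hε, by linarith [hs.2]⟩
    have hr' : r - s ∈ Ioo (max (-ε) (s₀ - s)) (min ε (s₁ - s)) := by
      simp only [mem_Ioo, max_lt_iff, lt_min_iff]
      exact ⟨⟨hrs.1, by linarith [hr.1]⟩, hrs.2, by linarith [hr.2]⟩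
    have hsub : ∀ q ∈ Ioo (max (-ε) (s₀ - s)) (min ε (s₁ - s)),
        q ∈ Ioo (-ε) ε ∧ q + s ∈ Ioo s₀ s₁ := by
      intro q hq
      simp only [mem_Ioo, max_lt_iff, lt_min_iff] at hq
      exact ⟨⟨hq.1.1, hq.2.1⟩, by linarith [hq.1.2], by linarith [hq.2.2]⟩
    have := integralCurve_eqOn_Ioo (X := β z.1) (γ := fun q => γ z (q + s))
      (γ' := fun q => f q (z.1, γ z s)) h0' (fun q hq => hβ.contMDiffAt _ (hγO z hz _ (hsub q hq).2))
      (((hγ z hz).comp_add s).mono fun q hq => (hsub q hq).2)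
      (fun q hq => (hf q (hsub q hq).1 _ hzW).2.2.hasMFDerivWithinAt)
      (by simp [hf0 _ hzW]) hr'
    simpa using this
  have hcτ : ContinuousAt (γ z₀) τ :=
    ((hγ z₀ hz₀).isMIntegralCurveAt (Ioo_mem_nhds hτ.1 hτ.2)).continuousAt
  have hcτ' : ∀ᶠ r in 𝓝 τ, (z₀.1, γ z₀ r) ∈ W :=
    (continuousAt_const.prodMk hcτ).eventually (hW.mem_nhds hmW)
  filter_upwards [nhdsWithin_le_nhds hcτ', self_mem_nhdsWithin,
    nhdsWithin_le_nhds (Ioo_mem_nhds (sub_lt_self τ hε) (lt_add_of_pos_right τ hε))]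
    with r hrW hr hrε
  exact ⟨key τ hτ r hr hmW ⟨by linarith [hrε.1], by linarith [hrε.2]⟩,
    key r hr τ hτ hrW ⟨by linarith [hrε.2], by linarith [hrε.1]⟩⟩

end Propagation

section HorizontalLift

variable {E : Type*} [NormedAddCommGroup E] [NormedSpace ℝ E]
  {M : Type*} [TopologicalSpace M] [ChartedSpace E M] [IsManifold 𝓘(ℝ, E) ∞ M]
  {E' : Type*} [NormedAddCommGroup E'] [NormedSpace ℝ E']
  {L : Type*} [TopologicalSpace L] [ChartedSpace E' L]
  {F : SingularFoliation 𝓘(ℝ, E) M} {j : L → M} {M_L : Set M} {p : M → L}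
  {hor : (x : M) → Submodule ℝ (TangentSpace 𝓘(ℝ, E) x)}

/-- The horizontal lift of a tangent vector of the base. -/
noncomputable def hlift (p : M → L) (hor : (x : M) → Submodule ℝ (TangentSpace 𝓘(ℝ, E) x)) (m : M)
    (w : TangentSpace 𝓘(ℝ, E') (p m)) : TangentSpace 𝓘(ℝ, E) m :=
  haveI : Nonempty (TangentSpace 𝓘(ℝ, E) m) := ⟨0⟩
  Classical.epsilon fun h => h ∈ hor m ∧ mfderiv 𝓘(ℝ, E) 𝓘(ℝ, E') p m h = w

lemma hlift_spec (hconn : IsEhresmannFConnection F j 𝓘(ℝ, E') M_L p hor) {m : M} (hm : m ∈ M_L)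
    (w : TangentSpace 𝓘(ℝ, E') (p m)) :
    hlift p hor m w ∈ hor m ∧ mfderiv 𝓘(ℝ, E) 𝓘(ℝ, E') p m (hlift p hor m w) = w := by
  refine Classical.epsilon_spec (p := fun h => h ∈ hor m ∧ mfderiv 𝓘(ℝ, E) 𝓘(ℝ, E') p m h = w) ?_
  obtain ⟨x, hx⟩ := hconn.submersion m hm w
  obtain ⟨h, hh, k, hk, hhk⟩ := Submodule.mem_sup.1
    ((hconn.isCompl m hm).sup_eq_top ▸ Submodule.mem_top (x := x))
  refine ⟨h, hh, ?_⟩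
  have hk' : mfderiv 𝓘(ℝ, E) 𝓘(ℝ, E') p m k = 0 := hk
  rw [← hx, ← hhk, map_add, hk', add_zero]

lemma eq_of_mem_hor (hconn : IsEhresmannFConnection F j 𝓘(ℝ, E') M_L p hor) {m : M} (hm : m ∈ M_L)
    {v w : TangentSpace 𝓘(ℝ, E) m} (hv : v ∈ hor m) (hw : w ∈ hor m)
    (h : mfderiv 𝓘(ℝ, E) 𝓘(ℝ, E') p m v = mfderiv 𝓘(ℝ, E) 𝓘(ℝ, E') p m w) : v = w := by
  refine sub_eq_zero.1 (Submodule.disjoint_def.1 (hconn.isCompl m hm).disjoint _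
    ((hor m).sub_mem hv hw) ?_)
  change mfderiv 𝓘(ℝ, E) 𝓘(ℝ, E') p m (v - w) = 0
  rw [map_sub, h, sub_self]

lemma smoothNear_proj (hconn : IsEhresmannFConnection F j 𝓘(ℝ, E') M_L p hor) {m : M}
    (hm : m ∈ M_L) : SmoothNear 𝓘(ℝ, E) 𝓘(ℝ, E') p m :=
  SmoothNear.of_contMDiffOn hconn.smooth_proj hconn.isOpen hm

variable [IsManifold 𝓘(ℝ, E') ∞ L]

lemma mfderiv_chart_comp_proj (hconn : IsEhresmannFConnection F j 𝓘(ℝ, E') M_L p hor) {ℓ : L}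
    {m : M} (hm : m ∈ M_L) (hp : p m ∈ (extChartAt 𝓘(ℝ, E') ℓ).source)
    (w : TangentSpace 𝓘(ℝ, E) m) :
    mfderiv 𝓘(ℝ, E) 𝓘(ℝ, E') (fun y => extChartAt 𝓘(ℝ, E') ℓ (p y)) m w =
      mfderiv 𝓘(ℝ, E') 𝓘(ℝ, E') (extChartAt 𝓘(ℝ, E') ℓ) (p m)
        (mfderiv 𝓘(ℝ, E) 𝓘(ℝ, E') p m w) := by
  have h1 : MDifferentiableAt 𝓘(ℝ, E') 𝓘(ℝ, E') (extChartAt 𝓘(ℝ, E') ℓ) (p m) :=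
    mdifferentiableAt_extChartAt (by rwa [← extChartAt_source 𝓘(ℝ, E')])
  have h2 : MDifferentiableAt 𝓘(ℝ, E) 𝓘(ℝ, E') p m :=
    (hconn.smooth_proj.contMDiffAt (hconn.isOpen.mem_nhds hm)).mdifferentiableAt (by simp)
  exact DFunLike.congr_fun (mfderiv_comp m h1 h2) w

lemma mfderiv_chart_injective {ℓ q : L} (hq : q ∈ (extChartAt 𝓘(ℝ, E') ℓ).source) :
    Function.Injective (mfderiv 𝓘(ℝ, E') 𝓘(ℝ, E') (extChartAt 𝓘(ℝ, E') ℓ) q) :=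
  (isInvertible_mfderiv_extChartAt hq).injective

lemma smoothNear_chart {ℓ q : L} (hq : q ∈ (extChartAt 𝓘(ℝ, E') ℓ).source) :
    SmoothNear 𝓘(ℝ, E') 𝓘(ℝ, E') (extChartAt 𝓘(ℝ, E') ℓ) q :=
  SmoothNear.of_contMDiffOn contMDiffOn_extChartAt (chartAt E' ℓ).open_source
    (by rwa [← extChartAt_source 𝓘(ℝ, E')])

lemma smoothNear_clm_inverse [CompleteSpace E'] :
    SmoothNear 𝓘(ℝ, E' →L[ℝ] E') 𝓘(ℝ, E' →L[ℝ] E')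
      (ContinuousLinearMap.inverse : (E' →L[ℝ] E') → (E' →L[ℝ] E')) (ContinuousLinearMap.id ℝ E') := by
  filter_upwards [ContinuousLinearEquiv.nhds (ContinuousLinearEquiv.refl ℝ E')] with A hA
  obtain ⟨e, rfl⟩ := hA
  exact (contDiffAt_map_inverse e).contMDiffAt

/-- A section of the horizontal subbundle is smooth if its projection to the base is. -/
lemma smoothNear_hor_section [FiniteDimensional ℝ E']
    (hconn : IsEhresmannFConnection F j 𝓘(ℝ, E') M_L p hor) {m₀ : M} (hm₀ : m₀ ∈ M_L) {ℓ : L}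
    (hp : p m₀ ∈ (extChartAt 𝓘(ℝ, E') ℓ).source) {ξ : VField 𝓘(ℝ, E) M}
    (hξ : ∀ᶠ m in 𝓝 m₀, ξ m ∈ hor m)
    (hs : SmoothNear 𝓘(ℝ, E) 𝓘(ℝ, E') (fun m =>
      (mfderiv 𝓘(ℝ, E) 𝓘(ℝ, E') (fun y => extChartAt 𝓘(ℝ, E') ℓ (p y)) m (ξ m) : E')) m₀) :
    SmoothNear 𝓘(ℝ, E) 𝓘(ℝ, E).tangent (fun m => (⟨m, ξ m⟩ : TangentBundle 𝓘(ℝ, E) M)) m₀ := by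
  set b := Module.finBasis ℝ E' with hb
  have hI : IsManifold 𝓘(ℝ, E) 1 M := IsManifold.of_le (n := ∞) (by simp)
  set P : M → E' := fun y => extChartAt 𝓘(ℝ, E') ℓ (p y) with hP
  have hPs : SmoothNear 𝓘(ℝ, E) 𝓘(ℝ, E') P m₀ := (smoothNear_chart hp).comp (smoothNear_proj hconn hm₀)
  have hsurj : ∀ k, ∃ v ∈ hor m₀, (mfderiv 𝓘(ℝ, E) 𝓘(ℝ, E') P m₀ v : E') = b k := by
    intro k
    obtain ⟨w, hw⟩ := (isInvertible_mfderiv_extChartAt hp).surjective (b k)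
    refine ⟨hlift p hor m₀ w, (hlift_spec hconn hm₀ w).1, ?_⟩
    refine (mfderiv_chart_comp_proj hconn hm₀ hp _).trans ?_
    rw [(hlift_spec hconn hm₀ w).2]
    exact hw
  choose v hv hPv using hsurj
  choose V hV hmV hVM X hX hXv hXhor using fun k => hconn.smooth_hor m₀ hm₀ (v k) (hv k)
  have hXs : ∀ k, SmoothNear 𝓘(ℝ, E) 𝓘(ℝ, E).tangent
      (fun m => (⟨m, X k m⟩ : TangentBundle 𝓘(ℝ, E) M)) m₀ := fun k =>
    SmoothNear.of_contMDiffOn (hX k) (hV k) (hmV k)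
  let cf : Fin _ → E' →L[ℝ] ℝ := fun k => LinearMap.toContinuousLinearMap (b.coord k)
  let T : M → E' →L[ℝ] E' := fun m =>
    ∑ k, ContinuousLinearMap.smulRightL ℝ E' E' (cf k) (mfderiv 𝓘(ℝ, E) 𝓘(ℝ, E') P m (X k m))
  have hTs : SmoothNear 𝓘(ℝ, E) 𝓘(ℝ, E' →L[ℝ] E') T m₀ :=
    SmoothNear.sum fun k _ => (hPs.mfderiv_vfield (hXs k)).clm_comp _
  have hT0 : T m₀ = ContinuousLinearMap.id ℝ E' := by
    ext u
    have : T m₀ u = ∑ k, b.coord k u • b k := by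
      simp only [T, _root_.sum_apply]
      refine Finset.sum_congr rfl fun k _ => ?_
      rw [hXv, hPv]
      rfl
    rw [this]
    exact b.sum_repr u
  have hTinv : SmoothNear 𝓘(ℝ, E) 𝓘(ℝ, E' →L[ℝ] E') (fun m => (T m).inverse) m₀ :=
    SmoothNear.comp (hT0 ▸ smoothNear_clm_inverse) hTs
  have hTev : ∀ᶠ m in 𝓝 m₀, (T m).IsInvertible := by
    have := hTs.continuousAt
    rw [ContinuousAt, hT0] at this
    exact this (ContinuousLinearEquiv.nhds (ContinuousLinearEquiv.refl ℝ E'))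
  let a : Fin _ → M → ℝ := fun k m =>
    cf k ((T m).inverse (mfderiv 𝓘(ℝ, E) 𝓘(ℝ, E') P m (ξ m)))
  have ha : ∀ k, SmoothNear 𝓘(ℝ, E) 𝓘(ℝ, ℝ) (a k) m₀ := fun k => by
    refine SmoothNear.clm_comp (cf k) ?_
    filter_upwards [hTinv, hs] with m h1 h2
    exact h1.clm_apply h2
  have hsum : SmoothNear 𝓘(ℝ, E) 𝓘(ℝ, E).tangent
      (fun m => (⟨m, ∑ k, a k m • X k m⟩ : TangentBundle 𝓘(ℝ, E) M)) m₀ := by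
    have hall : ∀ᶠ m in 𝓝 m₀, ∀ k, ContMDiffAt 𝓘(ℝ, E) 𝓘(ℝ, E).tangent ∞
        (fun m => (⟨m, a k m • X k m⟩ : TangentBundle 𝓘(ℝ, E) M)) m := by
      refine eventually_all.2 fun k => ?_
      filter_upwards [ha k, hXs k] with m h1 h2
      exact h1.smul_section h2
    filter_upwards [hall] with m hm
    exact ContMDiffAt.sum_section fun k _ => hm k
  refine hsum.congr ?_
  have hpm : ∀ᶠ m in 𝓝 m₀, p m ∈ (extChartAt 𝓘(ℝ, E') ℓ).source :=
    (smoothNear_proj hconn hm₀).continuousAt.eventually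
      ((isOpen_extChartAt_source ℓ).mem_nhds hp)
  filter_upwards [hTev, hξ, hpm, hconn.isOpen.mem_nhds hm₀,
    eventually_all.2 fun k => (hV k).mem_nhds (hmV k)] with m h1 h2 h3 h4 h5
  refine congrArg (Bundle.TotalSpace.mk m) ?_
  refine eq_of_mem_hor hconn h4 h2 ((hor m).sum_mem fun k _ => (hor m).smul_mem _ (hXhor k m (h5 k))) ?_
  refine mfderiv_chart_injective h3 ?_
  rw [← mfderiv_chart_comp_proj hconn h4 h3, ← mfderiv_chart_comp_proj hconn h4 h3, map_sum]
  simp only [map_smul]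
  have h6 : T m ((T m).inverse (mfderiv 𝓘(ℝ, E) 𝓘(ℝ, E') P m (ξ m))) =
      (mfderiv 𝓘(ℝ, E) 𝓘(ℝ, E') P m (ξ m) : E') := h1.self_apply_inverse _
  have h7 : T m ((T m).inverse (mfderiv 𝓘(ℝ, E) 𝓘(ℝ, E') P m (ξ m))) =
      (∑ k, a k m • (mfderiv 𝓘(ℝ, E) 𝓘(ℝ, E') P m (X k m) : E') : E') := by
    simp only [T, _root_.sum_apply]
    rfl
  exact h6.symm.trans h7

end HorizontalLift

section HorizontalFields

variable {E : Type*} [NormedAddCommGroup E] [NormedSpace ℝ E]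
  {M : Type*} [TopologicalSpace M] [ChartedSpace E M] [IsManifold 𝓘(ℝ, E) ∞ M]
  {E' : Type*} [NormedAddCommGroup E'] [NormedSpace ℝ E'] [FiniteDimensional ℝ E']
  {L : Type*} [TopologicalSpace L] [ChartedSpace E' L] [IsManifold 𝓘(ℝ, E') ∞ L]
  {F : SingularFoliation 𝓘(ℝ, E) M} {j : L → M} {M_L : Set M} {p : M → L}
  {hor : (x : M) → Submodule ℝ (TangentSpace 𝓘(ℝ, E) x)}

lemma mem_onOpen_of_hor (hconn : IsEhresmannFConnection F j 𝓘(ℝ, E') M_L p hor)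
    {ξ : VField 𝓘(ℝ, E) M} (hξ : ∀ m ∈ M_L, ξ m ∈ hor m)
    (hs : ∀ m₀ ∈ M_L, SmoothNear 𝓘(ℝ, E) 𝓘(ℝ, E') (fun m => (mfderiv 𝓘(ℝ, E) 𝓘(ℝ, E')
      (fun y => extChartAt 𝓘(ℝ, E') (p m₀) (p y)) m (ξ m) : E')) m₀) :
    ξ ∈ F.onOpen M_L := by
  refine hconn.sections_mem M_L hconn.isOpen subset_rfl ξ (fun m hm => ?_) hξ
  exact (smoothNear_hor_section hconn hm (mem_extChartAt_source (p m))
    (by filter_upwards [hconn.isOpen.mem_nhds hm] with y hy using hξ y hy)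
    (hs m hm)).contMDiffAt.contMDiffWithinAt

variable (E') in
/-- The vertical component of a vector field. -/
noncomputable def vertPart (p : M → L) (hor : (x : M) → Submodule ℝ (TangentSpace 𝓘(ℝ, E) x))
    (Y : VField 𝓘(ℝ, E) M) : VField 𝓘(ℝ, E) M :=
  fun m => Y m - hlift (E' := E') p hor m (mfderiv 𝓘(ℝ, E) 𝓘(ℝ, E') p m (Y m))

omit [FiniteDimensional ℝ E'] [IsManifold 𝓘(ℝ, E') ∞ L] in
lemma mfderiv_vertPart (hconn : IsEhresmannFConnection F j 𝓘(ℝ, E') M_L p hor) {m : M}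
    (hm : m ∈ M_L) (Y : VField 𝓘(ℝ, E) M) :
    mfderiv 𝓘(ℝ, E) 𝓘(ℝ, E') p m (vertPart E' p hor Y m) = 0 := by
  rw [vertPart, map_sub, (hlift_spec hconn hm _).2, sub_self]

lemma horPart_mem_onOpen (hconn : IsEhresmannFConnection F j 𝓘(ℝ, E') M_L p hor)
    {Y : VField 𝓘(ℝ, E) M} (hY : Y ∈ F.carrier) :
    (fun m => hlift (E' := E') p hor m (mfderiv 𝓘(ℝ, E) 𝓘(ℝ, E') p m (Y m))) ∈ F.onOpen M_L := by
  refine mem_onOpen_of_hor hconn (fun m hm => (hlift_spec hconn hm _).1) fun m₀ hm₀ => ?_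
  have hpm : ∀ᶠ m in 𝓝 m₀, p m ∈ (extChartAt 𝓘(ℝ, E') (p m₀)).source :=
    (smoothNear_proj hconn hm₀).continuousAt.eventually (extChartAt_source_mem_nhds _)
  have h1 : SmoothNear 𝓘(ℝ, E) 𝓘(ℝ, E') (fun y => extChartAt 𝓘(ℝ, E') (p m₀) (p y)) m₀ :=
    (smoothNear_chart (mem_extChartAt_source _)).comp (smoothNear_proj hconn hm₀)
  refine (h1.mfderiv_vfield (SmoothNear.of_contMDiffOn (F.smooth Y hY) isOpen_univ
    (mem_univ _))).congr ?_
  filter_upwards [hpm, hconn.isOpen.mem_nhds hm₀] with m h2 h3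
  rw [mfderiv_chart_comp_proj hconn h3 h2, mfderiv_chart_comp_proj hconn h3 h2,
    (hlift_spec hconn h3 _).2]

lemma vertPart_mem_onOpen [FiniteDimensional ℝ E] [T2Space M]
    (hconn : IsEhresmannFConnection F j 𝓘(ℝ, E') M_L p hor)
    {Y : VField 𝓘(ℝ, E) M} (hY : Y ∈ F.carrier) : vertPart E' p hor Y ∈ F.onOpen M_L := by
  intro m hm
  have h1 : SpanAlong F 𝓘(ℝ, E) (fun m => m) (fun m => VField.vec Y m) m := SpanAlong.of_mem hY
  have h2 := (SpanAlong.of_mem_onOpen (f := fun m : M => m) (I₁ := 𝓘(ℝ, E))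
    (horPart_mem_onOpen hconn hY) continuousAt_id hm).smul (smoothNear_const (c := (-1 : ℝ)))
  refine SpanAlong.exists_mem ((h1.add h2).congr (Eventually.of_forall fun m => ?_))
  have h3 : ∀ a c : E, a - c = a + (-1 : ℝ) • c := fun a c => by
    rw [neg_one_smul, sub_eq_add_neg]
  exact h3 _ _

/-- The vector field which is constant, equal to `u`, in the chart at `ℓ`. -/
noncomputable def constField (ℓ : L) (u : E') : VField 𝓘(ℝ, E') L :=
  VectorField.mpullback 𝓘(ℝ, E') 𝓘(ℝ, E') (extChartAt 𝓘(ℝ, E') ℓ) (fun _ => u)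

omit [FiniteDimensional ℝ E'] in
lemma mfderiv_constField {ℓ q : L} (hq : q ∈ (extChartAt 𝓘(ℝ, E') ℓ).source) (u : E') :
    mfderiv 𝓘(ℝ, E') 𝓘(ℝ, E') (extChartAt 𝓘(ℝ, E') ℓ) q (constField ℓ u q) = u :=
  (isInvertible_mfderiv_extChartAt hq).self_apply_inverse _

lemma constField_smooth (ℓ : L) (u : E') :
    SmoothVFieldOn 𝓘(ℝ, E') (constField ℓ u) (extChartAt 𝓘(ℝ, E') ℓ).source := by
  have hI : IsManifold 𝓘(ℝ, E') 1 L := IsManifold.of_le (n := ∞) (by simp)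
  intro q hq
  refine ContMDiffAt.contMDiffWithinAt ?_
  refine ContMDiffAt.mpullback_vectorField_preimage (n := ∞) ?_ (smoothNear_chart hq).contMDiffAt
    (isInvertible_mfderiv_extChartAt hq) (by simp)
  exact contMDiffAt_vectorSpace_iff_contDiffAt.2 contDiffAt_const

omit [FiniteDimensional ℝ E'] [IsManifold 𝓘(ℝ, E') ∞ L] in
lemma constField_sum {n : ℕ} (b : Module.Basis (Fin n) ℝ E') (ℓ q : L) (u : E') :
    constField ℓ u q = ∑ k, b.coord k u • constField ℓ (b k) q := by
  have h : ∀ A : E' →L[ℝ] E', A u = ∑ k, b.coord k u • A (b k) := fun A => by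
    conv_lhs => rw [← b.sum_repr u, map_sum]
    simp only [map_smul, b.coord_apply]
  exact h _

variable [T2Space L]

/-- The constant field of the chart at `ℓ`, cut off to a globally defined vector field. -/
noncomputable def cutoffField {ℓ : L} (χ : SmoothBumpFunction 𝓘(ℝ, E') ℓ) (u : E') :
    VField 𝓘(ℝ, E') L := fun q => χ q • constField ℓ u q

lemma cutoffField_smooth {ℓ : L} (χ : SmoothBumpFunction 𝓘(ℝ, E') ℓ) (u : E') :
    SmoothVFieldOn 𝓘(ℝ, E') (cutoffField χ u) univ := by
  have hI : IsManifold 𝓘(ℝ, E') 1 L := IsManifold.of_le (n := ∞) (by simp)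
  have h := ContMDiffOn.smul_section_of_tsupport (n := ∞) (ψ := χ) χ.contMDiff.contMDiffOn
    (isOpen_extChartAt_source ℓ)
    (by rw [extChartAt_source]; exact χ.tsupport_subset_chartAt_source) (constField_smooth ℓ u)
  exact h.contMDiffOn

/-- The horizontal lift of the cut off constant field. -/
noncomputable def liftField (p : M → L) (hor : (x : M) → Submodule ℝ (TangentSpace 𝓘(ℝ, E) x))
    {ℓ : L} (χ : SmoothBumpFunction 𝓘(ℝ, E') ℓ) (u : E') : VField 𝓘(ℝ, E) M :=
  fun m => hlift p hor m (cutoffField χ u (p m))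

omit [IsManifold 𝓘(ℝ, E') ∞ L] [T2Space L] in
lemma isHorizontalLift_liftField (hconn : IsEhresmannFConnection F j 𝓘(ℝ, E') M_L p hor) {ℓ : L}
    (χ : SmoothBumpFunction 𝓘(ℝ, E') ℓ) (u : E') :
    IsHorizontalLift 𝓘(ℝ, E') M_L p hor (cutoffField χ u) (liftField p hor χ u) :=
  fun _ hm => hlift_spec hconn hm _

lemma liftField_mem_onOpen (hconn : IsEhresmannFConnection F j 𝓘(ℝ, E') M_L p hor) {ℓ : L}
    (χ : SmoothBumpFunction 𝓘(ℝ, E') ℓ) (u : E') : liftField p hor χ u ∈ F.onOpen M_L := by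
  refine mem_onOpen_of_hor hconn (fun m hm => (hlift_spec hconn hm _).1) fun m₀ hm₀ => ?_
  have hpm : ∀ᶠ m in 𝓝 m₀, p m ∈ (extChartAt 𝓘(ℝ, E') (p m₀)).source :=
    (smoothNear_proj hconn hm₀).continuousAt.eventually (extChartAt_source_mem_nhds _)
  have h1 := ((smoothNear_chart (mem_extChartAt_source (I := 𝓘(ℝ, E')) (p m₀))).mfderiv_vfield
    (SmoothNear.of_contMDiffOn (cutoffField_smooth χ u) isOpen_univ (mem_univ _))).comp
    (smoothNear_proj hconn hm₀)
  refine h1.congr ?_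
  filter_upwards [hpm, hconn.isOpen.mem_nhds hm₀] with m h2 h3
  rw [mfderiv_chart_comp_proj hconn h3 h2, liftField, (hlift_spec hconn h3 _).2]

omit [IsManifold 𝓘(ℝ, E') ∞ L] [T2Space L] in
lemma liftField_sum (hconn : IsEhresmannFConnection F j 𝓘(ℝ, E') M_L p hor) {ℓ : L}
    (χ : SmoothBumpFunction 𝓘(ℝ, E') ℓ) {n : ℕ} (b : Module.Basis (Fin n) ℝ E') {m : M}
    (hm : m ∈ M_L) (u : E') :
    liftField p hor χ u m = ∑ k, b.coord k u • liftField p hor χ (b k) m := by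
  refine eq_of_mem_hor hconn hm (hlift_spec hconn hm _).1
    ((hor m).sum_mem fun k _ => (hor m).smul_mem _ (hlift_spec hconn hm _).1) ?_
  rw [map_sum, liftField, (hlift_spec hconn hm _).2]
  simp only [map_smul, liftField, (hlift_spec hconn hm _).2, cutoffField]
  rw [constField_sum b, Finset.smul_sum]
  exact Finset.sum_congr rfl fun k _ => smul_comm _ _ _

lemma isLinearFamilyOn_liftField (hconn : IsEhresmannFConnection F j 𝓘(ℝ, E') M_L p hor) {ℓ : L}
    (χ : SmoothBumpFunction 𝓘(ℝ, E') ℓ) {n : ℕ} (b : Module.Basis (Fin n) ℝ E') :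
    IsLinearFamilyOn F b (liftField p hor χ) M_L := by
  intro m₀ hm₀
  choose B hB hB' using fun k => liftField_mem_onOpen hconn χ (b k) m₀ hm₀
  refine ⟨B, hB, ?_⟩
  filter_upwards [eventually_all.2 hB', hconn.isOpen.mem_nhds hm₀] with m h1 h2 u
  refine (liftField_sum hconn χ b h2 u).trans ?_
  refine Finset.sum_congr rfl fun k _ => ?_
  rw [h1 k]
  rfl

end HorizontalFields

section RadialTransport

variable {E : Type*} [NormedAddCommGroup E] [NormedSpace ℝ E] [FiniteDimensional ℝ E]
  {M : Type*} [TopologicalSpace M] [T2Space M] [ChartedSpace E M] [IsManifold 𝓘(ℝ, E) ∞ M]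
  {E' : Type*} [NormedAddCommGroup E'] [NormedSpace ℝ E'] [FiniteDimensional ℝ E']
  {L : Type*} [TopologicalSpace L] [T2Space L] [ChartedSpace E' L] [IsManifold 𝓘(ℝ, E') ∞ L]
  {F : SingularFoliation 𝓘(ℝ, E) M} {j : L → M} {M_L : Set M} {p : M → L}
  {hor : (x : M) → Submodule ℝ (TangentSpace 𝓘(ℝ, E) x)}

omit [T2Space L] [FiniteDimensional ℝ E'] in
lemma mfderiv_chart_symm_const {ℓ : L} {x : E'} (hx : x ∈ (extChartAt 𝓘(ℝ, E') ℓ).target) (u : E') :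
    (mfderiv 𝓘(ℝ, E') 𝓘(ℝ, E') (extChartAt 𝓘(ℝ, E') ℓ).symm x u : E') =
      VField.vec (constField ℓ u) ((extChartAt 𝓘(ℝ, E') ℓ).symm x) := by
  have hq := (extChartAt 𝓘(ℝ, E') ℓ).map_target hx
  have h1 := mfderiv_chart_eq_chartField hq (constField ℓ u)
  rw [mfderiv_constField hq, (extChartAt 𝓘(ℝ, E') ℓ).right_inv hx] at h1
  have h2 := mfderiv_chart_symm_chartField hx (constField ℓ u)
  rw [← h1] at h2
  exact h2

omit [T2Space L] in
lemma isMIntegralCurveOn_line {ℓ : L} (χ : SmoothBumpFunction 𝓘(ℝ, E') ℓ) {x u : E'} {s t : ℝ}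
    (h : ∀ r ∈ Ioo s t, x + r • u ∈ (extChartAt 𝓘(ℝ, E') ℓ).target ∧
      χ ((extChartAt 𝓘(ℝ, E') ℓ).symm (x + r • u)) = 1) :
    IsMIntegralCurveOn (fun r => (extChartAt 𝓘(ℝ, E') ℓ).symm (x + r • u)) (cutoffField χ u)
      (Ioo s t) := by
  intro r hr
  obtain ⟨h1, h2⟩ := h r hr
  have hd : HasDerivAt (fun r : ℝ => x + r • u) u r := by
    simpa using ((hasDerivAt_id r).smul_const u).const_add x
  have h3 := (((chart_symm_contMDiffAt h1).mdifferentiableAt (by simp)).hasMFDerivAt).comp r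
    hd.hasFDerivAt.hasMFDerivAt
  refine (h3.congr_mfderiv ?_).hasMFDerivWithinAt
  refine ContinuousLinearMap.ext_ring ?_
  have h4 : VField.vec (cutoffField χ u) ((extChartAt 𝓘(ℝ, E') ℓ).symm (x + r • u)) =
      VField.vec (constField ℓ u) ((extChartAt 𝓘(ℝ, E') ℓ).symm (x + r • u)) := by
    change (χ _ • VField.vec (constField ℓ u) _ : E') = _
    rw [h2, one_smul]
  refine Eq.trans (congrArg (mfderiv 𝓘(ℝ, E') 𝓘(ℝ, E') (extChartAt 𝓘(ℝ, E') ℓ).symm (x + r • u))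
    (one_smul ℝ u)) ?_
  exact ((mfderiv_chart_symm_const h1 u).trans h4.symm).trans (one_smul ℝ _).symm

/-- The pairs `(u, m)` for which the parallel transport of `m` over the segment from `p m` to
`p m + u` in the chart at `ℓ` is considered. -/
def transportDomain (M_L : Set M) (p : M → L) (ℓ : L) (R : ℝ) : Set (E' × M) :=
  {z | z.1 ∈ Metric.ball (0 : E') R ∧ z.2 ∈ M_L ∧ p z.2 ∈ (extChartAt 𝓘(ℝ, E') ℓ).source ∧
    extChartAt 𝓘(ℝ, E') ℓ (p z.2) ∈ Metric.ball (extChartAt 𝓘(ℝ, E') ℓ ℓ) R}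

omit [FiniteDimensional ℝ E] [T2Space M] [FiniteDimensional ℝ E'] [T2Space L]
  [IsManifold 𝓘(ℝ, E') ∞ L] in
lemma isOpen_transportDomain (hconn : IsEhresmannFConnection F j 𝓘(ℝ, E') M_L p hor) (ℓ : L)
    (R : ℝ) : IsOpen (transportDomain (E' := E') M_L p ℓ R) := by
  have h1 : IsOpen ((extChartAt 𝓘(ℝ, E') ℓ).source ∩ (extChartAt 𝓘(ℝ, E') ℓ) ⁻¹'
      Metric.ball (extChartAt 𝓘(ℝ, E') ℓ ℓ) R) :=
    (continuousOn_extChartAt ℓ).isOpen_inter_preimage (isOpen_extChartAt_source ℓ) Metric.isOpen_ball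
  have h2 := hconn.smooth_proj.continuousOn.isOpen_inter_preimage hconn.isOpen h1
  exact (Metric.isOpen_ball.preimage continuous_fst).inter (h2.preimage continuous_snd)

/-- Parallel transport over the segments of a chart of the base, as a map which depends smoothly on
the segment and transports the foliation. -/
theorem exists_radial_transport (hconn : IsEhresmannFConnection F j 𝓘(ℝ, E') M_L p hor)
    (hcomplete : IsCompleteConnection 𝓘(ℝ, E') M_L p hor) (ℓ : L) :
    ∃ R > 0, ∃ S : E' × M → M,
      Metric.ball (extChartAt 𝓘(ℝ, E') ℓ ℓ) R ⊆ (extChartAt 𝓘(ℝ, E') ℓ).target ∧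
      ∀ z ∈ transportDomain M_L p ℓ R, Transports F S z ∧ S z ∈ M_L ∧
        p (S z) = (extChartAt 𝓘(ℝ, E') ℓ).symm (extChartAt 𝓘(ℝ, E') ℓ (p z.2) + z.1) ∧
        ((-z.1, S z) ∈ transportDomain M_L p ℓ R → S (-z.1, S z) = z.2) := by
  set κ := extChartAt 𝓘(ℝ, E') ℓ with hκ
  obtain ⟨χ⟩ : Nonempty (SmoothBumpFunction 𝓘(ℝ, E') ℓ) := inferInstance
  set b := Module.finBasis ℝ E'
  obtain ⟨R', hR', hball⟩ : ∃ R' > 0, ∀ x ∈ Metric.ball (κ ℓ) R', x ∈ κ.target ∧ χ (κ.symm x) = 1 := by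
    have h1 : ∀ᶠ x in 𝓝 (κ ℓ), x ∈ κ.target := extChartAt_target_mem_nhds ℓ
    have h2 : Tendsto κ.symm (𝓝 (κ ℓ)) (𝓝 ℓ) := by
      have := continuousAt_extChartAt_symm (I := 𝓘(ℝ, E')) ℓ
      rwa [ContinuousAt, extChartAt_to_inv] at this
    exact Metric.eventually_nhds_iff_ball.1 (h1.and (h2.eventually χ.eventuallyEq_one))
  set R := R' / 3 with hR
  have hRpos : 0 < R := by positivity
  have hline : ∀ z ∈ transportDomain M_L p ℓ R, ∀ r ∈ Ioo (-(1 / 2) : ℝ) (3 / 2),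
      κ (p z.2) + r • z.1 ∈ Metric.ball (κ ℓ) R' := by
    rintro z ⟨h1, -, -, h2⟩ r hr
    rw [Metric.mem_ball, dist_eq_norm] at h1 h2 ⊢
    rw [sub_zero] at h1
    have h3 : ‖r • z.1‖ ≤ 3 / 2 * R := by
      rw [norm_smul, Real.norm_eq_abs]
      have : |r| ≤ 3 / 2 := abs_le.2 ⟨by linarith [hr.1], hr.2.le⟩
      exact mul_le_mul this h1.le (norm_nonneg _) (by norm_num)
    calc ‖κ (p z.2) + r • z.1 - κ ℓ‖ = ‖(κ (p z.2) - κ ℓ) + r • z.1‖ := by congr 1; abel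
      _ ≤ ‖κ (p z.2) - κ ℓ‖ + ‖r • z.1‖ := norm_add_le _ _
      _ < R + 3 / 2 * R := by linarith
      _ < R' := by rw [hR]; linarith
  have h0 : (0 : ℝ) ∈ Ioo (-(1 / 2) : ℝ) (3 / 2) := by norm_num
  have h1 : (1 : ℝ) ∈ Ioo (-(1 / 2) : ℝ) (3 / 2) := by norm_num
  have hint : ∀ z ∈ transportDomain M_L p ℓ R, IsMIntegralCurveOn
      (fun r : ℝ => κ.symm (κ (p z.2) + r • z.1)) (cutoffField χ z.1)
      (Ioo (-(1 / 2) : ℝ) (3 / 2)) := fun z hz =>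
    isMIntegralCurveOn_line χ fun r hr => hball _ (hline z hz r hr)
  have hex : ∀ z : E' × M, ∃ γ : ℝ → M, z ∈ transportDomain M_L p ℓ R → γ 0 = z.2 ∧
      (∀ r ∈ Ioo (-(1 / 2) : ℝ) (3 / 2), γ r ∈ M_L) ∧
      IsMIntegralCurveOn γ (liftField p hor χ z.1) (Ioo (-(1 / 2) : ℝ) (3 / 2)) := by
    intro z
    by_cases hz : z ∈ transportDomain M_L p ℓ R
    · obtain ⟨γ, h⟩ := (hcomplete _ _ (cutoffField_smooth χ z.1)
        (isHorizontalLift_liftField hconn χ z.1) z.2 hz.2.1 (-(1 / 2)) (3 / 2) (by norm_num)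
        (by norm_num)).2 ⟨_, by simpa using κ.left_inv hz.2.2.1, hint z hz⟩
      exact ⟨γ, fun _ => h⟩
    · exact ⟨fun _ => z.2, fun h => absurd h hz⟩
  choose γ hγ using hex
  have hfam := isLinearFamilyOn_liftField hconn χ b
  have hproj : ∀ z ∈ transportDomain M_L p ℓ R, ∀ r ∈ Ioo (-(1 / 2) : ℝ) (3 / 2),
      p (γ z r) = κ.symm (κ (p z.2) + r • z.1) := by
    intro z hz r hr
    obtain ⟨g0, gM, gi⟩ := hγ z hz
    have hpi : IsMIntegralCurveOn (fun r => p (γ z r)) (cutoffField χ z.1)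
        (Ioo (-(1 / 2) : ℝ) (3 / 2)) := by
      intro q hq
      have hp := ((hconn.smooth_proj.contMDiffAt (hconn.isOpen.mem_nhds (gM q hq))).mdifferentiableAt
        (by simp)).hasMFDerivAt
      refine (hp.comp_hasMFDerivWithinAt q (gi q hq)).congr_mfderiv ?_
      refine ContinuousLinearMap.ext_ring ?_
      have h2 := (isHorizontalLift_liftField hconn χ z.1 _ (gM q hq)).2
      refine Eq.trans (congrArg (mfderiv 𝓘(ℝ, E) 𝓘(ℝ, E') p (γ z q)) (one_smul ℝ _)) ?_
      exact h2.trans (one_smul ℝ _).symm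
    refine integralCurve_eqOn_Ioo h0 (fun q _ => (cutoffField_smooth χ z.1).contMDiffAt univ_mem)
      hpi (hint z hz) ?_ hr
    simp only [g0, zero_smul, add_zero]
    exact (κ.left_inv hz.2.2.1).symm
  refine ⟨R, hRpos, fun z => γ z 1, fun x hx => (hball x (Metric.ball_subset_ball
    (by rw [hR]; linarith) hx)).1, fun z hz => ⟨?_, (hγ z hz).2.1 1 h1, ?_, fun hz' => ?_⟩⟩
  · exact transports_flow hconn.isOpen hfam (isOpen_transportDomain hconn ℓ R) h0
      (fun z hz => (hγ z hz).1) (fun z hz => (hγ z hz).2.1) (fun z hz => (hγ z hz).2.2) hz h1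
  · simpa using hproj z hz 1 h1
  · obtain ⟨g0, gM, gi⟩ := hγ z hz
    have hrev : IsMIntegralCurveOn (fun r => γ z (1 - r)) (liftField p hor χ (-z.1))
        (Ioo (-(1 / 2) : ℝ) (3 / 2)) := by
      intro r hr
      have hr' : 1 - r ∈ Ioo (-(1 / 2) : ℝ) (3 / 2) := ⟨by linarith [hr.2], by linarith [hr.1]⟩
      have h2 := (gi _ hr').hasMFDerivAt (Ioo_mem_nhds hr'.1 hr'.2)
      have hd : HasDerivAt (fun r : ℝ => 1 - r) (-1) r := by
        simpa using (hasDerivAt_id r).const_sub 1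
      refine ((h2.comp r hd.hasFDerivAt.hasMFDerivAt).congr_mfderiv ?_).hasMFDerivWithinAt
      refine ContinuousLinearMap.ext_ring ?_
      have h3 : liftField p hor χ (-z.1) (γ z (1 - r)) = -liftField p hor χ z.1 (γ z (1 - r)) := by
        rw [liftField_sum hconn χ b (gM _ hr'), liftField_sum hconn χ b (gM _ hr') z.1]
        simp only [map_neg, neg_smul, Finset.sum_neg_distrib]
      have h4 : ∀ v : E, ((1 : ℝ) • (-1 : ℝ)) • v = (1 : ℝ) • -v := by simp
      exact (h4 _).trans (congrArg (fun v : E => (1 : ℝ) • v) h3.symm)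
    have h3 := integralCurve_eqOn_Ioo (X := liftField p hor χ (-z.1)) h0
      (fun r hr => hfam.contMDiffAt _ ((hγ _ hz').2.1 r hr)) (hγ _ hz').2.2 hrev
      (by simp [(hγ _ hz').1]) h1
    simpa [g0] using h3

end RadialTransport

section Trivialization

variable {E : Type*} [NormedAddCommGroup E] [NormedSpace ℝ E]
  {M : Type*} [TopologicalSpace M] [ChartedSpace E M] [IsManifold 𝓘(ℝ, E) ∞ M]
  {E' : Type*} [NormedAddCommGroup E'] [NormedSpace ℝ E']
  {L : Type*} [TopologicalSpace L] [ChartedSpace E' L] [IsManifold 𝓘(ℝ, E') ∞ L]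
  {E₁ : Type*} [NormedAddCommGroup E₁] [NormedSpace ℝ E₁]
  {H₁ : Type*} [TopologicalSpace H₁] {I₁ : ModelWithCorners ℝ E₁ H₁}
  {Q : Type*} [TopologicalSpace Q] [ChartedSpace H₁ Q]
  {F : SingularFoliation 𝓘(ℝ, E) M} {j : L → M} {M_L : Set M} {p : M → L}
  {hor : (x : M) → Submodule ℝ (TangentSpace 𝓘(ℝ, E) x)} {S : E' × M → M} {ℓ : L} {R : ℝ}

omit [IsManifold 𝓘(ℝ, E) ∞ M] in
lemma mfderiv_comp_pair {g : Q → E'} {h : Q → M} {z : Q}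
    (hS : MDifferentiableAt (𝓘(ℝ, E').prod 𝓘(ℝ, E)) 𝓘(ℝ, E) S (g z, h z))
    (hg : MDifferentiableAt I₁ 𝓘(ℝ, E') g z) (hh : MDifferentiableAt I₁ 𝓘(ℝ, E) h z)
    (v : TangentSpace I₁ z) :
    mfderiv I₁ 𝓘(ℝ, E) (fun z => S (g z, h z)) z v =
      mfderiv (𝓘(ℝ, E').prod 𝓘(ℝ, E)) 𝓘(ℝ, E) S (g z, h z)
        (pairVec (z := (g z, h z)) (mfderiv I₁ 𝓘(ℝ, E') g z v) (mfderiv I₁ 𝓘(ℝ, E) h z v)) := by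
  have h1 := mfderiv_comp z (g := S) (f := fun z : Q => (g z, h z)) hS (hg.prodMk hh)
  rw [mfderiv_prodMk hg hh] at h1
  exact DFunLike.congr_fun h1 v

lemma Transports.spanAlong [FiniteDimensional ℝ E'] {g : Q → E'} {h : Q → M} {z₀ : Q}
    (hS : Transports F S (g z₀, h z₀)) (hg : SmoothNear I₁ 𝓘(ℝ, E') g z₀)
    (hh : SmoothNear I₁ 𝓘(ℝ, E) h z₀) {u : Q → E'} (hu : SmoothNear I₁ 𝓘(ℝ, E') u z₀) {y : Q → E}
    (hy : SpanAlong F I₁ h y z₀) :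
    SpanAlong F I₁ (fun z => S (g z, h z)) (fun z => (mfderiv (𝓘(ℝ, E').prod 𝓘(ℝ, E)) 𝓘(ℝ, E) S
      (g z, h z) (pairVec (z := (g z, h z)) (u z) (y z)) : E)) z₀ := by
  set b := Module.finBasis ℝ E'
  have hσ : SmoothNear I₁ (𝓘(ℝ, E').prod 𝓘(ℝ, E)) (fun z => (g z, h z)) z₀ := hg.prodMk hh
  obtain ⟨ι, _, Y, a, hY, ha, hya⟩ := hy
  have h1 := fun k => (SpanAlong.comp (σ := fun z : Q => (g z, h z)) (hS.2 (b k) _ F.zero_mem)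
    hσ).smul (hu.clm_comp (LinearMap.toContinuousLinearMap (b.coord k)))
  have h2 := fun i => (SpanAlong.comp (σ := fun z : Q => (g z, h z)) (hS.2 0 (Y i) (hY i)) hσ).smul
    (ha i)
  refine ((SpanAlong.sum (s := Finset.univ) fun k _ => h1 k).add
    (SpanAlong.sum (s := Finset.univ) fun i _ => h2 i)).congr ?_
  filter_upwards [hya] with z hz
  have key : ((u z, y z) : E' × E) = (∑ k, b.coord k (u z) • ((b k, 0) : E' × E)) +
      ∑ i, a i z • ((0, VField.vec (Y i) (h z)) : E' × E) := by
    rw [hz]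
    ext
    · simp [Prod.fst_sum, b.sum_repr]
    · simp [Prod.snd_sum]
  have lin : ∀ A : E' × E →L[ℝ] E, A (u z, y z) = (∑ k, b.coord k (u z) • A (b k, 0)) +
      ∑ i, a i z • A (0, VField.vec (Y i) (h z)) := fun A => by
    rw [key, map_add, map_sum, map_sum]
    simp only [map_smul]
  exact lin _

/-- The map `S` is a parallel transport over the segments of length less than `R` in the chart
at `ℓ`. -/
structure IsRadialTransport (F : SingularFoliation 𝓘(ℝ, E) M) (M_L : Set M) (p : M → L) (ℓ : L)
    (R : ℝ) (S : E' × M → M) : Prop where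
  pos : 0 < R
  transports : ∀ z ∈ transportDomain M_L p ℓ R, Transports F S z
  mem : ∀ z ∈ transportDomain M_L p ℓ R, S z ∈ M_L
  proj : ∀ z ∈ transportDomain M_L p ℓ R, p (S z) =
    (extChartAt 𝓘(ℝ, E') ℓ).symm (extChartAt 𝓘(ℝ, E') ℓ (p z.2) + z.1)
  reverse : ∀ z ∈ transportDomain M_L p ℓ R, (-z.1, S z) ∈ transportDomain M_L p ℓ R →
    S (-z.1, S z) = z.2

variable (E') in
/-- The coordinate ball of radius `R` around `ℓ`. -/
def chartBall (ℓ : L) (R : ℝ) : Set L :=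
  (extChartAt 𝓘(ℝ, E') ℓ).source ∩ (extChartAt 𝓘(ℝ, E') ℓ) ⁻¹'
    Metric.ball (extChartAt 𝓘(ℝ, E') ℓ ℓ) R

variable (E') in
/-- The coordinates of a point relative to `ℓ`. -/
noncomputable def relCoord (ℓ q : L) : E' := extChartAt 𝓘(ℝ, E') ℓ q - extChartAt 𝓘(ℝ, E') ℓ ℓ

/-- The map to the fibre over `ℓ` defined by a transport. -/
noncomputable def toFibre (p : M → L) (ℓ : L) (S : E' × M → M) (z : M) : M :=
  S (-relCoord E' ℓ (p z), z)

/-- The trivialization defined by a transport. -/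
noncomputable def trivialization (p : M → L) (ℓ : L) (S : E' × M → M) (z : M) : L × M :=
  (p z, toFibre p ℓ S z)

/-- The inverse of the trivialization defined by a transport. -/
noncomputable def trivializationInv (ℓ : L) (S : E' × M → M) (w : L × M) : M :=
  S (relCoord E' ℓ w.1, w.2)

omit [IsManifold 𝓘(ℝ, E') ∞ L] in
lemma isOpen_chartBall : IsOpen (chartBall E' ℓ R) :=
  (continuousOn_extChartAt ℓ).isOpen_inter_preimage (isOpen_extChartAt_source ℓ) Metric.isOpen_ball

omit [IsManifold 𝓘(ℝ, E') ∞ L] in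
lemma isOpen_preimage_chartBall (hconn : IsEhresmannFConnection F j 𝓘(ℝ, E') M_L p hor) :
    IsOpen (M_L ∩ p ⁻¹' chartBall E' ℓ R) :=
  hconn.smooth_proj.continuousOn.isOpen_inter_preimage hconn.isOpen isOpen_chartBall

omit [IsManifold 𝓘(ℝ, E') ∞ L] [TopologicalSpace M] [ChartedSpace E M] [IsManifold 𝓘(ℝ, E) ∞ M] in
lemma toFibre_domain {z : M} (hz : z ∈ M_L ∩ p ⁻¹' chartBall E' ℓ R) :
    (-relCoord E' ℓ (p z), z) ∈ transportDomain M_L p ℓ R := by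
  refine ⟨?_, hz.1, hz.2.1, hz.2.2⟩
  have := hz.2.2
  rw [mem_preimage, Metric.mem_ball, dist_comm, dist_eq_norm] at this
  simpa [relCoord] using this

omit [IsManifold 𝓘(ℝ, E') ∞ L] [TopologicalSpace M] [ChartedSpace E M] [IsManifold 𝓘(ℝ, E) ∞ M] in
lemma trivializationInv_domain (hR : 0 < R) {w : L × M}
    (hw : w ∈ chartBall E' ℓ R ×ˢ fibre M_L p ℓ) :
    (relCoord E' ℓ w.1, w.2) ∈ transportDomain M_L p ℓ R := by
  refine ⟨?_, hw.2.1, ?_, ?_⟩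
  · have := hw.1.2
    rw [mem_preimage, Metric.mem_ball, dist_eq_norm] at this
    simpa [relCoord] using this
  · rw [hw.2.2]; exact mem_extChartAt_source ℓ
  · rw [hw.2.2]; exact Metric.mem_ball_self hR

omit [IsManifold 𝓘(ℝ, E') ∞ L] in
lemma toFibre_mem (hS : IsRadialTransport F M_L p ℓ R S) {z : M}
    (hz : z ∈ M_L ∩ p ⁻¹' chartBall E' ℓ R) : toFibre p ℓ S z ∈ fibre M_L p ℓ := by
  refine ⟨hS.mem _ (toFibre_domain hz), (hS.proj _ (toFibre_domain hz)).trans ?_⟩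
  simp [relCoord]

omit [IsManifold 𝓘(ℝ, E') ∞ L] in
lemma proj_trivializationInv (hS : IsRadialTransport F M_L p ℓ R S) {w : L × M}
    (hw : w ∈ chartBall E' ℓ R ×ˢ fibre M_L p ℓ) : p (trivializationInv ℓ S w) = w.1 := by
  refine (hS.proj _ (trivializationInv_domain hS.pos hw)).trans ?_
  simp only [hw.2.2, relCoord, add_sub_cancel]
  exact (extChartAt 𝓘(ℝ, E') ℓ).left_inv hw.1.1

omit [IsManifold 𝓘(ℝ, E') ∞ L] in
lemma trivialization_mem (hS : IsRadialTransport F M_L p ℓ R S) {z : M}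
    (hz : z ∈ M_L ∩ p ⁻¹' chartBall E' ℓ R) :
    trivialization p ℓ S z ∈ chartBall E' ℓ R ×ˢ fibre M_L p ℓ := ⟨hz.2, toFibre_mem hS hz⟩

omit [IsManifold 𝓘(ℝ, E') ∞ L] in
lemma trivializationInv_mem (hS : IsRadialTransport F M_L p ℓ R S) {w : L × M}
    (hw : w ∈ chartBall E' ℓ R ×ˢ fibre M_L p ℓ) :
    trivializationInv ℓ S w ∈ M_L ∩ p ⁻¹' chartBall E' ℓ R :=
  ⟨hS.mem _ (trivializationInv_domain hS.pos hw), by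
    rw [mem_preimage, proj_trivializationInv hS hw]; exact hw.1⟩

omit [IsManifold 𝓘(ℝ, E') ∞ L] in
lemma trivializationInv_trivialization (hS : IsRadialTransport F M_L p ℓ R S) {z : M}
    (hz : z ∈ M_L ∩ p ⁻¹' chartBall E' ℓ R) :
    trivializationInv ℓ S (trivialization p ℓ S z) = z := by
  have h := hS.reverse _ (toFibre_domain hz)
  simp only [neg_neg] at h
  exact h (trivializationInv_domain hS.pos (trivialization_mem hS hz))

omit [IsManifold 𝓘(ℝ, E') ∞ L] in
lemma trivialization_trivializationInv (hS : IsRadialTransport F M_L p ℓ R S) {w : L × M}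
    (hw : w ∈ chartBall E' ℓ R ×ˢ fibre M_L p ℓ) :
    trivialization p ℓ S (trivializationInv ℓ S w) = w := by
  have h1 := proj_trivializationInv hS hw
  refine Prod.ext h1 ?_
  have h := hS.reverse _ (trivializationInv_domain hS.pos hw)
  have h2 := toFibre_domain (trivializationInv_mem hS hw)
  rw [h1] at h2
  simp only [trivialization, toFibre, h1]
  exact h h2

lemma smoothNear_relCoord {q : L} (hq : q ∈ chartBall E' ℓ R) :
    SmoothNear 𝓘(ℝ, E') 𝓘(ℝ, E') (relCoord E' ℓ) q :=
  ((smoothNear_chart hq.1).add (smoothNear_const (c := -extChartAt 𝓘(ℝ, E') ℓ ℓ))).congr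
    (Eventually.of_forall fun _ => sub_eq_add_neg _ _)

lemma mfderiv_relCoord {q : L} (hq : q ∈ chartBall E' ℓ R) (v : TangentSpace 𝓘(ℝ, E') q) :
    mfderiv 𝓘(ℝ, E') 𝓘(ℝ, E') (relCoord E' ℓ) q v =
      mfderiv 𝓘(ℝ, E') 𝓘(ℝ, E') (extChartAt 𝓘(ℝ, E') ℓ) q v := by
  have h1 := ((smoothNear_chart hq.1).contMDiffAt.mdifferentiableAt (by simp)).hasMFDerivAt
  have h2 := h1.sub (hasMFDerivAt_const (I := 𝓘(ℝ, E')) (extChartAt 𝓘(ℝ, E') ℓ ℓ) q)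
  have h3 : ∀ A : E' →L[ℝ] E', A - 0 = A := sub_zero
  exact DFunLike.congr_fun (h2.mfderiv.trans (h3 _)) v

lemma smoothNear_toFibre (hconn : IsEhresmannFConnection F j 𝓘(ℝ, E') M_L p hor)
    (hS : IsRadialTransport F M_L p ℓ R S) {z : M} (hz : z ∈ M_L ∩ p ⁻¹' chartBall E' ℓ R) :
    SmoothNear 𝓘(ℝ, E) 𝓘(ℝ, E) (toFibre p ℓ S) z :=
  SmoothNear.comp (g := S) (f := fun z : M => (-relCoord E' ℓ (p z), z))
    (hS.transports _ (toFibre_domain hz)).1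
    (((smoothNear_relCoord hz.2).comp (smoothNear_proj hconn hz.1)).neg.prodMk smoothNear_id)

lemma smoothNear_trivialization (hconn : IsEhresmannFConnection F j 𝓘(ℝ, E') M_L p hor)
    (hS : IsRadialTransport F M_L p ℓ R S) {z : M} (hz : z ∈ M_L ∩ p ⁻¹' chartBall E' ℓ R) :
    SmoothNear 𝓘(ℝ, E) (𝓘(ℝ, E').prod 𝓘(ℝ, E)) (trivialization p ℓ S) z :=
  (smoothNear_proj hconn hz.1).prodMk (smoothNear_toFibre hconn hS hz)

lemma smoothNear_trivializationInv (hS : IsRadialTransport F M_L p ℓ R S) {w : L × M}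
    (hw : w ∈ chartBall E' ℓ R ×ˢ fibre M_L p ℓ) :
    SmoothNear (𝓘(ℝ, E').prod 𝓘(ℝ, E)) 𝓘(ℝ, E) (trivializationInv ℓ S) w :=
  SmoothNear.comp (g := S) (f := fun w : L × M => (relCoord E' ℓ w.1, w.2))
    (hS.transports _ (trivializationInv_domain hS.pos hw)).1
    (((smoothNear_relCoord hw.1).comp smoothNear_fst).prodMk smoothNear_snd)

lemma isDiffeoBetween_trivialization (hconn : IsEhresmannFConnection F j 𝓘(ℝ, E') M_L p hor)
    (hS : IsRadialTransport F M_L p ℓ R S) :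
    IsDiffeoBetween 𝓘(ℝ, E) (𝓘(ℝ, E').prod 𝓘(ℝ, E)) (trivialization p ℓ S)
      (trivializationInv ℓ S) (M_L ∩ p ⁻¹' chartBall E' ℓ R)
      (chartBall E' ℓ R ×ˢ fibre M_L p ℓ) where
  mapsTo _ hz := trivialization_mem hS hz
  mapsTo_inv _ hw := trivializationInv_mem hS hw
  left_inv _ hz := trivializationInv_trivialization hS hz
  right_inv _ hw := trivialization_trivializationInv hS hw
  smooth z hz := by
    obtain ⟨V, hV, hzV, h⟩ := (smoothNear_trivialization hconn hS hz).exists_contMDiffOn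
    exact ⟨V, hV, hzV, _, h, fun _ _ => rfl⟩
  smooth_inv w hw := by
    obtain ⟨V, hV, hwV, h⟩ := (smoothNear_trivializationInv hS hw).exists_contMDiffOn
    exact ⟨V, hV, hwV, _, h, fun _ _ => rfl⟩

/-- The differential of the trivialization. -/
lemma mfderiv_trivialization (hconn : IsEhresmannFConnection F j 𝓘(ℝ, E') M_L p hor)
    (hS : IsRadialTransport F M_L p ℓ R S) {z : M} (hz : z ∈ M_L ∩ p ⁻¹' chartBall E' ℓ R)
    (v : TangentSpace 𝓘(ℝ, E) z) :
    (mfderiv 𝓘(ℝ, E) (𝓘(ℝ, E').prod 𝓘(ℝ, E)) (trivialization p ℓ S) z v : E' × E) =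
      ((mfderiv 𝓘(ℝ, E) 𝓘(ℝ, E') p z v, mfderiv 𝓘(ℝ, E) 𝓘(ℝ, E) (toFibre p ℓ S) z v) :
        E' × E) :=
  DFunLike.congr_fun (mfderiv_prodMk
    ((smoothNear_proj hconn hz.1).contMDiffAt.mdifferentiableAt (by simp))
    ((smoothNear_toFibre hconn hS hz).contMDiffAt.mdifferentiableAt (by simp))) v

lemma mfderiv_proj_toFibre (hconn : IsEhresmannFConnection F j 𝓘(ℝ, E') M_L p hor)
    (hS : IsRadialTransport F M_L p ℓ R S) {z : M} (hz : z ∈ M_L ∩ p ⁻¹' chartBall E' ℓ R)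
    (v : TangentSpace 𝓘(ℝ, E) z) :
    mfderiv 𝓘(ℝ, E) 𝓘(ℝ, E') p (toFibre p ℓ S z)
      (mfderiv 𝓘(ℝ, E) 𝓘(ℝ, E) (toFibre p ℓ S) z v) = 0 := by
  have h1 := mfderiv_comp z
    ((smoothNear_proj hconn (toFibre_mem hS hz).1).contMDiffAt.mdifferentiableAt (by simp))
    ((smoothNear_toFibre hconn hS hz).contMDiffAt.mdifferentiableAt (by simp))
  have h2 : (p ∘ toFibre p ℓ S) =ᶠ[𝓝 z] fun _ => ℓ := by
    filter_upwards [(isOpen_preimage_chartBall hconn).mem_nhds hz] with y hy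
    exact (toFibre_mem hS hy).2
  have h3 := Filter.EventuallyEq.mfderiv_eq (I := 𝓘(ℝ, E)) (I' := 𝓘(ℝ, E')) h2
  have h4 : ∀ v : E, (mfderiv 𝓘(ℝ, E) 𝓘(ℝ, E') (p ∘ toFibre p ℓ S) z v : E') = 0 := fun v => by
    have h5 : (mfderiv 𝓘(ℝ, E) 𝓘(ℝ, E') (fun _ : M => ℓ) z v : E') = 0 := by
      rw [mfderiv_const]; rfl
    exact Eq.trans (DFunLike.congr_fun h3 v) h5
  exact (DFunLike.congr_fun h1 v).symm.trans (h4 v)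

end Trivialization

section Intertwining

variable {E : Type*} [NormedAddCommGroup E] [NormedSpace ℝ E]
  {M : Type*} [TopologicalSpace M] [ChartedSpace E M] [IsManifold 𝓘(ℝ, E) ∞ M]
  {E' : Type*} [NormedAddCommGroup E'] [NormedSpace ℝ E']
  {L : Type*} [TopologicalSpace L] [ChartedSpace E' L] [IsManifold 𝓘(ℝ, E') ∞ L]
  {F : SingularFoliation 𝓘(ℝ, E) M} {j : L → M} {M_L : Set M} {p : M → L}
  {hor : (x : M) → Submodule ℝ (TangentSpace 𝓘(ℝ, E) x)} {S : E' × M → M} {ℓ : L} {R : ℝ}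
  {X : VField 𝓘(ℝ, E) M} {Z : VField (𝓘(ℝ, E').prod 𝓘(ℝ, E)) (L × M)}

lemma mfderiv_relCoord_comp_proj (hconn : IsEhresmannFConnection F j 𝓘(ℝ, E') M_L p hor) {z : M}
    (hz : z ∈ M_L ∩ p ⁻¹' chartBall E' ℓ R) (v : TangentSpace 𝓘(ℝ, E) z) :
    mfderiv 𝓘(ℝ, E) 𝓘(ℝ, E') (fun y => relCoord E' ℓ (p y)) z v =
      mfderiv 𝓘(ℝ, E') 𝓘(ℝ, E') (extChartAt 𝓘(ℝ, E') ℓ) (p z)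
        (mfderiv 𝓘(ℝ, E) 𝓘(ℝ, E') p z v) := by
  have h := mfderiv_comp z ((smoothNear_relCoord hz.2).contMDiffAt.mdifferentiableAt (by simp))
    ((smoothNear_proj hconn hz.1).contMDiffAt.mdifferentiableAt (by simp))
  exact (DFunLike.congr_fun h v).trans (mfderiv_relCoord hz.2 _)

lemma vertPart_mem_fibreFoliation [FiniteDimensional ℝ E] [T2Space M] [FiniteDimensional ℝ E']
    (hconn : IsEhresmannFConnection F j 𝓘(ℝ, E') M_L p hor)
    {Y : VField 𝓘(ℝ, E) M} (hY : Y ∈ F.carrier) (ℓ : L) :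
    vertPart E' p hor Y ∈ fibreFoliation F 𝓘(ℝ, E') M_L p ℓ := by
  intro m hm
  obtain ⟨Y', hY', h⟩ := vertPart_mem_onOpen hconn hY m hm.1
  exact ⟨mfderiv_vertPart hconn hm.1 Y, Y', hY', h.filter_mono nhdsWithin_le_nhds⟩

omit [IsManifold 𝓘(ℝ, E') ∞ L] in
lemma sum_vertPart (hconn : IsEhresmannFConnection F j 𝓘(ℝ, E') M_L p hor) {m : M} (hm : m ∈ M_L)
    {ι : Type*} [Fintype ι] (Y : ι → VField 𝓘(ℝ, E) M) (a : ι → ℝ)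
    (h : mfderiv 𝓘(ℝ, E) 𝓘(ℝ, E') p m (∑ i, a i • Y i m) = 0) :
    ∑ i, a i • vertPart E' p hor (Y i) m = ∑ i, a i • Y i m := by
  have h1 : ∑ i, a i • hlift (E' := E') p hor m (mfderiv 𝓘(ℝ, E) 𝓘(ℝ, E') p m (Y i m)) = 0 := by
    refine eq_of_mem_hor hconn hm ((hor m).sum_mem fun i _ => (hor m).smul_mem _
      (hlift_spec hconn hm _).1) (hor m).zero_mem ?_
    rw [map_zero, ← h, map_sum, map_sum]
    simp only [map_smul, (hlift_spec hconn hm _).2]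
  simp only [vertPart, smul_sub, Finset.sum_sub_distrib, h1, sub_zero]

/-- A vector field whose push-forward belongs to the product foliation belongs to `F`. -/
lemma mem_onOpen_of_pushforward_mem [FiniteDimensional ℝ E] [T2Space M] [FiniteDimensional ℝ E']
    (hconn : IsEhresmannFConnection F j 𝓘(ℝ, E') M_L p hor)
    (hS : IsRadialTransport F M_L p ℓ R S)
    (hXZ : ∀ z ∈ M_L ∩ p ⁻¹' chartBall E' ℓ R,
      mfderiv 𝓘(ℝ, E) (𝓘(ℝ, E').prod 𝓘(ℝ, E)) (trivialization p ℓ S) z (X z) =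
        Z (trivialization p ℓ S z))
    (hZ : Z ∈ prodFoliation (chartBall E' ℓ R) (fullFoliation 𝓘(ℝ, E') (chartBall E' ℓ R))
      (fibre M_L p ℓ) (fibreFoliation F 𝓘(ℝ, E') M_L p ℓ)) :
    X ∈ F.onOpen (M_L ∩ p ⁻¹' chartBall E' ℓ R) := by
  intro z₀ hz₀
  obtain ⟨W, hW, hzW, k, l, A, Y, f, g, hA, hY, hf, hg, hsum⟩ := hZ _ (trivialization_mem hS hz₀)
  have hΦ := smoothNear_trivialization hconn hS hz₀
  have hp := smoothNear_proj hconn hz₀.1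
  have hT := smoothNear_toFibre hconn hS hz₀
  choose Y' hY' hYY' using fun i => (hY i _ (toFibre_mem hS hz₀)).2
  have hTend : Tendsto (toFibre p ℓ S) (𝓝 z₀) (𝓝[fibre M_L p ℓ] (toFibre p ℓ S z₀)) := by
    refine tendsto_nhdsWithin_iff.2 ⟨hT.continuousAt, ?_⟩
    filter_upwards [(isOpen_preimage_chartBall hconn).mem_nhds hz₀] with z hz
    exact toFibre_mem hS hz
  have hf' : ∀ i, SmoothNear 𝓘(ℝ, E) 𝓘(ℝ, ℝ) (fun z => f i (trivialization p ℓ S z)) z₀ :=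
    fun i => (SmoothNear.of_contMDiffOn (hf i) hW hzW).comp hΦ
  have hg' : ∀ i, SmoothNear 𝓘(ℝ, E) 𝓘(ℝ, ℝ) (fun z => g i (trivialization p ℓ S z)) z₀ :=
    fun i => (SmoothNear.of_contMDiffOn (hg i) hW hzW).comp hΦ
  have hu : SmoothNear 𝓘(ℝ, E) 𝓘(ℝ, E') (fun z => ∑ i, f i (trivialization p ℓ S z) •
      (mfderiv 𝓘(ℝ, E') 𝓘(ℝ, E') (extChartAt 𝓘(ℝ, E') ℓ) (p z) (A i (p z)) : E')) z₀ :=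
    SmoothNear.sum fun i _ => (hf' i).smul (((smoothNear_chart hz₀.2.1).mfderiv_vfield
      (SmoothNear.of_contMDiffOn (hA i) isOpen_chartBall hz₀.2)).comp hp)
  have hy : SpanAlong F 𝓘(ℝ, E) (toFibre p ℓ S) (fun z => ∑ i, g i (trivialization p ℓ S z) •
      VField.vec (Y' i) (toFibre p ℓ S z)) z₀ :=
    SpanAlong.sum fun i _ => (SpanAlong.of_mem (hY' i)).smul (hg' i)
  have hspan := Transports.spanAlong (g := fun z => relCoord E' ℓ (p z)) (h := toFibre p ℓ S)
    (z₀ := z₀) (hS.transports _ (trivializationInv_domain hS.pos (trivialization_mem hS hz₀)))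
    ((smoothNear_relCoord hz₀.2).comp hp) hT hu hy
  have hA_nhds := (isOpen_preimage_chartBall hconn).mem_nhds hz₀
  have hid : ∀ z ∈ M_L ∩ p ⁻¹' chartBall E' ℓ R, S (relCoord E' ℓ (p z), toFibre p ℓ S z) = z :=
    fun z hz => trivializationInv_trivialization hS hz
  refine SpanAlong.exists_mem ((hspan.congr_map ?_).congr ?_)
  · filter_upwards [hA_nhds] with z hz using (hid z hz).symm
  filter_upwards [hA_nhds, hΦ.continuousAt.eventually (hW.mem_nhds hzW),
    eventually_all.2 fun i => hTend.eventually (hYY' i)] with z hz hzW hYz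
  have hval : ((mfderiv 𝓘(ℝ, E) 𝓘(ℝ, E') p z (X z),
      mfderiv 𝓘(ℝ, E) 𝓘(ℝ, E) (toFibre p ℓ S) z (X z)) : E' × E) =
      ∑ i, f i (trivialization p ℓ S z) • ((VField.vec (A i) (p z), 0) : E' × E) +
        ∑ i, g i (trivialization p ℓ S z) • ((0, VField.vec (Y i) (toFibre p ℓ S z)) : E' × E) :=
    ((mfderiv_trivialization hconn hS hz (X z)).symm.trans (hXZ z hz)).trans
      (hsum _ ⟨hzW, trivialization_mem hS hz⟩)
  have h1 : (mfderiv 𝓘(ℝ, E) 𝓘(ℝ, E') p z (X z) : E') =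
      ∑ i, f i (trivialization p ℓ S z) • VField.vec (A i) (p z) :=
    (congrArg Prod.fst hval).trans (by simp [Prod.fst_sum])
  have h2 : (mfderiv 𝓘(ℝ, E) 𝓘(ℝ, E) (toFibre p ℓ S) z (X z) : E) =
      ∑ i, g i (trivialization p ℓ S z) • VField.vec (Y' i) (toFibre p ℓ S z) := by
    have : (mfderiv 𝓘(ℝ, E) 𝓘(ℝ, E) (toFibre p ℓ S) z (X z) : E) =
      ∑ i, g i (trivialization p ℓ S z) • VField.vec (Y i) (toFibre p ℓ S z) :=
      (congrArg Prod.snd hval).trans (by simp [Prod.snd_sum])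
    refine this.trans (Finset.sum_congr rfl fun i _ => ?_)
    exact congrArg (fun v : E => _ • v) (hYz i)
  have h3 : (mfderiv 𝓘(ℝ, E) 𝓘(ℝ, E') (fun y => relCoord E' ℓ (p y)) z (X z) : E') =
      ∑ i, f i (trivialization p ℓ S z) •
        (mfderiv 𝓘(ℝ, E') 𝓘(ℝ, E') (extChartAt 𝓘(ℝ, E') ℓ) (p z) (A i (p z)) : E') := by
    refine (mfderiv_relCoord_comp_proj hconn hz (X z)).trans ?_
    have : ∀ B : E' →L[ℝ] E', B (∑ i, f i (trivialization p ℓ S z) • VField.vec (A i) (p z)) =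
        ∑ i, f i (trivialization p ℓ S z) • B (VField.vec (A i) (p z)) := fun B => by
      rw [map_sum]; simp only [map_smul]
    exact (congrArg (mfderiv 𝓘(ℝ, E') 𝓘(ℝ, E') (extChartAt 𝓘(ℝ, E') ℓ) (p z)) h1).trans (this _)
  have h4 : ∀ v : E, (mfderiv 𝓘(ℝ, E) 𝓘(ℝ, E)
      (fun z => S (relCoord E' ℓ (p z), toFibre p ℓ S z)) z v : E) = v := fun v => by
    have h5 : (fun z => S (relCoord E' ℓ (p z), toFibre p ℓ S z)) =ᶠ[𝓝 z] fun z => z := by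
      filter_upwards [(isOpen_preimage_chartBall hconn).mem_nhds hz] with z hz using hid z hz
    have h6 := Filter.EventuallyEq.mfderiv_eq (I := 𝓘(ℝ, E)) (I' := 𝓘(ℝ, E)) h5
    have h7 : (mfderiv 𝓘(ℝ, E) 𝓘(ℝ, E) (fun z : M => z) z v : E) = v :=
      DFunLike.congr_fun (mfderiv_id (I := 𝓘(ℝ, E)) (x := z)) v
    exact Eq.trans (DFunLike.congr_fun h6 v) h7
  have h8 := mfderiv_comp_pair (S := S) (g := fun z => relCoord E' ℓ (p z)) (h := toFibre p ℓ S)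
    ((hS.transports _ (trivializationInv_domain hS.pos
      (trivialization_mem hS hz))).1.contMDiffAt.mdifferentiableAt (by simp))
    (((smoothNear_relCoord hz.2).comp
      (smoothNear_proj hconn hz.1)).contMDiffAt.mdifferentiableAt (by simp))
    ((smoothNear_toFibre hconn hS hz).contMDiffAt.mdifferentiableAt (by simp)) (X z)
  refine ((h4 (X z)).symm.trans h8).trans ?_
  exact congrArg (mfderiv (𝓘(ℝ, E').prod 𝓘(ℝ, E)) 𝓘(ℝ, E) S (relCoord E' ℓ (p z), toFibre p ℓ S z))
    (congrArg₂ (Prod.mk (α := E') (β := E)) h3 h2)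

/-- The push-forward of a vector field that belongs to `F` belongs to the product foliation. -/
lemma pushforward_mem_prodFoliation [FiniteDimensional ℝ E] [T2Space M] [FiniteDimensional ℝ E']
    (hconn : IsEhresmannFConnection F j 𝓘(ℝ, E') M_L p hor)
    (hS : IsRadialTransport F M_L p ℓ R S)
    (hXZ : ∀ z ∈ M_L ∩ p ⁻¹' chartBall E' ℓ R,
      mfderiv 𝓘(ℝ, E) (𝓘(ℝ, E').prod 𝓘(ℝ, E)) (trivialization p ℓ S) z (X z) =
        Z (trivialization p ℓ S z))
    (hX : X ∈ F.onOpen (M_L ∩ p ⁻¹' chartBall E' ℓ R)) :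
    Z ∈ prodFoliation (chartBall E' ℓ R) (fullFoliation 𝓘(ℝ, E') (chartBall E' ℓ R))
      (fibre M_L p ℓ) (fibreFoliation F 𝓘(ℝ, E') M_L p ℓ) := by
  set b := Module.finBasis ℝ E'
  intro w₀ hw₀
  have hz₀ := trivializationInv_mem hS hw₀
  set z₀ := trivializationInv ℓ S w₀ with hz₀_def
  obtain ⟨Y, hY, hXY⟩ := hX z₀ hz₀
  have hp := smoothNear_proj hconn hz₀.1
  have hPs := (smoothNear_relCoord hz₀.2).comp hp
  have hYs : SmoothNear 𝓘(ℝ, E) 𝓘(ℝ, E).tangent (fun y => (⟨y, Y y⟩ : TangentBundle 𝓘(ℝ, E) M)) z₀ :=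
    SmoothNear.of_contMDiffOn (F.smooth Y hY) isOpen_univ (mem_univ _)
  have hh := hPs.mfderiv_vfield hYs
  obtain ⟨ι, _, V, a, hV, ha, hsum⟩ := Transports.spanAlong (g := fun z => -relCoord E' ℓ (p z))
    (h := fun z => z) (hS.transports _ (toFibre_domain hz₀)) hPs.neg smoothNear_id
    (hPs.neg.mfderiv_vfield hYs) (SpanAlong.of_mem hY)
  have hΨ := smoothNear_trivializationInv hS hw₀
  have hlocal : ∀ᶠ z in 𝓝 z₀, z ∈ M_L ∩ p ⁻¹' chartBall E' ℓ R ∧ X z = Y z ∧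
      (mfderiv 𝓘(ℝ, E) 𝓘(ℝ, E) (toFibre p ℓ S) z (X z) : E) =
        ∑ i, a i z • VField.vec (V i) (toFibre p ℓ S z) := by
    filter_upwards [(isOpen_preimage_chartBall hconn).mem_nhds hz₀, hXY, hsum] with z hz h1 h2
    refine ⟨hz, h1, ?_⟩
    have h8 := mfderiv_comp_pair (S := S) (g := fun z => -relCoord E' ℓ (p z)) (h := fun z : M => z)
      ((hS.transports _ (toFibre_domain hz)).1.contMDiffAt.mdifferentiableAt (by simp))
      (((smoothNear_relCoord hz.2).comp
        (smoothNear_proj hconn hz.1)).neg.contMDiffAt.mdifferentiableAt (by simp))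
      mdifferentiableAt_id (X z)
    refine Eq.trans (h8.trans ?_) h2
    have h3 : ∀ v : E, (mfderiv 𝓘(ℝ, E) 𝓘(ℝ, E) (fun z : M => z) z v : E) = v := fun v =>
      DFunLike.congr_fun (mfderiv_id (I := 𝓘(ℝ, E)) (x := z)) v
    exact congrArg (mfderiv (𝓘(ℝ, E').prod 𝓘(ℝ, E)) 𝓘(ℝ, E) S (-relCoord E' ℓ (p z), z))
      (congrArg₂ (Prod.mk (α := E') (β := E)) (congrArg (mfderiv 𝓘(ℝ, E) 𝓘(ℝ, E')
        (fun z => -relCoord E' ℓ (p z)) z) h1) ((h3 (X z)).trans h1))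
  let e := (Fintype.equivFin ι).symm
  have hf' : ∀ k, SmoothNear (𝓘(ℝ, E').prod 𝓘(ℝ, E)) 𝓘(ℝ, ℝ) (fun w => b.coord k
      (mfderiv 𝓘(ℝ, E) 𝓘(ℝ, E') (fun y => relCoord E' ℓ (p y)) (trivializationInv ℓ S w)
        (Y (trivializationInv ℓ S w)) : E')) w₀ := fun k =>
    SmoothNear.comp (g := fun z => b.coord k
      (mfderiv 𝓘(ℝ, E) 𝓘(ℝ, E') (fun y => relCoord E' ℓ (p y)) z (Y z) : E'))
      (hh.clm_comp (LinearMap.toContinuousLinearMap (b.coord k))) hΨ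
  have hg' : ∀ i, SmoothNear (𝓘(ℝ, E').prod 𝓘(ℝ, E)) 𝓘(ℝ, ℝ)
      (fun w => a (e i) (trivializationInv ℓ S w)) w₀ := fun i =>
    SmoothNear.comp (g := a (e i)) (f := trivializationInv ℓ S) (ha (e i)) hΨ
  obtain ⟨W, hW, hWo, hwW⟩ := eventually_nhds_iff.1 (((eventually_all.2 hf').and
    (eventually_all.2 hg')).and (hΨ.continuousAt.eventually hlocal))
  refine ⟨W, hWo, hwW, _, _, fun k => constField ℓ (b k), fun i => vertPart E' p hor (V (e i)),
    _, _, fun k => (constField_smooth ℓ (b k)).mono inter_subset_left,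
    fun i => vertPart_mem_fibreFoliation hconn (hV _) ℓ,
    fun k w hw => ((hW w hw).1.1 k).contMDiffWithinAt,
    fun i w hw => ((hW w hw).1.2 i).contMDiffWithinAt, fun w hw => ?_⟩
  obtain ⟨hz, hXY, hTX⟩ := (hW w hw.1).2
  set z := trivializationInv ℓ S w with hz_def
  have hΦz : trivialization p ℓ S z = w := trivialization_trivializationInv hS hw.2
  have h1 : (mfderiv 𝓘(ℝ, E) 𝓘(ℝ, E') p z (X z) : E') = ∑ k, b.coord k
      (mfderiv 𝓘(ℝ, E) 𝓘(ℝ, E') (fun y => relCoord E' ℓ (p y)) z (Y z) : E') •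
        VField.vec (constField ℓ (b k)) (p z) := by
    refine Eq.trans ?_ (constField_sum b ℓ (p z)
      (mfderiv 𝓘(ℝ, E) 𝓘(ℝ, E') (fun y => relCoord E' ℓ (p y)) z (Y z) : E'))
    refine mfderiv_chart_injective hz.2.1 ?_
    refine (mfderiv_relCoord_comp_proj hconn hz (X z)).symm.trans ?_
    rw [hXY]
    exact (mfderiv_constField hz.2.1 _).symm
  have h2 : (mfderiv 𝓘(ℝ, E) 𝓘(ℝ, E) (toFibre p ℓ S) z (X z) : E) =
      ∑ i, a (e i) z • VField.vec (vertPart E' p hor (V (e i))) (toFibre p ℓ S z) := by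
    have h3 := sum_vertPart (E' := E') hconn (toFibre_mem hS hz).1 V (fun i => a i z)
      ((congrArg (mfderiv 𝓘(ℝ, E) 𝓘(ℝ, E') p (toFibre p ℓ S z)) hTX).symm.trans
        (mfderiv_proj_toFibre hconn hS hz (X z)))
    refine (hTX.trans h3.symm).trans ?_
    exact (e.sum_comp (fun i => a i z • VField.vec (vertPart E' p hor (V i)) (toFibre p ℓ S z))).symm
  have h4 : ((mfderiv 𝓘(ℝ, E) 𝓘(ℝ, E') p z (X z),
      mfderiv 𝓘(ℝ, E) 𝓘(ℝ, E) (toFibre p ℓ S) z (X z)) : E' × E) =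
      (∑ k, b.coord k (mfderiv 𝓘(ℝ, E) 𝓘(ℝ, E') (fun y => relCoord E' ℓ (p y)) z (Y z) : E') •
        ((VField.vec (constField ℓ (b k)) (p z), 0) : E' × E)) +
      ∑ i, a (e i) z •
        ((0, VField.vec (vertPart E' p hor (V (e i))) (toFibre p ℓ S z)) : E' × E) := by
    rw [h1, h2]
    ext
    · simp [Prod.fst_sum]
    · simp [Prod.snd_sum]
  have h5 : Z (trivialization p ℓ S z) = (∑ k, b.coord k
      (mfderiv 𝓘(ℝ, E) 𝓘(ℝ, E') (fun y => relCoord E' ℓ (p y)) z (Y z) : E') •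
        liftFst (I₂ := 𝓘(ℝ, E)) (constField ℓ (b k)) (trivialization p ℓ S z)) +
      ∑ i, a (e i) z • liftSnd (I₁ := 𝓘(ℝ, E')) (vertPart E' p hor (V (e i)))
        (trivialization p ℓ S z) :=
    ((hXZ z hz).symm.trans (mfderiv_trivialization hconn hS hz (X z))).trans h4
  rw [hΦz] at h5
  exact h5

end Intertwining

end SingFol

theorem mainTheorem8
    {E : Type*} [NormedAddCommGroup E] [NormedSpace ℝ E] [FiniteDimensional ℝ E]
    {M : Type*} [TopologicalSpace M] [T2Space M] [SecondCountableTopology M]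
    [ChartedSpace E M] [IsManifold 𝓘(ℝ, E) ∞ M]
    {E' : Type*} [NormedAddCommGroup E'] [NormedSpace ℝ E'] [FiniteDimensional ℝ E']
    {L : Type*} [TopologicalSpace L] [T2Space L] [SecondCountableTopology L]
    [ChartedSpace E' L] [IsManifold 𝓘(ℝ, E') ∞ L]
    (F : SingFol.SingularFoliation 𝓘(ℝ, E) M)
    (j : L → M) (hL : SingFol.IsLocallyClosedLeaf F j 𝓘(ℝ, E'))
    (M_L : Set M) (p : M → L) (hor : (x : M) → Submodule ℝ (TangentSpace 𝓘(ℝ, E) x))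
    (hconn : SingFol.IsEhresmannFConnection F j 𝓘(ℝ, E') M_L p hor)
    (hcomplete : SingFol.IsCompleteConnection 𝓘(ℝ, E') M_L p hor)
    (ℓ : L) :
    ∃ (U : Set L) (Φ : M → L × M) (Ψ : L × M → M),
      IsOpen U ∧ ℓ ∈ U ∧
      SingFol.IsDiffeoBetween 𝓘(ℝ, E) (𝓘(ℝ, E').prod 𝓘(ℝ, E)) Φ Ψ
        (M_L ∩ p ⁻¹' U) (U ×ˢ SingFol.fibre M_L p ℓ) ∧
      (∀ m ∈ M_L ∩ p ⁻¹' U, (Φ m).1 = p m) ∧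
      SingFol.Intertwines 𝓘(ℝ, E) (𝓘(ℝ, E').prod 𝓘(ℝ, E)) Φ (M_L ∩ p ⁻¹' U)
        (F.onOpen (M_L ∩ p ⁻¹' U))
        (SingFol.prodFoliation U (SingFol.fullFoliation 𝓘(ℝ, E') U)
          (SingFol.fibre M_L p ℓ) (SingFol.fibreFoliation F 𝓘(ℝ, E') M_L p ℓ)) := by
  obtain ⟨R, hR, S, -, h⟩ := SingFol.exists_radial_transport hconn hcomplete ℓ
  have hS : SingFol.IsRadialTransport F M_L p ℓ R S :=
    ⟨hR, fun z hz => (h z hz).1, fun z hz => (h z hz).2.1, fun z hz => (h z hz).2.2.1,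
      fun z hz => (h z hz).2.2.2⟩
  refine ⟨SingFol.chartBall E' ℓ R, SingFol.trivialization p ℓ S, SingFol.trivializationInv ℓ S,
    SingFol.isOpen_chartBall, ⟨mem_extChartAt_source ℓ, Metric.mem_ball_self hR⟩,
    SingFol.isDiffeoBetween_trivialization hconn hS, fun _ _ => rfl, fun X Z hXZ =>
      ⟨SingFol.pushforward_mem_prodFoliation hconn hS hXZ,
        SingFol.mem_onOpen_of_pushforward_mem hconn hS hXZ⟩⟩
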